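/- A \emph{variety} of semigroups is a class of semigroups closed under homomorphic images, subsemigroups and direct products; the variety generated by a semigroup $S$ is the smallest variety containing $S$. A variety is \emph{finitely based} if it is the class of all semigroups satisfying some finite set of identities $u\approx v$, where $u,v$ are words (elements of the free semigroup) over a countably infinite alphabet. The \emph{indicator Burnside semigroups} are the following semigroups. Here a presentation whose relations involve $0$ is a presentation of a semigroup with zero; a presentation without the symbol $0$ is a plain semigroup presentation. $A=\langle x,y \mid x=x^{2};\ y^{2}=0;\ xy=yx\rangle$, $B=\langle x,y \mid x^{2}=0;\ y^{2}=0;\ xyx=yxy\rangle$, $C_{\lambda}=\langle x,y \mid x^{2}=x^{3};\ yx=y;\ x^{2}y=0;\ y^{2}=0\rangle$, $C_{\rho}=\langle x,y \mid x^{2}=x^{3};\ xy=y;\ yx^{2}=0;\ y^{2}=0\rangle$, $N_{3}=\langle x \mid x^{3}=0\rangle$, $D=\langle x,y \mid x^{2}=0;\ y=y^2;\ yxy=0\rangle$, $K_{n}=\langle x,y \mid x^{2}=0;\ y^{2}=y^{n+2};\ yxy=0;\ xy^{q}x=0\ (q=2,\dots,n);\ xyx=xy^{n+1}x\rangle$ for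 each integer $n\ge 1$, $F_{\lambda}=\langle x,y \mid xy=xyx=xy^{2};\ yx=yxy=yx^{2};\ x^{2}=x^{2}y=x^{3};\ y^{2}=y^{2}x=y^{3}\rangle$, $F_{\rho}=\langle x,y \mid xy=yxy=x^{2}y;\ yx=xyx=y^{2}x;\ x^{2}=yx^{2}=x^{3};\ y^{2}=xy^{2}=y^{3}\rangle$, $W_{\lambda}=\langle a,x,y \mid a^{2}=x^{2}=y^{2}=xy=yx=0;\ ax=axax;\ ay=ayay;\ xa=xaxa;\ ya=yaya;\ xay=xax;\ yax=yay\rangle$, $W_{\rho}=\langle a,x,y \mid a^{2}=x^{2}=y^{2}=xy=yx=0;\ xa=xaxa;\ ya=yaya;\ ax=axax;\ ay=ayay;\ xay=yay;\ yax=xax\rangle$, $L_{2}^{1}=\langle a,x,y \mid x=x^{2};\ y=y^{2};\ a=a^{2};\ xy=x;\ yx=y;\ ax=xa=x;\ ay=ya=y\rangle$, $R_{2}^{1}=\langle a,x,y \mid x=x^{2};\ y=y^{2};\ a=a^{2};\ xy=y;\ yx=x;\ ax=xa=x;\ ay=ya=y\rangle$. \textbf{Theorem.} Each indicator Burnside semigroup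 generates a finitely based variety. -/

import Mathlib

universe u

/-! ### Identities and varieties of semigroups -/

/-- A semigroup identity `p ≈ q`: a pair of words over a countably infinite alphabet. -/
abbrev SemigroupIdentity : Type := FreeSemigroup ℕ × FreeSemigroup ℕ

/-- The semigroup `M` satisfies the identity `e`. -/
def SatisfiesIdentity (M : Type u) [Semigroup M] (e : SemigroupIdentity) : Prop :=
  ∀ φ : FreeSemigroup ℕ →ₙ* M, φ e.1 = φ e.2

/-- The variety defined by a set of identities. -/
def varietyOfIdentities (E : Set SemigroupIdentity) : Set Semigrp.{u} :=
  {M | ∀ e ∈ E, SatisfiesIdentity M e}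

/-- A variety: a class of semigroups closed under homomorphic images, subsemigroups and
direct products. -/
structure IsSemigroupVariety (V : Set Semigrp.{u}) : Prop where
  image : ∀ (M N : Semigrp.{u}) (f : M →ₙ* N), Function.Surjective f → M ∈ V → N ∈ V
  sub : ∀ (M : Semigrp.{u}) (H : Subsemigroup M), M ∈ V → Semigrp.of H ∈ V
  prod : ∀ (I : Type u) (M : I → Semigrp.{u}), (∀ i, M i ∈ V) → Semigrp.of (∀ i, M i) ∈ V

/-- The variety generated by a semigroup `S`: the smallest variety containing `S`.
(`ULift` only moves `S` to the universe of the semigroups under consideration.) -/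
def varietyGeneratedBy (S : Semigrp.{0}) : Set Semigrp.{u} :=
  ⋂₀ {V | IsSemigroupVariety V ∧ Semigrp.of (ULift.{u} S) ∈ V}

/-- A class of semigroups is a finitely based variety if it is the class of all semigroups
that satisfy some finite set of identities. -/
def IsFinitelyBased (V : Set Semigrp.{u}) : Prop :=
  ∃ E : Set SemigroupIdentity, E.Finite ∧ V = varietyOfIdentities E

/-! ### Presentations -/

/-- The semigroup `⟨α ∣ R⟩`. -/
def presented {α : Type} (R : Set (FreeSemigroup α × FreeSemigroup α)) : Semigrp.{0} :=
  Semigrp.of (conGen fun p q => (p, q) ∈ R).Quotient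

/-- The semigroup with zero `⟨α ∣ R⟩`, where the relations may involve the symbol `0`:
the free semigroup over `α` with a zero adjoined, modulo the congruence generated by `R`. -/
def presentedWithZero {α : Type}
    (R : Set (WithZero (FreeSemigroup α) × WithZero (FreeSemigroup α))) : Semigrp.{0} :=
  Semigrp.of (conGen fun p q => (p, q) ∈ R).Quotient

/-- `powSucc m k` is the power `m ^ (k + 1)`. -/
def powSucc {M : Type} [Semigroup M] (m : M) : ℕ → M
  | 0 => m
  | k + 1 => powSucc m k * m

namespace IndicatorBurnside

/-- One generator. -/
inductive Gen1 : Type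
  | x

/-- Two generators. -/
inductive Gen2 : Type
  | x
  | y

/-- Three generators. -/
inductive Gen3 : Type
  | a
  | x
  | y

/-- A generator as an element of the free semigroup. -/
def gen {α : Type} (g : α) : FreeSemigroup α := FreeSemigroup.of g

/-- A generator as an element of the free semigroup with a zero adjoined. -/
def gen₀ {α : Type} (g : α) : WithZero (FreeSemigroup α) := (FreeSemigroup.of g : FreeSemigroup α)

/-- `A = ⟨x, y ∣ x = x², y² = 0, xy = yx⟩`. -/
def A : Semigrp.{0} :=
  let x := gen₀ Gen2.x
  let y := gen₀ Gen2.y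
  presentedWithZero {(x, x * x), (y * y, 0), (x * y, y * x)}

/-- `B = ⟨x, y ∣ x² = 0, y² = 0, xyx = yxy⟩`. -/
def B : Semigrp.{0} :=
  let x := gen₀ Gen2.x
  let y := gen₀ Gen2.y
  presentedWithZero {(x * x, 0), (y * y, 0), (x * y * x, y * x * y)}

/-- `C_λ = ⟨x, y ∣ x² = x³, yx = y, x²y = 0, y² = 0⟩`. -/
def Clam : Semigrp.{0} :=
  let x := gen₀ Gen2.x
  let y := gen₀ Gen2.y
  presentedWithZero {(x * x, x * x * x), (y * x, y), (x * x * y, 0), (y * y, 0)}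

/-- `C_ρ = ⟨x, y ∣ x² = x³, xy = y, yx² = 0, y² = 0⟩`. -/
def Crho : Semigrp.{0} :=
  let x := gen₀ Gen2.x
  let y := gen₀ Gen2.y
  presentedWithZero {(x * x, x * x * x), (x * y, y), (y * x * x, 0), (y * y, 0)}

/-- `N₃ = ⟨x ∣ x³ = 0⟩`. -/
def N3 : Semigrp.{0} :=
  let x := gen₀ Gen1.x
  presentedWithZero {(x * x * x, 0)}

/-- `D = ⟨x, y ∣ x² = 0, y = y², yxy = 0⟩`. -/
def D : Semigrp.{0} :=
  let x := gen₀ Gen2.x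
  let y := gen₀ Gen2.y
  presentedWithZero {(x * x, 0), (y, y * y), (y * x * y, 0)}

/-- `K_n = ⟨x, y ∣ x² = 0, y² = yⁿ⁺², yxy = 0, xy^qx = 0 (q = 2, …, n), xyx = xyⁿ⁺¹x⟩`. -/
def K (n : ℕ) : Semigrp.{0} :=
  let x := gen₀ Gen2.x
  let y := gen₀ Gen2.y
  presentedWithZero
    ({(x * x, 0), (y * y, powSucc y (n + 1)), (y * x * y, 0),
        (x * y * x, x * powSucc y n * x)} ∪
      {r | ∃ k : ℕ, 2 ≤ k + 1 ∧ k + 1 ≤ n ∧ r = (x * powSucc y k * x, 0)})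

/-- `F_λ = ⟨x, y ∣ xy = xyx = xy², yx = yxy = yx², x² = x²y = x³, y² = y²x = y³⟩`
(no zero element). -/
def Flam : Semigrp.{0} :=
  let x := gen Gen2.x
  let y := gen Gen2.y
  presented {(x * y, x * y * x), (x * y, x * y * y), (y * x, y * x * y), (y * x, y * x * x),
    (x * x, x * x * y), (x * x, x * x * x), (y * y, y * y * x), (y * y, y * y * y)}

/-- `F_ρ = ⟨x, y ∣ xy = yxy = x²y, yx = xyx = y²x, x² = yx² = x³, y² = xy² = y³⟩`
(no zero element). -/
def Frho : Semigrp.{0} :=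
  let x := gen Gen2.x
  let y := gen Gen2.y
  presented {(x * y, y * x * y), (x * y, x * x * y), (y * x, x * y * x), (y * x, y * y * x),
    (x * x, y * x * x), (x * x, x * x * x), (y * y, x * y * y), (y * y, y * y * y)}

/-- `W_λ = ⟨a, x, y ∣ a² = x² = y² = xy = yx = 0, ax = axax, ay = ayay, xa = xaxa,
ya = yaya, xay = xax, yax = yay⟩`. -/
def Wlam : Semigrp.{0} :=
  let a := gen₀ Gen3.a
  let x := gen₀ Gen3.x
  let y := gen₀ Gen3.y
  presentedWithZero {(a * a, 0), (x * x, 0), (y * y, 0), (x * y, 0), (y * x, 0),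
    (a * x, a * x * a * x), (a * y, a * y * a * y), (x * a, x * a * x * a),
    (y * a, y * a * y * a), (x * a * y, x * a * x), (y * a * x, y * a * y)}

/-- `W_ρ = ⟨a, x, y ∣ a² = x² = y² = xy = yx = 0, xa = xaxa, ya = yaya, ax = axax,
ay = ayay, xay = yay, yax = xax⟩`. -/
def Wrho : Semigrp.{0} :=
  let a := gen₀ Gen3.a
  let x := gen₀ Gen3.x
  let y := gen₀ Gen3.y
  presentedWithZero {(a * a, 0), (x * x, 0), (y * y, 0), (x * y, 0), (y * x, 0),
    (x * a, x * a * x * a), (y * a, y * a * y * a), (a * x, a * x * a * x),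
    (a * y, a * y * a * y), (x * a * y, y * a * y), (y * a * x, x * a * x)}

/-- `L₂¹ = ⟨a, x, y ∣ x = x², y = y², a = a², xy = x, yx = y, ax = xa = x, ay = ya = y⟩`
(no zero element). -/
def L21 : Semigrp.{0} :=
  let a := gen Gen3.a
  let x := gen Gen3.x
  let y := gen Gen3.y
  presented {(x, x * x), (y, y * y), (a, a * a), (x * y, x), (y * x, y),
    (a * x, x), (x * a, x), (a * y, y), (y * a, y)}

/-- `R₂¹ = ⟨a, x, y ∣ x = x², y = y², a = a², xy = y, yx = x, ax = xa = x, ay = ya = y⟩`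
(no zero element). -/
def R21 : Semigrp.{0} :=
  let a := gen Gen3.a
  let x := gen Gen3.x
  let y := gen Gen3.y
  presented {(x, x * x), (y, y * y), (a, a * a), (x * y, y), (y * x, x),
    (a * x, x), (x * a, x), (a * y, y), (y * a, y)}

end IndicatorBurnside

/-- The indicator Burnside semigroups; there is one semigroup `K_n` for each positive `n`. -/
inductive IsIndicatorBurnside : Semigrp.{0} → Prop
  | A : IsIndicatorBurnside IndicatorBurnside.A
  | B : IsIndicatorBurnside IndicatorBurnside.B
  | Clam : IsIndicatorBurnside IndicatorBurnside.Clam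
  | Crho : IsIndicatorBurnside IndicatorBurnside.Crho
  | N3 : IsIndicatorBurnside IndicatorBurnside.N3
  | D : IsIndicatorBurnside IndicatorBurnside.D
  | K (n : ℕ) (hn : 1 ≤ n) : IsIndicatorBurnside (IndicatorBurnside.K n)
  | Flam : IsIndicatorBurnside IndicatorBurnside.Flam
  | Frho : IsIndicatorBurnside IndicatorBurnside.Frho
  | Wlam : IsIndicatorBurnside IndicatorBurnside.Wlam
  | Wrho : IsIndicatorBurnside IndicatorBurnside.Wrho
  | L21 : IsIndicatorBurnside IndicatorBurnside.L21
  | R21 : IsIndicatorBurnside IndicatorBurnside.R21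

/-!
By Birkhoff's theorem (`varietyGeneratedBy_eq`) the variety generated by `S` is the class of all
semigroups that satisfy the identities of `S`, so it suffices that these identities follow from
finitely many of them (`HasFiniteBasis`). For each `S` the argument has two halves. The identities
of `S` force the two sides to agree in certain invariants of words, which are read off from
assignments of the letters in `S`, or in an image of `S` given by an explicit multiplication.
Conversely, finitely many identities of `S`, applied in an arbitrary semigroup with an identity
adjoined, suffice to transform into each other any two words with the same invariants. The
semigroups with index `ρ`, and `R₂¹`, are opposite to those with index `λ`, and to `L₂¹`, and
finite bases can be mirrored (`HasFiniteBasis.op`).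

* `B` and `N₃` are nilpotent and `F_λ` satisfies `xyz = xy`. One identity reduces each word to a
  bounded length, and up to renaming there are finitely many identities between bounded words
  (`hasFiniteBasis_of_bounded`).
* For `A` the basis is `xy = yx`, `x² = x³`; the invariants are the letters that occur and those
  that occur once. For `L₂¹` the basis is `x² = x`, `xyx = xy`; the invariant is the order of the
  first occurrences of the letters.
* In `C_λ` only the content of a word matters behind its second letter; the second letter matters
  if it is not repeated, and the first one if it or the second one is not repeated
  (`CLaws.evalList_eq`).
* In `D` and `K_n` only the content and the numbers of occurrences modulo `n` matter in the
  interior of a word; for `D` this is the case `n = 1`. The first and the last letter matter if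
  they are not repeated, and also in the special words `sws`, with `s` not in `w`, in which `w`
  can be evaluated to a generator of the cyclic group of order `n`. In the remaining words of the
  form `sws` the numbers of occurrences in `w` have a common divisor `d > 1` with `n`, and
  `x yᵈ x = x² yᵈ` removes the distinction (`KFullLaws.evalList_eq`).
* For `W_λ` letters are read as edges of a graph with two vertices, with arbitrary sources and
  targets. The main invariant of a word consists of its letters and of the colourings by two colours
  for which it is a walk; then it is determined which colourings by any set of colours make it a
  walk (`walk_iff_forall_bool`). A letter cuts a word if it occurs once and the parts before and
  after it have no common letter. Words without cut letters are von Neumann regular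
  (`WLaws.isRegular_evalList`), and the values of their prefixes form a colouring by the elements
  of the semigroup itself (`WLaws.exists_walk`). Applying it to a second regular word with the same
  walks shows that the values of both words are fixed by each other's idempotents, and
  commutation of idempotents makes them equal (`WLaws.evalList_eq_of_comm'`). Words with cut
  letters are treated part by part. At the beginning of a word fewer idempotents commute, whence
  the further invariants: the first letter, and the second letter unless the first one is a loop
  in every colouring that makes the word a walk (`WLaws.evalList_eq`).
-/

/-! ### Words as lists of letters -/

/-- The list of letters of a word; it is never empty. -/
def letters {β : Type*} (w : FreeSemigroup β) : List β := w.head :: w.tail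

/-- The value in a monoid of a list of letters under an assignment of the letters. -/
def evalList {β N : Type*} [Monoid N] (f : β → N) (l : List β) : N := (l.map f).prod

section EvalList

variable {β N : Type*} [Monoid N] (f : β → N)

@[simp] theorem evalList_nil : evalList f [] = 1 := rfl

@[simp] theorem evalList_cons (c : β) (l : List β) :
    evalList f (c :: l) = f c * evalList f l := by simp [evalList]

@[simp] theorem evalList_append (l m : List β) :
    evalList f (l ++ m) = evalList f l * evalList f m := by simp [evalList]

theorem evalList_congr {f g : β → N} {l : List β} (h : ∀ c ∈ l, f c = g c) :
    evalList f l = evalList g l := by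
  rw [evalList, evalList, List.map_congr_left h]

end EvalList

section Letters

variable {β : Type*}

@[simp] theorem letters_of (b : β) : letters (FreeSemigroup.of b) = [b] := rfl

@[simp] theorem letters_mul (v w : FreeSemigroup β) :
    letters (v * w) = letters v ++ letters w := by simp [letters]

theorem letters_injective : Function.Injective (letters (β := β)) := by
  intro v w h
  simp only [letters, List.cons.injEq] at h
  exact FreeSemigroup.ext h.1 h.2

theorem length_letters (w : FreeSemigroup β) : (letters w).length = w.length := by
  simp [letters, FreeSemigroup.length]

theorem letters_map {γ : Type*} (f : β → γ) (w : FreeSemigroup β) :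
    letters (FreeSemigroup.map f w) = (letters w).map f := by
  induction w using FreeSemigroup.recOnMul with
  | ih1 x => rfl
  | ih2 x y _ hy => simp [hy]

/-- Adjoining an identity turns the value of a word into a product over its letters. -/
theorem coe_lift {T : Type*} [Semigroup T] (f : β → T) (w : FreeSemigroup β) :
    ((FreeSemigroup.lift f w : T) : WithOne T) =
      evalList (fun b => (f b : WithOne T)) (letters w) := by
  induction w using FreeSemigroup.recOnMul with
  | ih1 x => simp
  | ih2 x y _ hy => simp [hy]

theorem lift_map {γ : Type*} {T : Type*} [Semigroup T] (f : γ → T) (ρ : β → γ)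
    (w : FreeSemigroup β) :
    FreeSemigroup.lift f (FreeSemigroup.map ρ w) = FreeSemigroup.lift (f ∘ ρ) w := by
  apply WithOne.coe_injective
  rw [coe_lift, coe_lift, letters_map]
  simp [evalList, Function.comp_def]

theorem lift_congr {T : Type*} [Semigroup T] {f g : β → T} {w : FreeSemigroup β}
    (h : ∀ c ∈ letters w, f c = g c) : FreeSemigroup.lift f w = FreeSemigroup.lift g w := by
  apply WithOne.coe_injective
  rw [coe_lift, coe_lift]
  exact evalList_congr fun c hc => by rw [h c hc]

end Letters

section WithZero

variable {M : Type*} [SemigroupWithZero M] {k : ℕ → M}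

theorem coe_zero_mul_evalList (l : List ℕ) :
    ((0 : M) : WithOne M) * evalList (fun c => (k c : WithOne M)) l = (0 : M) := by
  induction l with
  | nil => simp
  | cons c l ih => rw [evalList_cons, ← mul_assoc, ← WithOne.coe_mul, zero_mul, ih]

theorem coe_mul_evalList_eq_zero {l : List ℕ} {c : ℕ} (hc : c ∈ l) (hk : k c = 0) (p : M) :
    (p : WithOne M) * evalList (fun c => (k c : WithOne M)) l = (0 : M) := by
  induction l generalizing p with
  | nil => simp at hc
  | cons d l ih =>
    rw [evalList_cons, ← mul_assoc, ← WithOne.coe_mul]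
    by_cases h : c = d
    · rw [← h, hk, mul_zero, coe_zero_mul_evalList]
    · exact ih (by simpa [h] using hc) _

end WithZero

theorem satisfiesIdentity_iff_lift {T : Type*} [Semigroup T] (e : SemigroupIdentity) :
    SatisfiesIdentity T e ↔
      ∀ f : ℕ → T, FreeSemigroup.lift f e.1 = FreeSemigroup.lift f e.2 :=
  ⟨fun h f => h _, fun h φ => by
    have := h (φ ∘ FreeSemigroup.of)
    rwa [FreeSemigroup.lift_comp_of'] at this⟩

theorem satisfiesIdentity_iff_evalList {T : Type*} [Semigroup T] (e : SemigroupIdentity) :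
    SatisfiesIdentity T e ↔ ∀ f : ℕ → T,
      evalList (fun b => (f b : WithOne T)) (letters e.1) =
        evalList (fun b => (f b : WithOne T)) (letters e.2) := by
  simp only [satisfiesIdentity_iff_lift, ← coe_lift, WithOne.coe_inj]

theorem SatisfiesIdentity.of_surjective {S T : Type*} [Semigroup S] [Semigroup T]
    (f : S →ₙ* T) (hf : Function.Surjective f) {e : SemigroupIdentity}
    (h : SatisfiesIdentity S e) : SatisfiesIdentity T e := by
  rw [satisfiesIdentity_iff_lift] at h ⊢
  intro g
  choose k hk using hf
  have key : ∀ w, FreeSemigroup.lift g w = f (FreeSemigroup.lift (k ∘ g) w) := by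
    intro w
    induction w using FreeSemigroup.recOnMul with
    | ih1 x => simp [hk]
    | ih2 x y _ hy => simp [hy, hk]
  rw [key, key, h]

theorem SatisfiesIdentity.of_injective {S T : Type*} [Semigroup S] [Semigroup T]
    (f : S →ₙ* T) (hf : Function.Injective f) {e : SemigroupIdentity}
    (h : SatisfiesIdentity T e) : SatisfiesIdentity S e := by
  intro φ
  exact hf (h (f.comp φ))

/-! ### Finite bases of identities and Birkhoff's theorem -/

/-- The identities of the semigroup `S` follow, in all semigroups of the universe `u`, from
finitely many of them. -/
def HasFiniteBasis (S : Type) [Semigroup S] : Prop :=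
  ∃ E : Set SemigroupIdentity, E.Finite ∧ (∀ e ∈ E, SatisfiesIdentity S e) ∧
    ∀ (T : Type u) [Semigroup T], (∀ e ∈ E, SatisfiesIdentity T e) →
      ∀ e, SatisfiesIdentity S e → SatisfiesIdentity T e

theorem HasFiniteBasis.congr {S S' : Type} [Semigroup S] [Semigroup S']
    (h : ∀ e, SatisfiesIdentity S e ↔ SatisfiesIdentity S' e)
    (hS : HasFiniteBasis.{u} S) : HasFiniteBasis.{u} S' := by
  obtain ⟨E, hE, h1, h2⟩ := hS
  exact ⟨E, hE, fun e he => (h e).1 (h1 e he), fun T _ hT e he => h2 T hT e ((h e).2 he)⟩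

theorem isSemigroupVariety_varietyOfIdentities (E : Set SemigroupIdentity) :
    IsSemigroupVariety (varietyOfIdentities.{u} E) where
  image _ _ f hf hM e he := (hM e he).of_surjective f hf
  sub _ H hM e he := (hM e he).of_injective (MulMemClass.subtype H) Subtype.val_injective
  prod I M hM e he := by
    intro φ
    funext i
    exact hM i e he ((Pi.evalMulHom (fun i => (M i : Type u)) i).comp φ)

/-- Finitely many elements can be named by natural numbers. -/
theorem exists_naming {β : Type*} [Nonempty β] (L : List β) :
    ∃ (ρ : β → ℕ) (κ : ℕ → β), ∀ b ∈ L, κ (ρ b) = b ∧ ρ b < L.length := by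
  classical
  refine ⟨fun b => L.idxOf b, fun n => L.getD n (Classical.arbitrary β), fun b hb => ?_⟩
  have h := List.idxOf_lt_length_of_mem hb
  exact ⟨by simp [h], h⟩

/-- Birkhoff's theorem for one semigroup: the variety that it generates consists of the
semigroups that satisfy all its identities. -/
theorem varietyGeneratedBy_eq (S : Semigrp.{0}) :
    varietyGeneratedBy.{u} S = varietyOfIdentities {e | SatisfiesIdentity S e} := by
  apply Set.Subset.antisymm
  · refine Set.sInter_subset_of_mem ⟨isSemigroupVariety_varietyOfIdentities _, fun e he => ?_⟩
    exact SatisfiesIdentity.of_injective (S := ULift.{u} S) (T := S)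
      (MulEquiv.ulift.toMulHom) MulEquiv.ulift.injective he
  · rintro M hM V ⟨hV, hS⟩
    -- the free semigroup over `M`, evaluated in all ways in `S`, maps onto `M`
    let P : Type u := ∀ _ : M → ULift.{u} S, ULift.{u} S
    let f : FreeSemigroup M →ₙ* P := FreeSemigroup.lift fun m φ => φ m
    let g : FreeSemigroup M →ₙ* M := FreeSemigroup.lift id
    have hf : ∀ w φ, f w φ = FreeSemigroup.lift φ w := by
      intro w φ
      induction w using FreeSemigroup.recOnMul with
      | ih1 x => simp [f]
      | ih2 x y _ hy =>
        rw [map_mul, map_mul, ← hy]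
        exact congrArg (· * f y φ) (by simp [f])
    have key : ∀ v w, f v = f w → g v = g w := by
      intro v w h
      have : Nonempty M := ⟨v.head⟩
      obtain ⟨ρ, κ, hρ⟩ := exists_naming (letters v ++ letters w)
      have hid : SatisfiesIdentity M (FreeSemigroup.map ρ v, FreeSemigroup.map ρ w) := by
        apply hM
        change SatisfiesIdentity S _
        rw [satisfiesIdentity_iff_lift]
        intro φ
        have := congrFun h (fun m => ULift.up (φ (ρ m)))
        rw [hf, hf] at this
        have hu : ∀ z : FreeSemigroup M, FreeSemigroup.lift φ (FreeSemigroup.map ρ z) =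
            (FreeSemigroup.lift (fun m => ULift.up.{u} (φ (ρ m))) z).down := by
          intro z
          rw [lift_map]
          induction z using FreeSemigroup.recOnMul with
          | ih1 x => simp
          | ih2 x y _ hy => simp [hy]
        rw [hu, hu, this]
      rw [satisfiesIdentity_iff_lift] at hid
      have := hid κ
      rw [lift_map, lift_map] at this
      simp only [g]
      rw [lift_congr (g := κ ∘ ρ), this, lift_congr]
      · intro c hc; exact (hρ c (by simp [hc])).1
      · intro c hc; exact ((hρ c (by simp [hc])).1).symm
    have hsurj : ∀ x : MulHom.srange f, ∃ w, f w = x := fun x => x.2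
    choose k hk using hsurj
    let h : MulHom.srange f →ₙ* M :=
      { toFun := fun x => g (k x)
        map_mul' := fun x y => by
          rw [← map_mul]
          apply key
          rw [map_mul, hk, hk, hk]; rfl }
    have hP : Semigrp.of P ∈ V := hV.prod _ _ fun _ => hS
    refine hV.image (Semigrp.of (MulHom.srange f)) M h ?_ (hV.sub (Semigrp.of P) (MulHom.srange f) hP)
    intro m
    refine ⟨⟨f (FreeSemigroup.of m), _, rfl⟩, ?_⟩
    exact (key _ (FreeSemigroup.of m) (hk _)).trans (by simp [g])

theorem HasFiniteBasis.isFinitelyBased {S : Semigrp.{0}} (h : HasFiniteBasis.{u} S) :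
    IsFinitelyBased (varietyGeneratedBy.{u} S) := by
  obtain ⟨E, hE, h1, h2⟩ := h
  refine ⟨E, hE, ?_⟩
  rw [varietyGeneratedBy_eq]
  ext M
  exact ⟨fun hM e he => hM e (h1 e he), fun hM e he => h2 M hM e he⟩

/-! ### Opposite semigroups -/

/-- The mirror image of a word. -/
def mirror (w : FreeSemigroup ℕ) : FreeSemigroup ℕ :=
  (FreeSemigroup.lift (fun n => MulOpposite.op (FreeSemigroup.of n)) w).unop

theorem mirror_mirror (w : FreeSemigroup ℕ) : mirror (mirror w) = w := by
  have hm : ∀ v w, mirror (v * w) = mirror w * mirror v := fun v w => by simp [mirror]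
  induction w using FreeSemigroup.recOnMul with
  | ih1 x => rfl
  | ih2 x y _ hy => rw [hm, hm, hy]; rfl

theorem satisfiesIdentity_op {T : Type*} [Semigroup T] (e : SemigroupIdentity) :
    SatisfiesIdentity Tᵐᵒᵖ e ↔ SatisfiesIdentity T (mirror e.1, mirror e.2) := by
  have key : ∀ (f : ℕ → T) w, FreeSemigroup.lift f (mirror w) =
      (FreeSemigroup.lift (MulOpposite.op ∘ f) w).unop := by
    intro f w
    induction w using FreeSemigroup.recOnMul with
    | ih1 x => simp [mirror]
    | ih2 x y _ hy => simp [mirror] at hy; simp [mirror, hy]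
  rw [satisfiesIdentity_iff_lift, satisfiesIdentity_iff_lift]
  constructor
  · intro h f
    rw [key, key, h]
  · intro h f
    have := h (MulOpposite.unop ∘ f)
    rw [key, key, MulOpposite.unop_inj] at this
    exact this

theorem HasFiniteBasis.op {S : Type} [Semigroup S] (h : HasFiniteBasis.{u} S) :
    HasFiniteBasis.{u} Sᵐᵒᵖ := by
  obtain ⟨E, hE, h1, h2⟩ := h
  refine ⟨(fun e => (mirror e.1, mirror e.2)) '' E, hE.image _, ?_, ?_⟩
  · rintro _ ⟨e, he, rfl⟩
    rw [satisfiesIdentity_op]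
    simpa [mirror_mirror] using h1 e he
  · intro T _ hT e he
    rw [satisfiesIdentity_op] at he
    have := h2 Tᵐᵒᵖ (fun e he => ?_) _ he
    · rw [satisfiesIdentity_op] at this
      simpa [mirror_mirror] using this
    · rw [satisfiesIdentity_op]
      exact hT _ ⟨e, he, rfl⟩

/-! ### Identities given by words of bounded length -/

/-- If finitely many identities of `S` reduce every word to a word of bounded length, then `S` has
a finite basis of identities: the remaining identities involve finitely many words only. -/
theorem hasFiniteBasis_of_bounded {S : Type} [Semigroup S] (E : Set SemigroupIdentity)
    (hE : E.Finite) (hS : ∀ e ∈ E, SatisfiesIdentity S e) (k : ℕ)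
    (hk : ∀ w : FreeSemigroup ℕ, ∃ w' : FreeSemigroup ℕ, w'.length ≤ k ∧
      SatisfiesIdentity S (w, w') ∧
      ∀ (T : Type u) [Semigroup T], (∀ e ∈ E, SatisfiesIdentity T e) →
        SatisfiesIdentity T (w, w')) :
    HasFiniteBasis.{u} S := by
  have hfin : {w : FreeSemigroup ℕ | w.length ≤ k ∧ ∀ n ∈ letters w, n < 2 * k}.Finite := by
    have h1 : {l : List (Fin (2 * k)) | l.length ≤ k}.Finite := List.finite_length_le _ k
    have h2 := h1.image (List.map Fin.val)
    refine (h2.preimage letters_injective.injOn).subset ?_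
    rintro w ⟨hw, hn⟩
    refine ⟨(letters w).attach.map fun n => ⟨n.1, hn n.1 n.2⟩, ?_, ?_⟩
    · simpa [length_letters] using hw
    · simp [List.map_map, Function.comp_def]
  refine ⟨E ∪ {e | SatisfiesIdentity S e ∧
      (e.1.length ≤ k ∧ ∀ n ∈ letters e.1, n < 2 * k) ∧
      (e.2.length ≤ k ∧ ∀ n ∈ letters e.2, n < 2 * k)}, hE.union ?_, ?_, ?_⟩
  · exact (hfin.prod hfin).subset fun e he => ⟨he.2.1, he.2.2⟩
  · rintro e (he | he)
    · exact hS e he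
    · exact he.1
  · rintro T _ hT ⟨p, q⟩ he
    obtain ⟨p', hp', hSp, hTp⟩ := hk p
    obtain ⟨q', hq', hSq, hTq⟩ := hk q
    have hTE : ∀ e ∈ E, SatisfiesIdentity T e := fun e he => hT e (Or.inl he)
    have hS' : SatisfiesIdentity S (p', q') := fun φ =>
      (hSp φ).symm.trans ((he φ).trans (hSq φ))
    obtain ⟨ρ, κ, hρ⟩ := exists_naming (letters p' ++ letters q')
    have hlt : (letters p' ++ letters q').length ≤ 2 * k := by
      simp only [List.length_append, length_letters]; omega
    have hmem : SatisfiesIdentity T (FreeSemigroup.map ρ p', FreeSemigroup.map ρ q') := by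
      refine hT _ (Or.inr ⟨?_, ⟨?_, ?_⟩, ⟨?_, ?_⟩⟩)
      · rw [satisfiesIdentity_iff_lift] at hS' ⊢
        intro f
        rw [lift_map, lift_map]
        exact hS' _
      · simpa using hp'
      · intro n hn
        rw [letters_map, List.mem_map] at hn
        obtain ⟨b, hb, rfl⟩ := hn
        exact (hρ b (by simp [hb])).2.trans_le hlt
      · simpa using hq'
      · intro n hn
        rw [letters_map, List.mem_map] at hn
        obtain ⟨b, hb, rfl⟩ := hn
        exact (hρ b (by simp [hb])).2.trans_le hlt
    have hT' : SatisfiesIdentity T (p', q') := by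
      rw [satisfiesIdentity_iff_lift] at hmem ⊢
      intro f
      have := hmem (f ∘ κ)
      rw [lift_map, lift_map] at this
      refine (lift_congr ?_).trans (this.trans (lift_congr ?_))
      · intro c hc; simp [(hρ c (by simp [hc])).1]
      · intro c hc; simp [(hρ c (by simp [hc])).1]
    exact fun φ => (hTp T hTE φ).trans ((hT' φ).trans (hTq T hTE φ).symm)

/-! ### Homomorphisms from presented semigroups -/

section Presented

variable {α : Type}

/-- The homomorphism from a presented semigroup given by images of the generators that satisfy
the relations. -/
def presentedLift {R : Set (FreeSemigroup α × FreeSemigroup α)} {T : Type*} [Semigroup T]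
    (f : α → T) (hf : ∀ r ∈ R, FreeSemigroup.lift f r.1 = FreeSemigroup.lift f r.2) :
    presented R →ₙ* T where
  toFun q := Con.liftOn q (FreeSemigroup.lift f) fun a b h => by
    have : conGen (fun p q => (p, q) ∈ R) ≤ Con.ker (FreeSemigroup.lift f) :=
      Con.conGen_le.2 fun x y hxy => hf _ hxy
    exact this h
  map_mul' a b := Con.induction_on₂ a b fun x y => (FreeSemigroup.lift f).map_mul x y

/-- A generator of a presented semigroup. -/
def presentedGen (R : Set (FreeSemigroup α × FreeSemigroup α)) (a : α) : presented R :=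
  ((FreeSemigroup.of a : FreeSemigroup α) : (conGen fun p q => (p, q) ∈ R).Quotient)

/-- The value of a word in the generators. -/
theorem presented_mk_eq (R : Set (FreeSemigroup α × FreeSemigroup α)) (w : FreeSemigroup α) :
    ((w : (conGen fun p q => (p, q) ∈ R).Quotient) : presented R) =
      FreeSemigroup.lift (presentedGen R) w := by
  induction w using FreeSemigroup.recOnMul with
  | ih1 x => rfl
  | ih2 x y _ hy => rw [map_mul, ← hy]; rfl

theorem presented_relation {R : Set (FreeSemigroup α × FreeSemigroup α)}
    {r : FreeSemigroup α × FreeSemigroup α} (hr : r ∈ R) :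
    FreeSemigroup.lift (presentedGen R) r.1 = FreeSemigroup.lift (presentedGen R) r.2 := by
  rw [← presented_mk_eq, ← presented_mk_eq]
  exact (Con.eq _).2 (ConGen.Rel.of _ _ hr)

theorem presented_induction {R : Set (FreeSemigroup α × FreeSemigroup α)}
    {P : presented R → Prop} (gen : ∀ a, P (presentedGen R a))
    (mul : ∀ a s, P s → P (presentedGen R a * s)) (s : presented R) : P s := by
  refine Con.induction_on s fun w => ?_
  rw [presented_mk_eq]
  induction w using FreeSemigroup.recOnMul with
  | ih1 x => exact gen x
  | ih2 x y _ hy => rw [map_mul]; exact mul x _ hy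

/-- Extension of a map on the generators to words and the symbol `0`. -/
def liftZero {T : Type*} [SemigroupWithZero T] (f : α → T) :
    WithZero (FreeSemigroup α) →ₙ* T where
  toFun w := WithZero.recZeroCoe 0 (FreeSemigroup.lift f) w
  map_mul' v w := by
    induction v using WithZero.recZeroCoe with
    | zero => simp
    | coe v =>
      induction w using WithZero.recZeroCoe with
      | zero => simp
      | coe w => exact (FreeSemigroup.lift f).map_mul v w

@[simp] theorem liftZero_zero {T : Type*} [SemigroupWithZero T] (f : α → T) :
    liftZero f 0 = 0 := rfl

@[simp] theorem liftZero_gen₀ {T : Type*} [SemigroupWithZero T] (f : α → T) (a : α) :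
    liftZero f (IndicatorBurnside.gen₀ a) = f a := rfl

variable {R : Set (WithZero (FreeSemigroup α) × WithZero (FreeSemigroup α))}

instance : SemigroupWithZero (presentedWithZero R) where
  zero := ((0 : WithZero (FreeSemigroup α)) : (conGen fun p q => (p, q) ∈ R).Quotient)
  zero_mul a := Con.induction_on a fun w =>
    congrArg (fun z : WithZero (FreeSemigroup α) =>
      (z : (conGen fun p q => (p, q) ∈ R).Quotient)) (zero_mul w)
  mul_zero a := Con.induction_on a fun w =>
    congrArg (fun z : WithZero (FreeSemigroup α) =>
      (z : (conGen fun p q => (p, q) ∈ R).Quotient)) (mul_zero w)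

/-- The homomorphism from a presented semigroup with zero given by images of the generators that
satisfy the relations. -/
def presentedWithZeroLift {T : Type*} [SemigroupWithZero T] (f : α → T)
    (hf : ∀ r ∈ R, liftZero f r.1 = liftZero f r.2) : presentedWithZero R →ₙ* T where
  toFun q := Con.liftOn q (liftZero f) fun a b h => by
    have : conGen (fun p q => (p, q) ∈ R) ≤ Con.ker (liftZero f) :=
      Con.conGen_le.2 fun x y hxy => hf _ hxy
    exact this h
  map_mul' a b := Con.induction_on₂ a b fun x y => (liftZero f).map_mul x y

variable (R) in
/-- A generator of a presented semigroup with zero. -/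
def presentedWithZeroGen (a : α) : presentedWithZero R :=
  ((IndicatorBurnside.gen₀ a : WithZero (FreeSemigroup α)) :
    (conGen fun p q => (p, q) ∈ R).Quotient)

variable (R) in
/-- The value of a word, or of `0`, in the generators. -/
theorem presentedWithZero_mk_eq (w : WithZero (FreeSemigroup α)) :
    ((w : (conGen fun p q => (p, q) ∈ R).Quotient) : presentedWithZero R) =
      liftZero (presentedWithZeroGen R) w := by
  induction w using WithZero.recZeroCoe with
  | zero => rfl
  | coe w =>
    induction w using FreeSemigroup.recOnMul with
    | ih1 x => rfl
    | ih2 x y _ hy => rw [WithZero.coe_mul, map_mul, ← hy]; rfl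

theorem presentedWithZero_relation
    {r : WithZero (FreeSemigroup α) × WithZero (FreeSemigroup α)} (hr : r ∈ R) :
    liftZero (presentedWithZeroGen R) r.1 = liftZero (presentedWithZeroGen R) r.2 := by
  rw [← presentedWithZero_mk_eq, ← presentedWithZero_mk_eq]
  exact (Con.eq _).2 (ConGen.Rel.of _ _ hr)

theorem presentedWithZero_induction {P : presentedWithZero R → Prop} (zero : P 0)
    (gen : ∀ a, P (presentedWithZeroGen R a))
    (mul : ∀ a s, P s → P (presentedWithZeroGen R a * s)) (s : presentedWithZero R) : P s := by
  refine Con.induction_on s fun w => ?_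
  rw [presentedWithZero_mk_eq]
  induction w using WithZero.recZeroCoe with
  | zero => exact zero
  | coe w =>
    induction w using FreeSemigroup.recOnMul with
    | ih1 x => exact gen x
    | ih2 x y _ hy => rw [WithZero.coe_mul, map_mul]; exact mul x _ hy

/-- `S` is presented by `R`, as a semigroup without zero, on the generators `g`. -/
structure IsPlainPresentation (R : Set (FreeSemigroup α × FreeSemigroup α))
    {S : Type} [Semigroup S] (g : α → S) : Prop where
  relation : ∀ r ∈ R, FreeSemigroup.lift g r.1 = FreeSemigroup.lift g r.2
  induction : ∀ P : S → Prop, (∀ a, P (g a)) → (∀ a s, P s → P (g a * s)) → ∀ s, P s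
  exists_hom : ∀ (T : Type) [Semigroup T] (f : α → T),
    (∀ r ∈ R, FreeSemigroup.lift f r.1 = FreeSemigroup.lift f r.2) →
      ∃ F : S →ₙ* T, ∀ a, F (g a) = f a

theorem HasFiniteBasis.of_plainPresentation {R : Set (FreeSemigroup α × FreeSemigroup α)}
    (h : ∀ (S : Type) [Semigroup S] (g : α → S),
      IsPlainPresentation R g → HasFiniteBasis.{u} S) : HasFiniteBasis.{u} (presented R) :=
  h _ (presentedGen R) ⟨fun _ => presented_relation, fun _ => presented_induction,
    fun _ _ f hf => ⟨presentedLift f hf, fun _ => rfl⟩⟩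

/-- `S` is presented by `R`, as a semigroup with zero, on the generators `g`. -/
structure IsPresentation (R : Set (WithZero (FreeSemigroup α) × WithZero (FreeSemigroup α)))
    {S : Type} [SemigroupWithZero S] (g : α → S) : Prop where
  relation : ∀ r ∈ R, liftZero g r.1 = liftZero g r.2
  induction : ∀ P : S → Prop, P 0 → (∀ a, P (g a)) → (∀ a s, P s → P (g a * s)) → ∀ s, P s
  exists_hom : ∀ (T : Type) [SemigroupWithZero T] (f : α → T),
    (∀ r ∈ R, liftZero f r.1 = liftZero f r.2) → ∃ F : S →ₙ* T, F 0 = 0 ∧ ∀ a, F (g a) = f a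

theorem isPresentation_presentedWithZero
    (R : Set (WithZero (FreeSemigroup α) × WithZero (FreeSemigroup α))) :
    IsPresentation R (presentedWithZeroGen R) where
  relation _ := presentedWithZero_relation
  induction _ := presentedWithZero_induction
  exists_hom _ _ f hf := ⟨presentedWithZeroLift f hf, rfl, fun _ => rfl⟩

/-- `S` satisfies the identities of a semigroup `M` if `M` is a complete list of normal forms
for it: `k` writes the elements of `M` in the generators, and the relations suffice to compute the
products of a generator and a normal form. -/
theorem IsPresentation.satisfies {S : Type} [SemigroupWithZero S] {g : α → S}
    (hS : IsPresentation R g) {M : Type} [SemigroupWithZero M] {f : α → M} (F : S →ₙ* M)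
    (hF0 : F 0 = 0) (hF : ∀ a, F (g a) = f a) (k : M → S) (h0 : k 0 = 0)
    (hk : ∀ a, k (f a) = g a) (hmul : ∀ a m, g a * k m = k (f a * m)) {e : SemigroupIdentity}
    (he : SatisfiesIdentity M e) : SatisfiesIdentity S e := by
  refine SatisfiesIdentity.of_injective F ?_ he
  refine Function.LeftInverse.injective (g := k) fun s => ?_
  refine hS.induction (fun s => k (F s) = s) ?_ ?_ ?_ s
  · rw [hF0, h0]
  · intro a; rw [hF, hk]
  · intro a s hs; rw [map_mul, hF, ← hmul, hs]

theorem HasFiniteBasis.of_presentation (h : ∀ (S : Type) [SemigroupWithZero S] (g : α → S),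
    IsPresentation R g → HasFiniteBasis.{u} S) : HasFiniteBasis.{u} (presentedWithZero R) :=
  h _ _ (isPresentation_presentedWithZero R)

end Presented

/-! ### Assignments and opposite presentations -/

/-- The assignment `0 ↦ l[0], 1 ↦ l[1], …` of the letters, with default value `d`. -/
def assign {T : Type*} (l : List T) (d : T) (n : ℕ) : T := l.getD n d

@[simp] theorem assign_zero {T : Type*} (a : T) (l : List T) (d : T) :
    assign (a :: l) d 0 = a := rfl

@[simp] theorem assign_one {T : Type*} (a : T) (l : List T) (d : T) :
    assign (a :: l) d 1 = assign l d 0 := rfl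

@[simp] theorem assign_two {T : Type*} (a : T) (l : List T) (d : T) :
    assign (a :: l) d 2 = assign l d 1 := rfl

@[simp] theorem assign_three {T : Type*} (a : T) (l : List T) (d : T) :
    assign (a :: l) d 3 = assign l d 2 := rfl

theorem SatisfiesIdentity.lift_eq {T : Type*} [Semigroup T] {p q : FreeSemigroup ℕ}
    (h : SatisfiesIdentity T (p, q)) (f : ℕ → T) :
    FreeSemigroup.lift f p = FreeSemigroup.lift f q :=
  (satisfiesIdentity_iff_lift _).1 h f

theorem lift_comp_hom {β S T : Type*} [Semigroup S] [Semigroup T] (F : S →ₙ* T) (f : β → S)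
    (w : FreeSemigroup β) : FreeSemigroup.lift (F ∘ f) w = F (FreeSemigroup.lift f w) := by
  induction w using FreeSemigroup.recOnMul with
  | ih1 x => simp
  | ih2 x y _ hy => simp [hy]

theorem lift_eq_evalList {β N : Type*} [Monoid N] (f : β → N) (w : FreeSemigroup β) :
    FreeSemigroup.lift f w = evalList f (letters w) := by
  induction w using FreeSemigroup.recOnMul with
  | ih1 x => simp
  | ih2 x y _ hy => simp [hy]

/-- An identity of `S` holds under each assignment by images of elements of `S` in a monoid. -/
theorem SatisfiesIdentity.evalList_eq {S N : Type*} [Semigroup S] [Monoid N]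
    {e : SemigroupIdentity} (h : SatisfiesIdentity S e) (F : S →ₙ* N) (f : ℕ → S) :
    evalList (fun c => F (f c)) (letters e.1) = evalList (fun c => F (f c)) (letters e.2) := by
  have := congrArg F ((satisfiesIdentity_iff_lift _).1 h f)
  rwa [← lift_comp_hom, ← lift_comp_hom, lift_eq_evalList, lift_eq_evalList] at this

/-- Two semigroups each of which is an image of the opposite of the other satisfy mirrored
identities. -/
theorem HasFiniteBasis.of_op {S S' : Type} [Semigroup S] [Semigroup S']
    (h : HasFiniteBasis.{u} S) (f : S →ₙ* S'ᵐᵒᵖ) (hf : Function.Surjective f)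
    (g : S' →ₙ* Sᵐᵒᵖ) (hg : Function.Surjective g) : HasFiniteBasis.{u} S' := by
  refine h.op.congr fun e => ⟨fun he => ?_, fun he => he.of_surjective g hg⟩
  rw [satisfiesIdentity_op] at he
  have := he.of_surjective f hf
  rw [satisfiesIdentity_op] at this
  simpa [mirror_mirror] using this

section OpPresented

variable {α : Type}

theorem presentedLift_op_surjective {R R' : Set (FreeSemigroup α × FreeSemigroup α)}
    (hf : ∀ r ∈ R, FreeSemigroup.lift (fun a => MulOpposite.op (presentedGen R' a)) r.1 =
      FreeSemigroup.lift (fun a => MulOpposite.op (presentedGen R' a)) r.2) :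
    Function.Surjective (presentedLift _ hf) := by
  suffices h : ∀ s : presented R', ∃ t, presentedLift _ hf t = MulOpposite.op s from
    fun s => h s.unop
  intro s
  induction s using presented_induction with
  | gen a => exact ⟨presentedGen R a, rfl⟩
  | mul a s hs =>
    obtain ⟨t, ht⟩ := hs
    exact ⟨t * presentedGen R a, by rw [map_mul, ht]; rfl⟩

/-- Reversing the relations of a presentation preserves the existence of a finite basis. -/
theorem HasFiniteBasis.presented_op {R R' : Set (FreeSemigroup α × FreeSemigroup α)}
    (h : HasFiniteBasis.{u} (presented R))
    (hf : ∀ (S : Type) [Semigroup S] (g : α → S),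
      (∀ r ∈ R', FreeSemigroup.lift g r.1 = FreeSemigroup.lift g r.2) →
      ∀ r ∈ R, FreeSemigroup.lift (fun a => MulOpposite.op (g a)) r.1 =
        FreeSemigroup.lift (fun a => MulOpposite.op (g a)) r.2)
    (hg : ∀ (S : Type) [Semigroup S] (g : α → S),
      (∀ r ∈ R, FreeSemigroup.lift g r.1 = FreeSemigroup.lift g r.2) →
      ∀ r ∈ R', FreeSemigroup.lift (fun a => MulOpposite.op (g a)) r.1 =
        FreeSemigroup.lift (fun a => MulOpposite.op (g a)) r.2) :
    HasFiniteBasis.{u} (presented R') :=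
  h.of_op _ (presentedLift_op_surjective (hf _ _ fun _ => presented_relation)) _
    (presentedLift_op_surjective (hg _ _ fun _ => presented_relation))

theorem presentedWithZeroLift_op_surjective
    {R R' : Set (WithZero (FreeSemigroup α) × WithZero (FreeSemigroup α))}
    (hf : ∀ r ∈ R, liftZero (fun a => MulOpposite.op (presentedWithZeroGen R' a)) r.1 =
      liftZero (fun a => MulOpposite.op (presentedWithZeroGen R' a)) r.2) :
    Function.Surjective (presentedWithZeroLift _ hf) := by
  suffices h : ∀ s : presentedWithZero R', ∃ t,
      presentedWithZeroLift _ hf t = MulOpposite.op s from fun s => h s.unop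
  intro s
  induction s using presentedWithZero_induction with
  | zero => exact ⟨0, rfl⟩
  | gen a => exact ⟨presentedWithZeroGen R a, rfl⟩
  | mul a s hs =>
    obtain ⟨t, ht⟩ := hs
    exact ⟨t * presentedWithZeroGen R a, by rw [map_mul, ht]; rfl⟩

/-- Reversing the relations of a presentation with zero preserves the existence of a finite
basis. -/
theorem HasFiniteBasis.presentedWithZero_op
    {R R' : Set (WithZero (FreeSemigroup α) × WithZero (FreeSemigroup α))}
    (h : HasFiniteBasis.{u} (presentedWithZero R))
    (hf : ∀ (S : Type) [SemigroupWithZero S] (g : α → S),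
      (∀ r ∈ R', liftZero g r.1 = liftZero g r.2) →
      ∀ r ∈ R, liftZero (fun a => MulOpposite.op (g a)) r.1 =
        liftZero (fun a => MulOpposite.op (g a)) r.2)
    (hg : ∀ (S : Type) [SemigroupWithZero S] (g : α → S),
      (∀ r ∈ R, liftZero g r.1 = liftZero g r.2) →
      ∀ r ∈ R', liftZero (fun a => MulOpposite.op (g a)) r.1 =
        liftZero (fun a => MulOpposite.op (g a)) r.2) :
    HasFiniteBasis.{u} (presentedWithZero R') :=
  h.of_op _ (presentedWithZeroLift_op_surjective (hf _ _ fun _ => presentedWithZero_relation)) _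
    (presentedWithZeroLift_op_surjective (hg _ _ fun _ => presentedWithZero_relation))

end OpPresented

/-- A variable of the alphabet `ℕ`, as a word. -/
abbrev var (n : ℕ) : FreeSemigroup ℕ := FreeSemigroup.of n

/-! ### The semigroups `B`, `N₃`, `F_λ`, `F_ρ`: bounded words -/

theorem FreeSemigroup.eq_of_or_mul {α : Type*} (w : FreeSemigroup α) :
    (∃ a, w = FreeSemigroup.of a) ∨ ∃ a v, w = FreeSemigroup.of a * v := by
  induction w using FreeSemigroup.recOnMul with
  | ih1 x => exact Or.inl ⟨x, rfl⟩
  | ih2 x y _ _ => exact Or.inr ⟨x, y, rfl⟩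

/-- A semigroup in which all products of four factors agree has a finite basis. -/
theorem hasFiniteBasis_of_nilpotent {S : Type} [Semigroup S]
    (h : ∀ a b c d a' b' c' d' : S, a * b * c * d = a' * b' * c' * d') :
    HasFiniteBasis.{u} S := by
  have hgen : ∀ (T : Type u) [Semigroup T], (∀ e ∈ ({(var 0 * var 1 * var 2 * var 3,
      var 4 * var 5 * var 6 * var 7)} : Set SemigroupIdentity), SatisfiesIdentity T e) →
      ∀ a b c d a' b' c' d' : T, a * b * c * d = a' * b' * c' * d' := by
    intro T _ hT a b c d a' b' c' d'
    exact (hT _ rfl).lift_eq (assign [a, b, c, d, a', b', c', d'] a)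
  refine hasFiniteBasis_of_bounded {(var 0 * var 1 * var 2 * var 3,
    var 4 * var 5 * var 6 * var 7)} (Set.finite_singleton _) ?_ 4 fun w => ?_
  · rintro e rfl φ
    simpa using h _ _ _ _ _ _ _ _
  · obtain ⟨a, rfl⟩ | ⟨a, w, rfl⟩ := w.eq_of_or_mul
    · exact ⟨var a, by simp, fun _ => rfl, fun _ _ _ _ => rfl⟩
    obtain ⟨b, rfl⟩ | ⟨b, w, rfl⟩ := w.eq_of_or_mul
    · exact ⟨var a * var b, by simp, fun _ => rfl, fun _ _ _ _ => rfl⟩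
    obtain ⟨c, rfl⟩ | ⟨c, w, rfl⟩ := w.eq_of_or_mul
    · exact ⟨var a * (var b * var c), by simp, fun _ => rfl, fun _ _ _ _ => rfl⟩
    refine ⟨var 0 * var 1 * var 2 * var 3, by simp, ?_, fun T _ hT => ?_⟩
    · intro φ
      simpa [mul_assoc] using h (φ (var a)) (φ (var b)) (φ (var c)) (φ w) (φ (var 0)) _ _ _
    · intro φ
      simpa [mul_assoc] using
        hgen T hT (φ (var a)) (φ (var b)) (φ (var c)) (φ w) (φ (var 0)) _ _ _

theorem presentedWithZero_mul_eq_zero {α : Type}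
    {R : Set (WithZero (FreeSemigroup α) × WithZero (FreeSemigroup α))}
    (h : ∀ a b c d, presentedWithZeroGen R a * presentedWithZeroGen R b *
      presentedWithZeroGen R c * presentedWithZeroGen R d = 0) (p q r s : presentedWithZero R) :
    p * q * r * s = 0 := by
  have h1 : ∀ a b c (s : presentedWithZero R), presentedWithZeroGen R a *
      presentedWithZeroGen R b * presentedWithZeroGen R c * s = 0 := by
    intro a b c s
    induction s using presentedWithZero_induction with
    | zero => exact mul_zero _
    | gen d => exact h a b c d
    | mul d s _ => rw [← mul_assoc, h, zero_mul]
  have h2 : ∀ a b (r s : presentedWithZero R), presentedWithZeroGen R a *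
      presentedWithZeroGen R b * r * s = 0 := by
    intro a b r s
    induction r using presentedWithZero_induction with
    | zero => rw [mul_zero, zero_mul]
    | gen d => exact h1 a b d s
    | mul d r _ => rw [← mul_assoc, h1, zero_mul]
  have h3 : ∀ a (q r s : presentedWithZero R), presentedWithZeroGen R a * q * r * s = 0 := by
    intro a q r s
    induction q using presentedWithZero_induction with
    | zero => rw [mul_zero, zero_mul, zero_mul]
    | gen d => exact h2 a d r s
    | mul d q _ => rw [← mul_assoc, h2, zero_mul]
  induction p using presentedWithZero_induction with
  | zero => rw [zero_mul, zero_mul, zero_mul]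
  | gen d => exact h3 d q r s
  | mul d p _ => rw [mul_assoc _ p q, h3]

/-- A semigroup with `xyz = xy` has a finite basis: each word is equal to its prefix of
length two. -/
theorem hasFiniteBasis_of_mul_mul {S : Type} [Semigroup S]
    (h : ∀ a b c : S, a * b * c = a * b) : HasFiniteBasis.{u} S := by
  refine hasFiniteBasis_of_bounded {(var 0 * var 1 * var 2, var 0 * var 1)}
    (Set.finite_singleton _) ?_ 2 fun w => ?_
  · rintro e rfl φ
    simpa using h _ _ _
  · obtain ⟨a, rfl⟩ | ⟨a, w, rfl⟩ := w.eq_of_or_mul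
    · exact ⟨var a, by simp, fun _ => rfl, fun _ _ _ _ => rfl⟩
    obtain ⟨b, rfl⟩ | ⟨b, w, rfl⟩ := w.eq_of_or_mul
    · exact ⟨var a * var b, by simp, fun _ => rfl, fun _ _ _ _ => rfl⟩
    refine ⟨var a * var b, by simp, fun φ => ?_, fun T _ hT φ => ?_⟩
    · simpa [mul_assoc] using h (φ (var a)) (φ (var b)) (φ w)
    · have hT' : ∀ a b c : T, a * b * c = a * b := fun a b c => by
        simpa using (hT _ rfl).lift_eq (assign [a, b, c] a)
      simpa [mul_assoc] using hT' (φ (var a)) (φ (var b)) (φ w)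

theorem hasFiniteBasis_of_gen_mul_eq_zero {α : Type}
    {R : Set (WithZero (FreeSemigroup α) × WithZero (FreeSemigroup α))}
    (h : ∀ (S : Type) [SemigroupWithZero S] (g : α → S),
      (∀ r ∈ R, liftZero g r.1 = liftZero g r.2) → ∀ a b c d, g a * g b * g c * g d = 0) :
    HasFiniteBasis.{u} (presentedWithZero R) :=
  have h' := presentedWithZero_mul_eq_zero (h _ _ fun _ => presentedWithZero_relation)
  hasFiniteBasis_of_nilpotent fun _ _ _ _ _ _ _ _ => (h' _ _ _ _).trans (h' _ _ _ _).symm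

theorem hasFiniteBasis_B : HasFiniteBasis.{u} IndicatorBurnside.B := by
  refine hasFiniteBasis_of_gen_mul_eq_zero fun S _ g hg => ?_
  simp only [Set.mem_insert_iff, Set.mem_singleton_iff, forall_eq_or_imp, forall_eq, map_mul,
    liftZero_gen₀, liftZero_zero] at hg
  obtain ⟨hx, hy, hxy⟩ := hg
  have hx' : ∀ z, g .x * (g .x * z) = 0 := fun z => by rw [← mul_assoc, hx, zero_mul]
  have hy' : ∀ z, g .y * (g .y * z) = 0 := fun z => by rw [← mul_assoc, hy, zero_mul]
  rw [mul_assoc, mul_assoc] at hxy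
  rintro (_ | _) (_ | _) (_ | _) (_ | _) <;>
    simp only [hx, hy, mul_assoc, mul_zero, zero_mul]
  · rw [← hxy, hx']
  · rw [hxy, hy']

theorem hasFiniteBasis_N3 : HasFiniteBasis.{u} IndicatorBurnside.N3 := by
  refine hasFiniteBasis_of_gen_mul_eq_zero fun S _ g hg => ?_
  simp only [Set.mem_singleton_iff, forall_eq, map_mul, liftZero_gen₀, liftZero_zero] at hg
  rintro ⟨⟩ ⟨⟩ ⟨⟩ ⟨⟩
  rw [hg, zero_mul]

theorem presented_mul_mul {α : Type} {R : Set (FreeSemigroup α × FreeSemigroup α)}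
    (h : ∀ a b c, presentedGen R a * presentedGen R b * presentedGen R c =
      presentedGen R a * presentedGen R b) (p q r : presented R) : p * q * r = p * q := by
  have h1 : ∀ a b (s : presented R), presentedGen R a * presentedGen R b * s =
      presentedGen R a * presentedGen R b := by
    intro a b s
    induction s using presented_induction with
    | gen c => exact h a b c
    | mul c s hs => rw [← mul_assoc, h, hs]
  have h2 : ∀ a (q r : presented R), presentedGen R a * q * r = presentedGen R a * q := by
    intro a q r
    induction q using presented_induction with
    | gen c => exact h1 a c r
    | mul c q _ => rw [← mul_assoc, h1, h1]
  induction p using presented_induction with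
  | gen c => exact h2 c q r
  | mul c p _ => rw [mul_assoc _ p q, h2]

theorem hasFiniteBasis_of_gen_mul_mul {α : Type} {R : Set (FreeSemigroup α × FreeSemigroup α)}
    (h : ∀ (S : Type) [Semigroup S] (g : α → S),
      (∀ r ∈ R, FreeSemigroup.lift g r.1 = FreeSemigroup.lift g r.2) →
      ∀ a b c, g a * g b * g c = g a * g b) : HasFiniteBasis.{u} (presented R) :=
  hasFiniteBasis_of_mul_mul (presented_mul_mul (h _ _ fun _ => presented_relation))

open IndicatorBurnside in
@[simp] theorem lift_gen {α : Type} {T : Type*} [Semigroup T] (f : α → T) (a : α) :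
    FreeSemigroup.lift f (gen a) = f a := rfl

theorem hasFiniteBasis_Flam : HasFiniteBasis.{u} IndicatorBurnside.Flam := by
  refine hasFiniteBasis_of_gen_mul_mul fun S _ g hg => ?_
  simp only [Set.mem_insert_iff, Set.mem_singleton_iff, forall_eq_or_imp, forall_eq, map_mul,
    lift_gen] at hg
  obtain ⟨h1, h2, h3, h4, h5, h6, h7, h8⟩ := hg
  rintro (_ | _) (_ | _) (_ | _)
  exacts [h6.symm, h5.symm, h1.symm, h2.symm, h4.symm, h3.symm, h7.symm, h8.symm]

theorem hasFiniteBasis_Frho : HasFiniteBasis.{u} IndicatorBurnside.Frho := by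
  refine hasFiniteBasis_Flam.presented_op (fun S _ g hg => ?_) (fun S _ g hg => ?_)
  all_goals
    simp only [Set.mem_insert_iff, Set.mem_singleton_iff, forall_eq_or_imp, forall_eq, map_mul,
      lift_gen, ← MulOpposite.op_mul, MulOpposite.op_inj, ← mul_assoc] at hg ⊢
    simp only [← hg, and_self]

/-! ### The semigroup `A` -/

open Classical in
/-- In a commutative monoid with `x² = x³`, only the letters and the once-occurring letters of
a word matter. -/
theorem evalList_eq_of_comm {N : Type*} [CommMonoid N] (h : ∀ x : N, x * x = x * x * x)
    {f : ℕ → N} {l m : List ℕ}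
    (hlm : ∀ c, min (l.count c) 2 = min (m.count c) 2) : evalList f l = evalList f m := by
  have hpow : ∀ (x : N) (i j : ℕ), min i 2 = min j 2 → x ^ i = x ^ j := by
    have h2 : ∀ (x : N) (i : ℕ), x ^ (i + 2) = x ^ 2 := by
      intro x i
      induction i with
      | zero => rfl
      | succ i ih => rw [show i + 1 + 2 = (i + 2) + 1 by ring, pow_succ, ih, pow_two, ← h]
    intro x i j hij
    obtain hi | hi := lt_or_ge i 2
    · rw [show i = j by omega]
    · obtain ⟨i, rfl⟩ := Nat.exists_eq_add_of_le' hi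
      obtain ⟨j, rfl⟩ := Nat.exists_eq_add_of_le' (show 2 ≤ j by omega)
      rw [h2, h2 x j]
  have hmem : l.toFinset = m.toFinset := by
    ext c
    have := hlm c
    rw [List.mem_toFinset, List.mem_toFinset, ← List.count_pos_iff, ← List.count_pos_iff]
    omega
  rw [evalList, evalList, Finset.prod_list_map_count, Finset.prod_list_map_count, hmem]
  exact Finset.prod_congr rfl fun c _ => hpow _ _ _ (hlm c)

open DualNumber in
theorem hasFiniteBasis_A : HasFiniteBasis.{u} IndicatorBurnside.A := by
  refine HasFiniteBasis.of_presentation fun S _ g hg => ?_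
  have hrel := hg.relation
  simp only [Set.mem_insert_iff, Set.mem_singleton_iff, forall_eq_or_imp, forall_eq, map_mul,
    liftZero_gen₀, liftZero_zero] at hrel
  obtain ⟨hx, hy, hxy⟩ := hrel
  have hx' : ∀ z, g .x * (g .x * z) = g .x * z := fun z => by rw [← mul_assoc, ← hx]
  have hyx' : ∀ z, g .y * (g .x * z) = g .x * (g .y * z) := fun z => by
    rw [← mul_assoc, ← mul_assoc, hxy]
  -- the elements of `A` are `0, x, y, xy`
  have hel : ∀ s, s = 0 ∨ s = g .x ∨ s = g .y ∨ s = g .x * g .y := by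
    refine hg.induction _ (by simp) ?_ ?_
    · rintro (_ | _) <;> simp
    · rintro (_ | _) s (rfl | rfl | rfl | rfl) <;>
        simp [← hx, hy, ← hxy, hx', hyx']
  refine ⟨{(var 0 * var 1, var 1 * var 0), (var 0 * var 0, var 0 * var 0 * var 0)},
    Set.toFinite _, ?_, ?_⟩
  · rintro e (rfl | rfl) φ
    · have h : ∀ s t : S, s * t = t * s := by
        intro s t
        obtain rfl | rfl | rfl | rfl := hel s <;> obtain rfl | rfl | rfl | rfl := hel t <;>
          simp [← hx, hy, ← hxy, hx', hyx', mul_assoc]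
      simpa using h _ _
    · have h : ∀ s : S, s * s = s * s * s := by
        intro s
        obtain rfl | rfl | rfl | rfl := hel s <;>
          simp [← hx, hy, hyx', mul_assoc]
      simpa using h _
  · intro T _ hT e he
    -- in the dual numbers, `x ↦ 1` and `y ↦ ε` define a homomorphism on `A`
    obtain ⟨F, -, hF⟩ := hg.exists_hom ℤ[ε] (fun | .x => 1 | .y => ε) (by simp)
    have hcount : ∀ c, min ((letters e.1).count c) 2 = min ((letters e.2).count c) 2 := by
      intro c
      have h := he.evalList_eq (F : S →ₙ* ℤ[ε]) (fun d => if d = c then g .y else g .x)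
      have key : ∀ l : List ℕ, evalList (fun d => F (if d = c then g .y else g .x)) l =
          ε ^ l.count c := by
        intro l
        induction l with
        | nil => simp
        | cons d l ih =>
          by_cases hd : d = c
          · simp [hd, hF, ih, pow_succ']
          · simp [hd, hF, ih]
      rw [key, key] at h
      have hε : ∀ n, (ε : ℤ[ε]) ^ (n + 2) = 0 := fun n => by simp [pow_add, pow_two]
      have h1 : (1 : ℤ[ε]) ≠ ε := fun h => by simpa using congrArg TrivSqZeroExt.fst h
      have h2 : (ε : ℤ[ε]) ≠ 0 := fun h => by simpa using congrArg TrivSqZeroExt.snd h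
      have key' : ∀ i j : ℕ, (ε : ℤ[ε]) ^ i = ε ^ j → min i 2 = min j 2 := by
        rintro (_ | _ | i) (_ | _ | j) <;> simp [hε, h1, h1.symm, h2, h2.symm]
      exact key' _ _ h
    have hcomm : ∀ a b : T, a * b = b * a := fun a b => by
      simpa using (hT _ (Or.inl rfl)).lift_eq (assign [a, b] a)
    let _ : CommSemigroup T := { mul_comm := hcomm }
    rw [satisfiesIdentity_iff_evalList]
    intro f
    refine evalList_eq_of_comm (fun x => ?_) hcount
    induction x using WithOne.recOneCoe with
    | one => simp
    | coe x =>
      have := (hT _ (Or.inr rfl)).lift_eq (assign [x] x)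
      simp only [map_mul, FreeSemigroup.lift_of, assign_zero] at this
      exact_mod_cast this

/-! ### The semigroups `L₂¹` and `R₂¹` -/

/-- If `x² = x` and `xyx = xy`, repeated occurrences of a letter can be deleted. -/
theorem evalList_mul_of_mem {N : Type*} [Monoid N] {f : ℕ → N}
    (h : ∀ c y, f c * y * f c = f c * y) {l : List ℕ} {c : ℕ} (hc : c ∈ l) :
    evalList f l * f c = evalList f l := by
  obtain ⟨p, q, rfl⟩ := List.append_of_mem hc
  simp only [evalList_append, evalList_cons]
  rw [mul_assoc, h]

/-- A constant map, as an element of the monoid of self-maps of `Bool`. -/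
def constEnd (b : Bool) : Function.End Bool := fun _ => b

theorem constEnd_mul (b : Bool) (z : Function.End Bool) : constEnd b * z = constEnd b := rfl

theorem one_ne_constEnd (b : Bool) : (1 : Function.End Bool) ≠ constEnd b := fun h => by
  cases b
  · exact absurd (congrFun h true : true = false) (by decide)
  · exact absurd (congrFun h false : false = true) (by decide)

/-- Two lists that agree after the deletion of repetitions have equal values in monoids with
`x² = x` and `xyx = xy`. The order of first occurrences is detected by evaluating letters as the
identity or a constant map; `p` is the part of the lists that has been read already. -/
theorem evalList_eq_of_const {N : Type*} [Monoid N] {f : ℕ → N}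
    (h : ∀ c y, f c * y * f c = f c * y) (n : ℕ) (p l m : List ℕ) (hn : l.length + m.length ≤ n)
    (hlm : ∀ k : ℕ → Function.End Bool, (∀ c, k c = 1 ∨ k c = constEnd false ∨ k c = constEnd true) →
      (∀ c ∈ p, k c = 1) → evalList k l = evalList k m) :
    evalList f p * evalList f l = evalList f p * evalList f m := by
  induction n generalizing p l m with
  | zero =>
    obtain rfl : l = [] := List.length_eq_zero_iff.1 (by omega)
    obtain rfl : m = [] := List.length_eq_zero_iff.1 (by omega)
    rfl
  | succ n ih =>
    -- a letter that has been read already can be skipped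
    by_cases hl : ∃ c ∈ l.head?, c ∈ p
    · obtain ⟨c, hc, hcp⟩ := hl
      cases l with
      | nil => simp at hc
      | cons d l =>
        obtain rfl : d = c := by simpa using hc
        rw [evalList_cons, ← mul_assoc, evalList_mul_of_mem h hcp]
        refine ih p l m (by simp at hn; omega) fun k hk hp => ?_
        rw [← hlm k hk hp, evalList_cons, hp d hcp, one_mul]
    by_cases hm : ∃ c ∈ m.head?, c ∈ p
    · obtain ⟨c, hc, hcp⟩ := hm
      cases m with
      | nil => simp at hc
      | cons d m =>
        obtain rfl : d = c := by simpa using hc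
        rw [evalList_cons, ← mul_assoc, evalList_mul_of_mem h hcp]
        refine ih p l m (by simp at hn; omega) fun k hk hp => ?_
        rw [hlm k hk hp, evalList_cons, hp d hcp, one_mul]
    cases l with
    | nil =>
      cases m with
      | nil => rfl
      | cons d m =>
        have hd : d ∉ p := by simpa using hm
        have := hlm (fun c => if c ∈ p then 1 else constEnd true)
          (fun c => by split <;> simp) (fun c hc => by simp [hc])
        simp only [evalList_nil, evalList_cons, hd, if_false, constEnd_mul] at this
        exact absurd this (one_ne_constEnd _)
    | cons c l =>
      have hc : c ∉ p := by simpa using hl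
      cases m with
      | nil =>
        have := hlm (fun c => if c ∈ p then 1 else constEnd true)
          (fun c => by split <;> simp) (fun c hc => by simp [hc])
        simp only [evalList_nil, evalList_cons, hc, if_false, constEnd_mul] at this
        exact absurd this.symm (one_ne_constEnd _)
      | cons d m =>
        have hd : d ∉ p := by simpa using hm
        have hcd : d = c := by
          by_contra hcd
          have := hlm (fun d => if d ∈ p then 1 else if d = c then constEnd true else constEnd false)
            (fun d => by split_ifs <;> simp)
            (fun c hc => by simp [hc])
          simp only [evalList_cons, hc, hd, hcd, if_false, if_true, constEnd_mul] at this
          exact absurd (congrFun this true : true = false) (by decide)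
        subst hcd
        have := ih (p ++ [d]) l m (by simp at hn; omega) fun k hk hp => by
          have := hlm k hk fun c hc => hp c (by simp [hc])
          simpa [hp d (by simp)] using this
        simpa [mul_assoc] using this

theorem hasFiniteBasis_L21 : HasFiniteBasis.{u} IndicatorBurnside.L21 := by
  refine HasFiniteBasis.of_plainPresentation fun S _ g hg => ?_
  obtain ⟨F, hF⟩ := hg.exists_hom (Function.End Bool)
    (fun | .a => 1 | .x => constEnd false | .y => constEnd true) (by
      simp only [Set.mem_insert_iff, Set.mem_singleton_iff, forall_eq_or_imp, forall_eq, map_mul,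
        lift_gen]
      exact ⟨rfl, rfl, rfl, rfl, rfl, rfl, rfl, rfl, rfl⟩)
  have hrel := hg.relation
  simp only [Set.mem_insert_iff, Set.mem_singleton_iff, forall_eq_or_imp, forall_eq, map_mul,
    lift_gen] at hrel
  obtain ⟨h1, h2, h3, h4, h5, h6, h7, h8, h9⟩ := hrel
  have haa : ∀ q, g .a * g q = g q := by rintro (_ | _ | _) <;> simp only [← h3, h6, h8]
  have hxy : ∀ p q, p ≠ .a → g p * g q = g p := by
    rintro (_ | _ | _) (_ | _ | _) hp <;> first
      | exact absurd rfl hp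
      | simp only [← h1, ← h2, h4, h5, h7, h9]
  have ha := hF .a
  have hx := hF .x
  have hy := hF .y
  have hel : ∀ s : S, ∃ p, s = g p := by
    intro s
    refine hg.induction (fun s => ∃ p, s = g p) (fun p => ⟨p, rfl⟩) ?_ s
    rintro p _ ⟨q, rfl⟩
    by_cases h : p = .a
    · subst h; exact ⟨q, haa q⟩
    · exact ⟨p, hxy p q h⟩
  have hidem : ∀ s : S, s * s = s := by
    intro s
    obtain ⟨p, rfl⟩ := hel s
    by_cases h : p = .a
    · subst h; exact haa .a
    · exact hxy p p h
  refine ⟨{(var 0 * var 0, var 0), (var 0 * var 1 * var 0, var 0 * var 1)}, Set.toFinite _, ?_, ?_⟩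
  · rintro e (rfl | rfl) φ
    · simpa using hidem _
    · have h : ∀ s t : S, s * t * s = s * t := by
        intro s t
        obtain ⟨p, rfl⟩ := hel s
        obtain ⟨q, rfl⟩ := hel t
        by_cases h : p = .a
        · subst h
          by_cases h' : q = .a
          · subst h'; rw [hidem, hidem]
          · rw [mul_assoc, hxy _ _ h']
        · rw [hxy _ _ h, hidem]
      simpa using h _ _
  · intro T _ hT e he
    rw [satisfiesIdentity_iff_evalList]
    intro f
    have := evalList_eq_of_const (f := fun c => (f c : WithOne T)) ?_ _ [] (letters e.1)
      (letters e.2) le_rfl fun k hk _ => ?_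
    · simpa using this
    · intro c y
      induction y using WithOne.recOneCoe with
      | one =>
        have := (hT _ (Or.inl rfl)).lift_eq (assign [f c] (f c))
        simp only [map_mul, FreeSemigroup.lift_of, assign_zero] at this
        rw [mul_one, ← WithOne.coe_mul, this]
      | coe y =>
        have := (hT _ (Or.inr rfl)).lift_eq (assign [f c, y] (f c))
        simp only [map_mul, FreeSemigroup.lift_of, assign_zero, assign_one] at this
        rw [← WithOne.coe_mul, ← WithOne.coe_mul, this]
    · have hF : ∀ c, ∃ s, F s = k c := by
        intro c
        obtain h | h | h := hk c
        exacts [⟨_, ha.trans h.symm⟩, ⟨_, hx.trans h.symm⟩, ⟨_, hy.trans h.symm⟩]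
      choose s hs using hF
      have := he.evalList_eq F s
      simpa only [hs] using this

theorem hasFiniteBasis_R21 : HasFiniteBasis.{u} IndicatorBurnside.R21 := by
  refine hasFiniteBasis_L21.presented_op (fun S _ g hg => ?_) (fun S _ g hg => ?_)
  all_goals
    simp only [Set.mem_insert_iff, Set.mem_singleton_iff, forall_eq_or_imp, forall_eq, map_mul,
      lift_gen, ← MulOpposite.op_mul, MulOpposite.op_inj] at hg ⊢
    obtain ⟨h1, h2, h3, h4, h5, h6, h7, h8, h9⟩ := hg
    exact ⟨h1, h2, h3, h5, h4, h7, h6, h9, h8⟩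

/-! ### Walks -/

/-- A colouring gives each letter `c` a source `σ c` and a target `ε c`. With respect to it,
`Walk σ ε p l q` says that the letters of `l` are the consecutive edges of a walk from `p`
to `q`. -/
def Walk {K : Type*} (σ ε : ℕ → K) : K → List ℕ → K → Prop
  | p, [], q => p = q
  | p, c :: l, q => p = σ c ∧ Walk σ ε (ε c) l q

section Walk

variable {K : Type*} {σ ε : ℕ → K}

@[simp] theorem walk_nil {p q : K} : Walk σ ε p [] q ↔ p = q := Iff.rfl

@[simp] theorem walk_cons {p q : K} {c : ℕ} {l : List ℕ} :
    Walk σ ε p (c :: l) q ↔ p = σ c ∧ Walk σ ε (ε c) l q := Iff.rfl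

theorem walk_append {p q : K} {l m : List ℕ} :
    Walk σ ε p (l ++ m) q ↔ ∃ r, Walk σ ε p l r ∧ Walk σ ε r m q := by
  induction l generalizing p with
  | nil => simp
  | cons c l ih => simp [ih, and_assoc]

theorem walk_congr {σ' ε' : ℕ → K} {l : List ℕ} (h : ∀ c ∈ l, σ c = σ' c ∧ ε c = ε' c)
    {p q : K} : Walk σ ε p l q ↔ Walk σ' ε' p l q := by
  induction l generalizing p with
  | nil => simp
  | cons c l ih =>
    rw [walk_cons, walk_cons, ih fun d hd => h d (by simp [hd]), (h c (by simp)).1,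
      (h c (by simp)).2]

theorem walk_of_loops {l : List ℕ} {r : K} (h : ∀ c ∈ l, σ c = r ∧ ε c = r) {p q : K} :
    (∃ c, c ∈ l) → (Walk σ ε p l q ↔ p = r ∧ q = r) := by
  induction l generalizing p with
  | nil => simp
  | cons c l ih =>
    intro _
    rw [walk_cons, (h c (by simp)).1, (h c (by simp)).2]
    cases l with
    | nil => simp [eq_comm]
    | cons d l => rw [ih (fun e he => h e (by simp [he])) ⟨d, by simp⟩]; simp

theorem walk_of_loops' {l : List ℕ} {r : K} (h : ∀ c ∈ l, σ c = r ∧ ε c = r) {q : K} :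
    Walk σ ε r l q ↔ q = r := by
  cases l with
  | nil => simp [eq_comm]
  | cons c l => rw [walk_of_loops h ⟨c, by simp⟩]; simp

theorem walk_map {L : Type*} (χ : K → L) {p q : K} {l : List ℕ} (h : Walk σ ε p l q) :
    Walk (χ ∘ σ) (χ ∘ ε) (χ p) l (χ q) := by
  induction l generalizing p with
  | nil => exact congrArg χ h
  | cons c l ih => exact ⟨congrArg χ h.1, ih h.2⟩

open Classical in
/-- Two colours suffice to test whether a list is a walk. -/
theorem walk_iff_forall_bool {p q : K} {l : List ℕ} :
    Walk σ ε p l q ↔ ∀ χ : K → Bool, Walk (χ ∘ σ) (χ ∘ ε) (χ p) l (χ q) := by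
  refine ⟨fun h χ => walk_map χ h, fun h => ?_⟩
  have heq : ∀ a b : K, (∀ χ : K → Bool, χ a = χ b) → a = b := fun a b hab => by
    have := hab fun x => decide (x = b)
    simpa using this
  induction l generalizing p with
  | nil => exact heq _ _ h
  | cons c l ih => exact ⟨heq _ _ fun χ => (h χ).1, ih fun χ => (h χ).2⟩

end Walk

/-- The two lists have the same letters and are walks between the same points for the same
two-coloured sources and targets. This describes the identities of the Brandt semigroup `B₂`. -/
def SameWalks (l m : List ℕ) : Prop :=
  (∀ c, c ∈ l ↔ c ∈ m) ∧ ∀ (σ ε : ℕ → Bool) (p q : Bool), Walk σ ε p l q ↔ Walk σ ε p m q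

theorem SameWalks.symm {l m : List ℕ} (h : SameWalks l m) : SameWalks m l :=
  ⟨fun c => (h.1 c).symm, fun σ ε p q => (h.2 σ ε p q).symm⟩

theorem SameWalks.walk_iff {l m : List ℕ} (h : SameWalks l m) {K : Type*} {σ ε : ℕ → K}
    {p q : K} : Walk σ ε p l q ↔ Walk σ ε p m q := by
  rw [walk_iff_forall_bool, walk_iff_forall_bool]
  exact forall_congr' fun χ => h.2 _ _ _ _

theorem SameWalks.eq_nil {m : List ℕ} (h : SameWalks [] m) : m = [] :=
  List.eq_nil_iff_forall_not_mem.2 fun c hc => by simpa using (h.1 c).2 hc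

/-! ### Cut letters -/

/-- The list `u ++ b :: v` is cut by `b`: the letters of `u`, `b` and `v` are different. -/
def IsCut (u : List ℕ) (b : ℕ) (v : List ℕ) : Prop :=
  b ∉ u ∧ b ∉ v ∧ ∀ c ∈ u, c ∉ v

/-- Some letter cuts the list. -/
def HasCut (l : List ℕ) : Prop := ∃ u b v, l = u ++ b :: v ∧ IsCut u b v

theorem HasCut.exists_first {l : List ℕ} (h : HasCut l) :
    ∃ u b v, l = u ++ b :: v ∧ IsCut u b v ∧ ¬ HasCut u := by
  obtain ⟨u, b, v, rfl, hc⟩ := h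
  induction hn : u.length using Nat.strong_induction_on generalizing u b v with
  | _ n ih =>
    by_cases hu : HasCut u
    · obtain ⟨p, d, q, rfl, h1, h2, h3⟩ := hu
      have hlen : p.length < n := by simp at hn; omega
      have hcut : IsCut p d (q ++ b :: v) := by
        obtain ⟨h4, h5, h6⟩ := hc
        refine ⟨h1, ?_, fun c hc' => ?_⟩
        · simp only [List.mem_append, List.mem_cons, not_or]
          refine ⟨h2, ?_, h6 d (by simp)⟩
          rintro rfl
          exact h4 (by simp)
        · simp only [List.mem_append, List.mem_cons, not_or]
          refine ⟨h3 c hc', ?_, h6 c (by simp [hc'])⟩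
          rintro rfl
          exact h4 (by simp [hc'])
      have := ih _ hlen p d _ hcut rfl
      simpa using this
    · exact ⟨u, b, v, rfl, hc, hu⟩

/-- A cut letter of a list cuts all lists with the same walks, into parts with the same walks. -/
theorem SameWalks.cut {u v m : List ℕ} {b : ℕ} (h : SameWalks (u ++ b :: v) m)
    (hc : IsCut u b v) :
    ∃ u' v', m = u' ++ b :: v' ∧ IsCut u' b v' ∧ SameWalks u u' ∧ SameWalks v v' := by
  obtain ⟨hbu, hbv, huv⟩ := hc
  have hmem : ∀ c ∈ m, c ∈ u ∨ c = b ∨ c ∈ v := fun c hcm => by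
    simpa using (h.1 c).2 hcm
  -- `b` is the only edge between the colours `false` and `true`
  let σ : ℕ → Bool := fun c => decide (c ∈ v)
  let ε : ℕ → Bool := fun c => decide (c ∈ v ∨ c = b)
  have hu : ∀ c ∈ u, σ c = false ∧ ε c = false := fun c hcu => by
    have : c ≠ b := by rintro rfl; exact hbu hcu
    simp [σ, ε, huv c hcu, this]
  have hv : ∀ c ∈ v, σ c = true ∧ ε c = true := fun c hcv => by simp [σ, ε, hcv]
  have hwalk : Walk σ ε false m true := by
    rw [← h.2, walk_append]
    refine ⟨false, (walk_of_loops' hu).2 rfl, ?_⟩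
    simp only [walk_cons]
    refine ⟨by simp [σ, hbv], ?_⟩
    rw [show ε b = true by simp [ε]]
    exact (walk_of_loops' hv).2 rfl
  have htail : ∀ l : List ℕ, (∀ c ∈ l, c ∈ u ∨ c = b ∨ c ∈ v) → ∀ q, Walk σ ε true l q →
      ∀ c ∈ l, c ∈ v := by
    intro l hl
    induction l with
    | nil => simp
    | cons d l ih =>
      rintro q ⟨h1, h2⟩
      have hd : d ∈ v := by simpa [σ] using h1.symm
      rw [(hv d hd).2] at h2
      intro c hc
      obtain rfl | hc := List.mem_cons.1 hc
      · exact hd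
      · exact ih (fun c hc => hl c (by simp [hc])) q h2 c hc
  have hsplit : ∀ l : List ℕ, (∀ c ∈ l, c ∈ u ∨ c = b ∨ c ∈ v) → Walk σ ε false l true →
      ∃ u' v', l = u' ++ b :: v' ∧ (∀ c ∈ u', c ∈ u) ∧ ∀ c ∈ v', c ∈ v := by
    intro l hl
    induction l with
    | nil => intro h; simp at h
    | cons d l ih =>
      rintro ⟨h1, h2⟩
      obtain hd | rfl | hd := hl d (by simp)
      · rw [(hu d hd).2] at h2
        obtain ⟨u', v', rfl, hu', hv'⟩ := ih (fun c hc => hl c (by simp [hc])) h2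
        refine ⟨d :: u', v', rfl, ?_, hv'⟩
        intro c hc
        obtain rfl | hc := List.mem_cons.1 hc
        exacts [hd, hu' c hc]
      · rw [show ε d = true by simp [ε]] at h2
        exact ⟨[], l, rfl, by simp, htail l (fun c hc => hl c (by simp [hc])) _ h2⟩
      · rw [(hv d hd).1] at h1
        simp at h1
  obtain ⟨u', v', rfl, hu', hv'⟩ := hsplit m hmem hwalk
  have hcu : ∀ c, c ∈ u ↔ c ∈ u' := by
    refine fun c => ⟨fun hcu => ?_, hu' c⟩
    have := (h.1 c).1 (by simp [hcu])
    simp only [List.mem_append, List.mem_cons] at this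
    obtain h | rfl | h := this
    exacts [h, absurd hcu hbu, absurd (hv' c h) (huv c hcu)]
  have hcv : ∀ c, c ∈ v ↔ c ∈ v' := by
    refine fun c => ⟨fun hcv => ?_, hv' c⟩
    have := (h.1 c).1 (by simp [hcv])
    simp only [List.mem_append, List.mem_cons] at this
    obtain h | rfl | h := this
    exacts [absurd hcv (huv c (hu' c h)), absurd hcv hbv, h]
  refine ⟨u', v', rfl, ⟨fun h => hbu (hu' _ h), fun h => hbv (hv' _ h),
    fun c h1 h2 => huv c (hu' c h1) (hv' c h2)⟩, ⟨hcu, fun σ ε p q => ?_⟩,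
    ⟨hcv, fun σ ε p q => ?_⟩⟩
  · -- extend the colouring by loops at `true` on the right of `b`
    let σ' : ℕ → Bool := fun c => if c ∈ u then σ c else if c = b then q else true
    let ε' : ℕ → Bool := fun c => if c ∈ u then ε c else true
    have key : ∀ l l' : List ℕ, (∀ c ∈ l, c ∈ u) → (∀ c ∈ l', c ∈ v) →
        (Walk σ' ε' p (l ++ b :: l') true ↔ Walk σ ε p l q) := by
      intro l l' hl hl'
      have h1 : ∀ r, Walk σ' ε' p l r ↔ Walk σ ε p l r := fun r =>
        walk_congr fun c hc => by simp [σ', ε', hl c hc]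
      have h2 : ∀ c ∈ l', σ' c = true ∧ ε' c = true := fun c hc => by
        have h3 : c ∉ u := fun h => huv c h (hl' c hc)
        have h4 : c ≠ b := by rintro rfl; exact hbv (hl' _ hc)
        simp [σ', ε', h3, h4]
      have h3 : σ' b = q ∧ ε' b = true := by simp [σ', ε', hbu]
      simp only [walk_append, walk_cons, h1, h3, walk_of_loops' h2, and_true, exists_eq_right]
    rw [← key u v (fun _ h => h) (fun _ h => h), ← key u' v' hu' hv', h.2]
  · -- extend the colouring by loops at `true` on the left of `b`
    let σ' : ℕ → Bool := fun c => if c ∈ v then σ c else true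
    let ε' : ℕ → Bool := fun c => if c ∈ v then ε c else if c = b then p else true
    have key : ∀ l l' : List ℕ, (∀ c ∈ l, c ∈ u) → (∀ c ∈ l', c ∈ v) →
        (Walk σ' ε' true (l ++ b :: l') q ↔ Walk σ ε p l' q) := by
      intro l l' hl hl'
      have h1 : ∀ r, Walk σ' ε' r l' q ↔ Walk σ ε r l' q := fun r =>
        walk_congr fun c hc => by simp [σ', ε', hl' c hc]
      have h2 : ∀ c ∈ l, σ' c = true ∧ ε' c = true := fun c hc => by
        have h3 : c ∉ v := fun h => huv c (hl c hc) h
        have h4 : c ≠ b := by rintro rfl; exact hbu (hl _ hc)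
        simp [σ', ε', h3, h4]
      have h3 : σ' b = true ∧ ε' b = p := by simp [σ', ε', hbv]
      simp only [walk_append, walk_cons, h1, h3, walk_of_loops' h2]
      constructor
      · rintro ⟨r, rfl, _, h⟩; exact h
      · intro h; exact ⟨true, rfl, rfl, h⟩
    rw [← key u v (fun _ h => h) (fun _ h => h), ← key u' v' hu' hv', h.2]

theorem SameWalks.hasCut {l m : List ℕ} (h : SameWalks l m) (hl : HasCut l) : HasCut m := by
  obtain ⟨u, b, v, rfl, hc⟩ := hl
  obtain ⟨u', v', rfl, hc', -⟩ := h.cut hc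
  exact ⟨u', b, v', rfl, hc'⟩

/-! ### Regular elements under the identities of `W_λ` -/

/-- The identities of `W_λ`, for the non-identity elements of a monoid in which the identity is
adjoined. -/
structure WLaws (N : Type*) [Monoid N] : Prop where
  mul_eq_one : ∀ x y : N, x * y = 1 → x = 1 ∧ y = 1
  cube : ∀ x : N, x * x = x * x * x
  sandwich : ∀ x y : N, x ≠ 1 → x * y * x = x * y * x * y * x
  absorb : ∀ x y : N, x * x * (y * y) * x = x * x * (y * y)
  comm_two : ∀ t s x y : N, t ≠ 1 → s ≠ 1 →
    t * s * ((x * x) * (y * y)) = t * s * ((y * y) * (x * x))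
  comm_one : ∀ t s a b : N, t ≠ 1 → s ≠ 1 → a ≠ 1 → b ≠ 1 →
    t * ((s * a * (s * a)) * (s * b * (s * b))) = t * ((s * b * (s * b)) * (s * a * (s * a)))
  comm_zero : ∀ t s a b : N, t ≠ 1 → s ≠ 1 → a ≠ 1 → b ≠ 1 →
    (t * s * a * (t * s * a)) * (t * s * b * (t * s * b)) =
      (t * s * b * (t * s * b)) * (t * s * a * (t * s * a))
  loop : ∀ t y : N, t ≠ 1 → y ≠ 1 →
    t * y * (t * y) * t * (t * y * (t * y)) = t * (t * y * (t * y))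

/-- Von Neumann regularity, with a witness other than the identity. -/
def IsRegular' {N : Type*} [Monoid N] (x : N) : Prop := ∃ r, r ≠ 1 ∧ x = x * r * x

namespace WLaws

variable {N : Type*} [Monoid N] (hN : WLaws N)
include hN

theorem mul_ne_one_left {x : N} (y : N) (hx : x ≠ 1) : x * y ≠ 1 :=
  fun h => hx (hN.mul_eq_one _ _ h).1

theorem mul_ne_one_right (x : N) {y : N} (hy : y ≠ 1) : x * y ≠ 1 :=
  fun h => hy (hN.mul_eq_one _ _ h).2

theorem isRegular_sandwich {x : N} (y : N) (hx : x ≠ 1) : IsRegular' (x * y * x) := by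
  refine ⟨y * x * y, hN.mul_ne_one_left _ (hN.mul_ne_one_right _ hx), ?_⟩
  have h1 := hN.sandwich x y hx
  have h2 : x * y * x * (y * x * y) * (x * y * x) = x * y * x * y * x * y * x * y * x := by
    simp only [mul_assoc]
  rw [h2, ← h1, ← h1, ← h1]

/-- Products of idempotents are idempotent, and so products of regular elements are regular. -/
theorem isRegular_mul {x y : N} (hx : IsRegular' x) (hy : IsRegular' y) : IsRegular' (x * y) := by
  obtain ⟨r, hr, hx⟩ := hx
  obtain ⟨q, hq, hy⟩ := hy
  refine ⟨q * r, hN.mul_ne_one_left _ hq, ?_⟩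
  have he : (r * x) * (r * x) = r * x := by
    rw [mul_assoc, ← mul_assoc x r x, ← hx]
  have hf : (y * q) * (y * q) = y * q := by
    rw [← mul_assoc, ← hy]
  have h := hN.absorb (r * x) (y * q)
  rw [he, hf] at h
  calc x * y = x * r * x * (y * q * y) := by rw [← hx, ← hy]
    _ = x * (r * x * (y * q)) * y := by simp only [mul_assoc]
    _ = x * (r * x * (y * q)) * (y * q) * y := by
        rw [mul_assoc x _ (y * q), mul_assoc (r * x) _ (y * q), hf]
    _ = x * (r * x * (y * q) * (r * x)) * (y * q) * y := by rw [h]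
    _ = (x * r * x) * (y * q * r) * x * (y * q * y) := by simp only [mul_assoc]
    _ = x * y * (q * r) * (x * y) := by rw [← hx, ← hy]; simp only [mul_assoc]

theorem stable {x p z : N} (h : x = p * x * z) : p * x = x ∧ x * z = x := by
  have h2 : x = p * p * x * (z * z) := by
    conv_lhs => rw [h, h]
    simp only [mul_assoc]
  constructor
  · have : p * x = p * p * p * x * (z * z) := by
      conv_lhs => rw [h2]
      simp only [mul_assoc]
    rw [this, ← hN.cube, ← h2]
  · have : x * z = p * p * x * (z * z * z) := by
      conv_lhs => rw [h2]
      simp only [mul_assoc]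
    rw [this, ← hN.cube, ← h2]

theorem isRegular_overlap {a b c : N} (hb : b ≠ 1) (h1 : IsRegular' (a * b))
    (h2 : IsRegular' (b * c)) : IsRegular' (a * b * c) := by
  obtain ⟨r, hr, h1⟩ := h1
  obtain ⟨q, hq, h2⟩ := h2
  have h3 := hN.sandwich b (r * (a * (b * (c * q)))) hb
  have key : a * b * c = (a * b * r) * (a * b * c) * (q * b * r) * (a * b * c) * (q * b * c) := by
    calc a * b * c = a * b * r * (a * b) * c := by rw [← h1]
      _ = a * b * r * a * (b * c) := by simp only [mul_assoc]
      _ = a * b * r * a * (b * c * q * (b * c)) := by rw [← h2]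
      _ = a * (b * (r * (a * (b * (c * q)))) * b) * c := by simp only [mul_assoc]
      _ = _ := by rw [h3]; simp only [mul_assoc]
  set x := a * b * c
  have hx := (hN.stable (x := x) (p := a * b * r) (z := q * b * r * x * (q * b * c)) (by
    conv_lhs => rw [key]
    simp only [mul_assoc])).2
  have hx' := (hN.stable (x := x) (p := x * (q * b * r)) (z := q * b * c) (by
    conv_lhs => rw [← hx]
    simp only [mul_assoc])).1
  exact ⟨q * b * r, hN.mul_ne_one_right _ hr, hx'.symm⟩

/-- If `h` has a return along the loops `cp` and `cq`, then it is fixed by the loop `cp`. -/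
theorem mul_loop {h c p q : N} (hc : c ≠ 1) (hh : h = h * (c * p) * (c * q)) :
    h * (c * p) = h := by
  have hs : ∀ p q : N, c * p * (c * q) = c * p * (c * p) * (c * q) := by
    intro p q
    have h3 := hN.sandwich c p hc
    calc c * p * (c * q) = c * p * c * q := by simp only [mul_assoc]
      _ = _ := by rw [h3]; simp only [mul_assoc]
  have hxy := hs p q
  have hyx := hs q p
  set x := c * p
  set y := c * q
  have hab := hN.absorb x y
  have e1 : x * y * x = x * x * (y * y) := by
    calc x * y * x = x * (y * x) := mul_assoc _ _ _
      _ = x * (y * y * x) := by rw [hyx]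
      _ = x * y * (y * x) := by simp only [mul_assoc]
      _ = x * x * y * (y * x) := by rw [hxy]
      _ = x * x * (y * y) * x := by simp only [mul_assoc]
      _ = _ := hab
  have e2 : h = h * (x * x * (y * y)) := by
    calc h = h * x * y := hh
      _ = h * x * y * x * y := by rw [← hh]; exact hh
      _ = h * (x * y * x) * y := by simp only [mul_assoc]
      _ = h * (x * x) * (y * y * y) := by rw [e1]; simp only [mul_assoc]
      _ = _ := by rw [← hN.cube]; simp only [mul_assoc]
  calc h * x = h * x * y * x := by rw [← hh]
    _ = h * (x * y * x) := by simp only [mul_assoc]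
    _ = h := by rw [e1, ← e2]

theorem isRegular_evalList {f : ℕ → N} (hf : ∀ c, f c ≠ 1) {l : List ℕ} (hl : l ≠ [])
    (hc : ¬ HasCut l) : IsRegular' (evalList f l) := by
  -- a regular prefix `p` can be extended until it exhausts `l`
  have step : ∀ n (p q : List ℕ), q.length ≤ n → l = p ++ q → p ≠ [] →
      IsRegular' (evalList f p) → IsRegular' (evalList f l) := by
    intro n
    induction n with
    | zero =>
      intro p q hn hpq _ hp
      obtain rfl : q = [] := List.length_eq_zero_iff.1 (by omega)
      rwa [hpq, List.append_nil]
    | succ n ih =>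
      intro p q hn hpq hp0 hp
      cases q with
      | nil => rwa [hpq, List.append_nil]
      | cons d q =>
        by_cases h1 : d ∈ p
        · obtain ⟨p1, p2, rfl⟩ := List.append_of_mem h1
          refine ih (p1 ++ d :: p2 ++ [d]) q (by simp at hn; omega) (by simp [hpq]) (by simp) ?_
          have := hN.isRegular_overlap (a := evalList f p1) (b := evalList f (d :: p2))
            (c := f d) (by simpa using hN.mul_ne_one_left _ (hf d)) (by simpa using hp)
            (by simpa using hN.isRegular_sandwich (evalList f p2) (hf d))
          simpa [mul_assoc] using this
        by_cases h2 : d ∈ q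
        · obtain ⟨q1, q2, rfl⟩ := List.append_of_mem h2
          refine ih (p ++ d :: q1 ++ [d]) q2 (by simp at hn; omega) (by simp [hpq]) (by simp) ?_
          have := hN.isRegular_mul hp (hN.isRegular_sandwich (evalList f q1) (hf d))
          simpa [mul_assoc] using this
        by_cases h3 : ∃ z ∈ p, z ∈ q
        · obtain ⟨z, hzp, hzq⟩ := h3
          obtain ⟨p1, p2, rfl⟩ := List.append_of_mem hzp
          obtain ⟨q1, q2, rfl⟩ := List.append_of_mem hzq
          refine ih (p1 ++ z :: p2 ++ d :: q1 ++ [z]) q2 (by simp at hn; omega)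
            (by simp [hpq]) (by simp) ?_
          have := hN.isRegular_overlap (a := evalList f p1) (b := evalList f (z :: p2))
            (c := evalList f (d :: q1 ++ [z])) (by simpa using hN.mul_ne_one_left _ (hf z))
            (by simpa using hp) (by
              simpa [mul_assoc] using
                hN.isRegular_sandwich (evalList f (p2 ++ d :: q1)) (hf z))
          simpa [mul_assoc] using this
        · push Not at h3
          exact absurd ⟨p, d, q, hpq, h1, h2, h3⟩ hc
  obtain ⟨c, l', rfl⟩ := List.exists_cons_of_ne_nil hl
  by_cases hcl : c ∈ l'
  · obtain ⟨p, q, rfl⟩ := List.append_of_mem hcl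
    refine step _ (c :: p ++ [c]) q le_rfl (by simp) (by simp) ?_
    simpa [mul_assoc] using hN.isRegular_sandwich (evalList f p) (hf c)
  · exact absurd ⟨[], c, l', rfl, by simp, hcl, by simp⟩ hc

/-! ### Words with the same walks -/

/-- The prefixes of a regular word label the vertices of its graph by elements of `N`. -/
theorem exists_walk {f : ℕ → N} (hf : ∀ c, f c ≠ 1) {l : List ℕ} {k r : N}
    (hk : k * evalList f l * r = k) :
    ∃ σ : ℕ → N, Walk σ (fun c => σ c * f c) k l (k * evalList f l) := by
  classical
  have hle : ∀ (c : ℕ) (p q s : List ℕ), l = p ++ c :: q ++ c :: s →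
      k * evalList f (p ++ c :: q) = k * evalList f p := by
    rintro c p q s rfl
    have := hN.mul_loop (h := k * evalList f p) (c := f c) (p := evalList f q)
      (q := evalList f s * r * evalList f p) (hf c) (by
        conv_lhs => rw [← hk]
        simp [mul_assoc])
    simpa [mul_assoc] using this
  have hwd : ∀ (c : ℕ) (p q p' q' : List ℕ), l = p ++ c :: q → l = p' ++ c :: q' →
      k * evalList f p = k * evalList f p' := by
    intro c p q p' q' h h'
    obtain ⟨a, ha1, ha2⟩ | ⟨a, ha1, ha2⟩ := List.append_eq_append_iff.1 (h.symm.trans h')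
    · cases a with
      | nil => simp [ha1]
      | cons d a =>
        obtain ⟨rfl, rfl⟩ : c = d ∧ q = a ++ c :: q' := by simpa using ha2
        rw [ha1, hle c p a q' (by simp [h])]
    · cases a with
      | nil => simp [ha1]
      | cons d a =>
        obtain ⟨rfl, rfl⟩ : c = d ∧ q' = a ++ c :: q := by simpa using ha2
        rw [ha1, hle c p' a q (by simp [h'])]
  have hex : ∀ c, ∃ x, ∀ p q, l = p ++ c :: q → k * evalList f p = x := by
    intro c
    by_cases hc : c ∈ l
    · obtain ⟨p, q, h⟩ := List.append_of_mem hc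
      exact ⟨k * evalList f p, fun p' q' h' => hwd c _ _ _ _ h' h⟩
    · exact ⟨1, fun p q h => absurd (by simp [h]) hc⟩
  choose σ hσ using hex
  refine ⟨σ, ?_⟩
  have key : ∀ q p, l = p ++ q →
      Walk σ (fun c => σ c * f c) (k * evalList f p) q (k * evalList f l) := by
    intro q
    induction q with
    | nil => rintro p rfl; simp
    | cons c q ih =>
      intro p h
      refine ⟨hσ c p q h, ?_⟩
      have := ih (p ++ [c]) (by simp [h])
      change Walk σ (fun c => σ c * f c) (σ c * f c) q (k * evalList f l)
      rw [← hσ c p q h]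
      simpa [mul_assoc] using this
  simpa using key l [] rfl

omit hN in
theorem eq_of_walk {f σ : ℕ → N} {l : List ℕ} {k m : N}
    (h : Walk σ (fun c => σ c * f c) k l m) : k * evalList f l = m := by
  induction l generalizing k with
  | nil => simpa using h
  | cons c l ih =>
    obtain ⟨rfl, h⟩ := h
    rw [evalList_cons, ← mul_assoc, ih h]

/-- Two regular words with the same walks have the same value after `α`, if the idempotents that
begin with these words commute after `α`. -/
theorem evalList_eq_of_comm' {f : ℕ → N} (hf : ∀ c, f c ≠ 1) {l m : List ℕ}
    (hlm : SameWalks l m) {α r q : N} (hr : r ≠ 1)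
    (hl : evalList f l = evalList f l * r * evalList f l)
    (hm : evalList f m = evalList f m * q * evalList f m) (hl0 : evalList f l ≠ 1)
    (hcomm : α * ((evalList f l * r) * (evalList f m * q)) =
      α * ((evalList f m * q) * (evalList f l * r))) :
    α * evalList f l = α * evalList f m := by
  have aux : ∀ {l m : List ℕ}, SameWalks l m → ∀ {r : N},
      evalList f l = evalList f l * r * evalList f l →
      α * evalList f l * r * evalList f m = α * evalList f l := by
    intro l m hlm r hl
    obtain ⟨σ, hσ⟩ := hN.exists_walk hf (l := l) (k := α * evalList f l * r) (r := r) (by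
      conv_rhs => rw [hl]
      simp only [mul_assoc])
    have := eq_of_walk (hlm.walk_iff.1 hσ)
    rw [this]
    conv_rhs => rw [hl]
    simp only [mul_assoc]
  have hA := aux hlm hl
  have hB := aux hlm.symm hm
  set u := evalList f l
  set v := evalList f m
  have hX : α * u = α * v * r * v := by
    calc α * u = α * u * r * v := hA.symm
      _ = α * u * r * (v * q * v) := by rw [← hm]
      _ = α * (u * r * (v * q)) * v := by simp only [mul_assoc]
      _ = α * v * q * u * r * v := by rw [hcomm]; simp only [mul_assoc]
      _ = α * v * r * v := by rw [hB]
  have hY : α * v = α * u * q * u := by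
    calc α * v = α * v * q * u := hB.symm
      _ = α * v * q * (u * r * u) := by rw [← hl]
      _ = α * (v * q * (u * r)) * u := by simp only [mul_assoc]
      _ = α * u * r * v * q * u := by rw [← hcomm]; simp only [mul_assoc]
      _ = α * u * q * u := by rw [hA]
  have h5 := hN.comm_two (α * u) (r * u) (r * v) (q * u)
    (hN.mul_ne_one_right _ hl0) (hN.mul_ne_one_left _ hr)
  have e0 : α * u * (r * u) = α * u := by
    conv_rhs => rw [hl]
    simp only [mul_assoc]
  have hXs : α * u * (r * v) = α * u := by rw [← mul_assoc, hA]
  have hXt : α * u * (q * u) = α * v := by rw [← mul_assoc, ← hY]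
  have hYs : α * v * (r * v) = α * u := by rw [← mul_assoc, ← hX]
  have hYt : α * v * (q * u) = α * v := by rw [← mul_assoc, hB]
  rw [e0] at h5
  simp only [← mul_assoc] at h5
  simp only [mul_assoc _ r v, mul_assoc _ q u] at h5
  simp only [hXs, hXt, hYs, hYt] at h5
  exact h5.symm

omit hN in
theorem idem_of_regular {u r : N} (h : u = u * r * u) : u * r * (u * r) = u * r := by
  rw [← mul_assoc, ← h]

/-- After two letters, words with the same walks are equal. -/
theorem evalList_eq_of_two {f : ℕ → N} (hf : ∀ c, f c ≠ 1) (n : ℕ) {l m : List ℕ}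
    (hn : l.length ≤ n) (hlm : SameWalks l m) {x y : N} (hx : x ≠ 1) (hy : y ≠ 1) :
    x * y * evalList f l = x * y * evalList f m := by
  induction n generalizing l m x y with
  | zero =>
    obtain rfl : l = [] := List.length_eq_zero_iff.1 (by omega)
    rw [hlm.eq_nil]
  | succ n ih =>
    by_cases hc : HasCut l
    · obtain ⟨u, b, v, rfl, hc⟩ := hc
      obtain ⟨u', v', rfl, -, hu, hv⟩ := hlm.cut hc
      simp only [List.length_append, List.length_cons] at hn
      have h1 := ih (l := u) (by omega) hu hx hy
      have h2 := ih (l := v) (by omega) hv (x := x * y * evalList f u') (y := f b)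
        (hN.mul_ne_one_left _ (hN.mul_ne_one_left _ hx)) (hf b)
      simp only [evalList_append, evalList_cons, ← mul_assoc] at h1 h2 ⊢
      rw [h1, h2]
    · by_cases hl : l = []
      · subst hl; rw [hlm.eq_nil]
      have hm : m ≠ [] := by rintro rfl; exact hl hlm.symm.eq_nil
      obtain ⟨r, hr, hlr⟩ := hN.isRegular_evalList hf hl hc
      obtain ⟨q, hq, hmq⟩ := hN.isRegular_evalList hf hm fun h => hc (hlm.symm.hasCut h)
      refine hN.evalList_eq_of_comm' hf hlm hr hlr hmq ?_ ?_
      · obtain ⟨c, l, rfl⟩ := List.exists_cons_of_ne_nil hl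
        simpa using hN.mul_ne_one_left _ (hf c)
      · have := hN.comm_two x y (evalList f l * r) (evalList f m * q) hx hy
        rwa [idem_of_regular hlr, idem_of_regular hmq] at this

/-- After one letter, words with the same walks and the same first letter are equal. -/
theorem evalList_eq_of_one {f : ℕ → N} (hf : ∀ c, f c ≠ 1) {l m : List ℕ} {s : ℕ}
    (hlm : SameWalks (s :: l) (s :: m)) {x : N} (hx : x ≠ 1) :
    x * evalList f (s :: l) = x * evalList f (s :: m) := by
  have key : ∀ {l m : List ℕ}, ¬ HasCut (s :: l) → SameWalks (s :: l) (s :: m) →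
      x * evalList f (s :: l) = x * evalList f (s :: m) := by
    intro l m hc hlm
    obtain ⟨r, hr, hlr⟩ := hN.isRegular_evalList hf (by simp) hc
    obtain ⟨q, hq, hmq⟩ := hN.isRegular_evalList hf (by simp) fun h => hc (hlm.symm.hasCut h)
    refine hN.evalList_eq_of_comm' hf hlm hr hlr hmq ?_ ?_
    · simpa using hN.mul_ne_one_left _ (hf s)
    · have := hN.comm_one x (f s) (evalList f l * r) (evalList f m * q) hx (hf s)
        (hN.mul_ne_one_right _ hr) (hN.mul_ne_one_right _ hq)
      simp only [← mul_assoc (f s), ← evalList_cons] at this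
      rwa [idem_of_regular hlr, idem_of_regular hmq] at this
  by_cases hc : HasCut (s :: l)
  · obtain ⟨u, b, v, h, hc, hu0⟩ := hc.exists_first
    rw [h] at hlm
    obtain ⟨u', v', h', -, hu, hv⟩ := hlm.cut hc
    rw [h, h']
    cases u with
    | nil =>
      obtain rfl := hu.eq_nil
      have := hN.evalList_eq_of_two hf _ le_rfl hv hx (hf b)
      simpa [mul_assoc] using this
    | cons a u =>
      cases u' with
      | nil => exact absurd hu.symm.eq_nil (by simp)
      | cons a' u' =>
        obtain ⟨rfl, -⟩ : s = a ∧ _ := by simpa using h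
        obtain ⟨rfl, -⟩ : s = a' ∧ _ := by simpa using h'
        have h1 := key hu0 hu
        have h2 := hN.evalList_eq_of_two hf _ le_rfl hv (x := x * evalList f (s :: u'))
          (y := f b) (hN.mul_ne_one_left _ hx) (hf b)
        rw [evalList_append, evalList_append, ← mul_assoc, ← mul_assoc, h1, evalList_cons _ b,
          evalList_cons _ b, ← mul_assoc, ← mul_assoc, h2]
  · exact key hc hlm

end WLaws

/-- In every two-coloured graph in which `l` is a walk, the letter `t` is a loop. -/
def IsLoopIn (t : ℕ) (l : List ℕ) : Prop :=
  ∀ (σ ε : ℕ → Bool) (p q : Bool), Walk σ ε p l q → σ t = ε t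

theorem IsLoopIn.eq {t : ℕ} {l : List ℕ} (h : IsLoopIn t l) {K : Type*} {σ ε : ℕ → K} {p q : K}
    (hl : Walk σ ε p l q) : σ t = ε t := by
  classical
  have := h _ _ _ _ (walk_map (fun x => decide (x = ε t)) hl)
  simpa using this

/-- A walk along the part before a cut letter extends to the whole list. -/
theorem IsCut.exists_walk {u v : List ℕ} {b : ℕ} (hc : IsCut u b v) {σ ε : ℕ → Bool} {p q : Bool}
    (h : Walk σ ε p u q) : ∃ σ' ε' : ℕ → Bool, (∀ c ∈ u, σ' c = σ c ∧ ε' c = ε c) ∧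
      σ' b = q ∧ (∀ c ∉ u, ε' c = !q) ∧ Walk σ' ε' p (u ++ b :: v) (!q) := by
  obtain ⟨h1, h2, h3⟩ := hc
  refine ⟨fun c => if c ∈ u then σ c else if c = b then q else !q,
    fun c => if c ∈ u then ε c else !q, fun c hc => by simp [hc], by simp [h1],
    fun c hc => by simp [hc], ?_⟩
  rw [walk_append]
  refine ⟨q, (walk_congr fun c hc => by simp [hc]).1 h, ?_⟩
  rw [walk_cons]
  refine ⟨by simp [h1], ?_⟩
  simp only [h1, if_false]
  refine (walk_of_loops' fun c hc => ?_).2 rfl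
  have h4 : c ∉ u := fun h => h3 c h hc
  have h5 : c ≠ b := by rintro rfl; exact h2 hc
  simp [h4, h5]

namespace WLaws

variable {N : Type*} [Monoid N] (hN : WLaws N)
include hN

theorem mul_eq_of_isLoopIn {f : ℕ → N} (hf : ∀ c, f c ≠ 1) {t : ℕ} {l : List ℕ}
    (hc : ¬ HasCut (t :: l)) (h : IsLoopIn t (t :: l)) :
    f t * evalList f (t :: l) = evalList f (t :: l) := by
  obtain ⟨r, hr, hlr⟩ := hN.isRegular_evalList hf (by simp) hc
  have he := idem_of_regular hlr
  obtain ⟨σ, hσ⟩ := hN.exists_walk hf (l := t :: l) (k := evalList f (t :: l) * r) (r := r) (by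
    rw [mul_assoc _ _ r, he])
  have h1 := h.eq hσ
  rw [← hσ.1] at h1
  have h2 := hN.loop (f t) (evalList f l * r) (hf t) (hN.mul_ne_one_right _ hr)
  simp only [← mul_assoc (f t), ← evalList_cons] at h2
  rw [he, ← h1, he] at h2
  have h3 : evalList f (t :: l) * r = f t * (evalList f (t :: l) * r) := h2.trans (by
    rw [evalList_cons f t (t :: l), mul_assoc (f t), mul_assoc (f t), he])
  conv_rhs => rw [hlr, h3, mul_assoc, ← hlr]

theorem evalList_eq_of_not_hasCut {f : ℕ → N} (hf : ∀ c, f c ≠ 1) {t : ℕ} {l m : List ℕ}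
    (hc : ¬ HasCut (t :: l)) (hlm : SameWalks (t :: l) (t :: m))
    (h : l.head? = m.head? ∨ IsLoopIn t (t :: l)) :
    evalList f (t :: l) = evalList f (t :: m) := by
  have hc' : ¬ HasCut (t :: m) := fun h => hc (hlm.symm.hasCut h)
  obtain h | h := h
  · cases l with
    | nil => exact absurd ⟨[], t, [], rfl, by simp [IsCut]⟩ hc
    | cons s l =>
      cases m with
      | nil => simp at h
      | cons s' m =>
        obtain rfl : s = s' := by simpa using h
        obtain ⟨r, hr, hlr⟩ := hN.isRegular_evalList hf (by simp) hc
        obtain ⟨q, hq, hmq⟩ := hN.isRegular_evalList hf (by simp) hc'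
        have := hN.evalList_eq_of_comm' hf hlm (α := 1) hr hlr hmq
          (by simpa using hN.mul_ne_one_left _ (hf t)) ?_
        · simpa using this
        · have := hN.comm_zero (f t) (f s) (evalList f l * r) (evalList f m * q) (hf t) (hf s)
            (hN.mul_ne_one_right _ hr) (hN.mul_ne_one_right _ hq)
          have e : ∀ (l : List ℕ) (r : N), f t * f s * (evalList f l * r) =
              evalList f (t :: s :: l) * r := fun l r => by
            simp only [evalList_cons, mul_assoc]
          rw [e, e, idem_of_regular hlr, idem_of_regular hmq] at this
          rw [one_mul, one_mul, this]
  · have h' : IsLoopIn t (t :: m) := fun σ ε p q hw => h σ ε p q ((hlm.2 σ ε p q).2 hw)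
    have h1 := hN.mul_eq_of_isLoopIn hf hc h
    have h2 := hN.mul_eq_of_isLoopIn hf hc' h'
    rw [← h1, ← h1, ← h2, ← h2, ← mul_assoc, ← mul_assoc]
    exact hN.evalList_eq_of_two hf _ le_rfl hlm (hf t) (hf t)

/-- The identities of `W_λ` follow from `WLaws`. -/
theorem evalList_eq {f : ℕ → N} (hf : ∀ c, f c ≠ 1) {t : ℕ} {l m : List ℕ}
    (hlm : SameWalks (t :: l) (t :: m)) (h : l.head? = m.head? ∨ IsLoopIn t (t :: l)) :
    evalList f (t :: l) = evalList f (t :: m) := by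
  by_cases hcl : HasCut (t :: l)
  · obtain ⟨u, b, v, hl, hc, hu0⟩ := hcl.exists_first
    rw [hl] at hlm h
    obtain ⟨u', v', hm, hc', hu, hv⟩ := hlm.cut hc
    rw [hl, hm]
    cases u with
    | nil =>
      obtain rfl := hu.eq_nil
      obtain ⟨rfl, rfl⟩ : t = b ∧ l = v := by simpa using hl
      obtain ⟨-, rfl⟩ : t = t ∧ m = v' := by simpa using hm
      obtain h | h := h
      · cases l with
        | nil => rw [hv.eq_nil]
        | cons s l =>
          cases m with
          | nil => simp at h
          | cons s' m =>
            obtain rfl : s = s' := by simpa using h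
            simpa using hN.evalList_eq_of_one hf hv (hf t)
      · obtain ⟨σ, ε, -, h1, h2, h3⟩ := hc.exists_walk (σ := fun _ => true) (ε := fun _ => true)
          (p := true) (q := true) (by simp)
        have := h σ ε _ _ h3
        rw [h1, h2 t (by simp)] at this
        simp at this
    | cons a u =>
      cases u' with
      | nil => exact absurd hu.symm.eq_nil (by simp)
      | cons a' u' =>
        obtain ⟨rfl, rfl⟩ : t = a ∧ l = u ++ b :: v := by simpa using hl
        obtain ⟨rfl, rfl⟩ : t = a' ∧ m = u' ++ b :: v' := by simpa using hm
        have h1 : evalList f (t :: u) = evalList f (t :: u') := by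
          refine hN.evalList_eq_of_not_hasCut hf hu0 hu ?_
          refine h.imp (fun h => ?_) fun h σ ε p q hw => ?_
          · have hne : ∀ {u : List ℕ}, ¬ HasCut (t :: u) → u ≠ [] := by
              rintro u hu rfl
              exact hu ⟨[], t, [], rfl, by simp [IsCut]⟩
            obtain ⟨d, w, rfl⟩ := List.exists_cons_of_ne_nil (hne hu0)
            obtain ⟨d', w', rfl⟩ := List.exists_cons_of_ne_nil
              (hne fun h => hu0 (hu.symm.hasCut h))
            simpa using h
          · obtain ⟨σ', ε', h1, -, -, h3⟩ := hc.exists_walk hw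
            have := h σ' ε' _ _ h3
            rwa [(h1 t (by simp)).1, (h1 t (by simp)).2] at this
        have h2 := hN.evalList_eq_of_two hf _ le_rfl hv (x := evalList f (t :: u')) (y := f b)
          (by simpa using hN.mul_ne_one_left _ (hf t)) (hf b)
        rw [evalList_append, evalList_append, h1, evalList_cons _ b,
          evalList_cons _ b, ← mul_assoc, ← mul_assoc, h2]
  · exact hN.evalList_eq_of_not_hasCut hf hcl hlm h

end WLaws

/-! ### A model of `W_λ` -/

/-- The elements of `W_λ`. In a nonzero product, occurrences of `a` and of the letters `x`, `y`
alternate; think of `a` as an edge from `false` to `true` and of `x`, `y` as edges from `true` to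
`false`. Then `el p q d` is the value of all walks of length at least two from `p` to `q` in which
the first of the letters `x`, `y` is `b d`, where `b false = x` and `b true = y`. -/
inductive WModel : Type
  | zero
  | a
  | b (d : Bool)
  | el (p q d : Bool)
  deriving DecidableEq

namespace WModel

/-- The multiplication of `W_λ`. -/
protected def mul : WModel → WModel → WModel
  | el p q d, el p' q' _ => if q = p' then el p q' d else zero
  | el p q d, a => if q = false then el p true d else zero
  | el p q d, b _ => if q = true then el p false d else zero
  | a, el p q d => if p = true then el false q d else zero
  | a, b d => el false false d
  | b d, el p q _ => if p = false then el true q d else zero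
  | b d, a => el true true d
  | _, _ => zero

instance : SemigroupWithZero WModel where
  mul := WModel.mul
  mul_assoc := by
    rintro (_ | _ | (_ | _) | ⟨_ | _, _ | _, _ | _⟩) (_ | _ | (_ | _) | ⟨_ | _, _ | _, _ | _⟩)
      (_ | _ | (_ | _) | ⟨_ | _, _ | _, _ | _⟩) <;> rfl
  zero := zero
  zero_mul := by rintro (_ | _ | _ | _) <;> rfl
  mul_zero := by rintro (_ | _ | _ | _) <;> rfl

instance : Fintype WModel where
  elems := {zero, a, b false, b true, el false false false, el false false true,
    el false true false, el false true true, el true false false, el true false true,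
    el true true false, el true true true}
  complete := by
    rintro (_ | _ | (_ | _) | ⟨_ | _, _ | _, _ | _⟩) <;> decide

theorem zero_def : (0 : WModel) = zero := rfl

theorem el_mul_el (p q d p' q' d' : Bool) :
    el p q d * el p' q' d' = if q = p' then el p q' d else zero := rfl

theorem a_mul_el (p q d : Bool) : a * el p q d = if p = true then el false q d else zero := rfl

/-! ### The identities of `W_λ` -/

section Identities

variable {σ ε δ : ℕ → Bool} {k : ℕ → WModel}

/-- The value of a walk that is preceded by a long walk. -/
theorem el_mul_evalList
    (hk : ∀ c, k c = el (σ c) (ε c) (δ c) ∨ k c = a ∧ σ c = false ∧ ε c = true)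
    {l : List ℕ} {p r q d : Bool} (h : Walk σ ε r l q) :
    ((el p r d : WModel) : WithOne WModel) * evalList (fun c => (k c : WithOne WModel)) l =
      (el p q d : WModel) := by
  induction l generalizing r with
  | nil => obtain rfl := h; simp
  | cons c l ih =>
    obtain ⟨rfl, h⟩ := h
    rw [evalList_cons, ← mul_assoc, ← WithOne.coe_mul]
    have : el p (σ c) d * k c = el p (ε c) d := by
      obtain hc | ⟨hc, h1, h2⟩ := hk c
      · rw [hc, el_mul_el, if_pos rfl]
      · rw [hc, h1, h2]; rfl
    rw [this, ih h]

theorem el_mul_evalList_eq_zero (hk : ∀ c, k c = el (σ c) (ε c) (δ c))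
    {l : List ℕ} {p r d : Bool} (h : ∀ q, ¬ Walk σ ε r l q) :
    ((el p r d : WModel) : WithOne WModel) * evalList (fun c => (k c : WithOne WModel)) l =
      (zero : WModel) := by
  induction l generalizing r with
  | nil => exact absurd rfl (h r)
  | cons c l ih =>
    rw [evalList_cons, ← mul_assoc, ← WithOne.coe_mul, hk, el_mul_el]
    split_ifs with hr
    · exact ih fun q hq => h q ⟨hr, hq⟩
    · exact coe_zero_mul_evalList l

theorem evalList_walk (hk : ∀ c, k c = el (σ c) (ε c) (δ c)) {t : ℕ} {l : List ℕ} {p q : Bool}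
    (h : Walk σ ε p (t :: l) q) :
    evalList (fun c => (k c : WithOne WModel)) (t :: l) = (el p q (δ t) : WModel) := by
  rw [evalList_cons, hk, ← h.1, el_mul_evalList (fun c => Or.inl (hk c)) h.2]

theorem evalList_not_walk (hk : ∀ c, k c = el (σ c) (ε c) (δ c)) {t : ℕ} {l : List ℕ}
    (h : ∀ p q, ¬ Walk σ ε p (t :: l) q) :
    evalList (fun c => (k c : WithOne WModel)) (t :: l) = (zero : WModel) := by
  rw [evalList_cons, hk, el_mul_evalList_eq_zero hk fun q hq => h _ q ⟨rfl, hq⟩]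

theorem evalList_eq_zero_of_mem {l : List ℕ} {c : ℕ} (hc : c ∈ l) (hk : k c = zero) :
    evalList (fun c => (k c : WithOne WModel)) l = (zero : WModel) := by
  obtain ⟨l, m, rfl⟩ := List.append_of_mem hc
  rw [evalList_append, evalList_cons, hk, ← zero_def, coe_zero_mul_evalList]
  generalize evalList (fun c => (k c : WithOne WModel)) l = z
  induction z using WithOne.recOneCoe with
  | one => rfl
  | coe z => exact congrArg _ (mul_zero z)

variable {t t' : ℕ} {l m : List ℕ}
  (h : ∀ k : ℕ → WModel, evalList (fun c => (k c : WithOne WModel)) (t :: l) =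
    evalList (fun c => (k c : WithOne WModel)) (t' :: m))
include h

theorem head_eq : t = t' := by
  by_contra hne
  have hw : ∀ l : List ℕ, Walk (fun _ => true) (fun _ => true) true l true := fun l =>
    (walk_of_loops' fun c _ => ⟨rfl, rfl⟩).2 rfl
  have := h fun c => el true true (decide (c = t))
  rw [evalList_walk (fun c => rfl) (hw _), evalList_walk (fun c => rfl) (hw _)] at this
  have := WithOne.coe_injective this
  simp [Ne.symm hne] at this

theorem mem_of_mem {c : ℕ} (hc : c ∈ t :: l) : c ∈ t' :: m := by
  by_contra hc'
  have := h fun d => if d = c then zero else el true true true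
  rw [evalList_eq_zero_of_mem hc (by simp)] at this
  have h2 : evalList (fun d => ((if d = c then zero else el true true true : WModel) :
      WithOne WModel)) (t' :: m) = evalList (fun d => ((el true true true : WModel) :
      WithOne WModel)) (t' :: m) := evalList_congr fun d hd => by
    rw [if_neg]
    rintro rfl
    exact hc' hd
  rw [h2, evalList_walk (σ := fun _ => true) (ε := fun _ => true) (p := true) (q := true)
    (δ := fun _ => true) (fun _ => rfl) ((walk_of_loops' fun c _ => ⟨rfl, rfl⟩).2 rfl)] at this
  exact absurd (WithOne.coe_injective this) (by decide)

theorem walk_of_walk {p q : Bool} (hw : Walk σ ε p (t :: l) q) : Walk σ ε p (t' :: m) q := by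
  have := h fun c => el (σ c) (ε c) true
  rw [evalList_walk (fun c => rfl) hw] at this
  by_cases hm : ∃ p' q', Walk σ ε p' (t' :: m) q'
  · obtain ⟨p', q', hm⟩ := hm
    rw [evalList_walk (fun c => rfl) hm] at this
    have := WithOne.coe_injective this
    simp only [el.injEq] at this
    rwa [this.1, this.2.1]
  · push Not at hm
    rw [evalList_not_walk (fun c => rfl) hm] at this
    exact absurd (WithOne.coe_injective this) (by simp)

theorem sameWalks : SameWalks (t :: l) (t' :: m) :=
  ⟨fun _ => ⟨mem_of_mem h, mem_of_mem fun k => (h k).symm⟩,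
    fun _ _ _ _ => ⟨walk_of_walk h, walk_of_walk fun k => (h k).symm⟩⟩

theorem head?_eq_or_isLoopIn : l.head? = m.head? ∨ IsLoopIn t (t :: l) := by
  obtain rfl := head_eq h
  have hs := sameWalks h
  by_contra! hcon
  obtain ⟨hne, hloop⟩ := hcon
  -- a colouring in which `t` goes from `false` to `true`, like the letter `a`
  obtain ⟨σ, ε, p, q, hw, hσ, hε⟩ : ∃ (σ ε : ℕ → Bool) (p q : Bool),
      Walk σ ε p (t :: l) q ∧ σ t = false ∧ ε t = true := by
    simp only [IsLoopIn, not_forall] at hloop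
    obtain ⟨σ, ε, p, q, hw, hσ⟩ := hloop
    rcases hs : σ t <;> rcases he : ε t
    · simp [hs, he] at hσ
    · exact ⟨σ, ε, p, q, hw, hs, he⟩
    · exact ⟨_, _, _, _, walk_map not hw, by simp [hs], by simp [he]⟩
    · simp [hs, he] at hσ
  have hwm := (hs.2 _ _ _ _).1 hw
  have hnil : ∀ {l m : List ℕ}, SameWalks (t :: l) (t :: m) → Walk σ ε p (t :: m) q →
      l = [] → m = [] := by
    rintro l m hs hw rfl
    cases m with
    | nil => rfl
    | cons s m =>
      obtain rfl : s = t := by simpa using (hs.1 s).2 (by simp)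
      have := hw.2.1
      simp [hσ, hε] at this
  cases l with
  | nil => exact hne (by rw [hnil hs hwm rfl])
  | cons s l =>
    cases m with
    | nil => exact absurd (hnil hs.symm hw rfl) (by simp)
    | cons s' m =>
      have h1 : σ s = true := by rw [← hw.2.1, hε]
      have h1' : σ s' = true := by rw [← hwm.2.1, hε]
      have h2 : ∀ {s}, σ s = true → s ≠ t := by
        rintro s h1 rfl
        simp [hσ] at h1
      have hss : s' ≠ s := by
        rintro rfl
        exact hne rfl
      let k : ℕ → WModel := fun c => if c = t then a else el (σ c) (ε c) (decide (c = s))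
      have hk : ∀ c, k c = el (σ c) (ε c) (decide (c = s)) ∨
          k c = a ∧ σ c = false ∧ ε c = true := by
        intro c
        by_cases hc : c = t
        · subst hc; exact Or.inr ⟨by simp [k], hσ, hε⟩
        · exact Or.inl (by simp [k, hc])
      have key : ∀ {s₁ l}, σ s₁ = true → Walk σ ε p (t :: s₁ :: l) q →
          evalList (fun c => (k c : WithOne WModel)) (t :: s₁ :: l) =
            (el false q (decide (s₁ = s)) : WModel) := by
        intro s₁ l h3 hw
        have h4 : k t * k s₁ = el false (ε s₁) (decide (s₁ = s)) := by
          simp [k, h2 h3, h3, a_mul_el]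
        rw [evalList_cons, evalList_cons, ← mul_assoc, ← WithOne.coe_mul, h4,
          el_mul_evalList hk hw.2.2]
      have := h k
      rw [key h1 hw, key h1' hwm] at this
      have := WithOne.coe_injective this
      simp [hss] at this

end Identities

end WModel

/-- A finite basis of identities of `W_λ`. -/
def wIdentities : Set SemigroupIdentity :=
  let x := var 0
  let y := var 1
  let t := var 2
  let s := var 3
  {(x * x, x * x * x),
    (x * y * x, x * y * x * y * x),
    (x * x * (y * y) * x, x * x * (y * y)),
    (t * s * ((x * x) * (y * y)), t * s * ((y * y) * (x * x))),
    (t * ((s * x * (s * x)) * (s * y * (s * y))), t * ((s * y * (s * y)) * (s * x * (s * x)))),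
    ((t * s * x * (t * s * x)) * (t * s * y * (t * s * y)),
      (t * s * y * (t * s * y)) * (t * s * x * (t * s * x))),
    (t * y * (t * y) * t * (t * y * (t * y)), t * (t * y * (t * y)))}

theorem WModel.satisfies_wIdentities {e : SemigroupIdentity} (he : e ∈ wIdentities) :
    SatisfiesIdentity WModel e := by
  obtain rfl | rfl | rfl | rfl | rfl | rfl | rfl := he <;> intro φ <;>
    simp only [map_mul] <;> generalize φ (var 0) = x
  · revert x; decide +kernel
  all_goals generalize φ (var 1) = y
  · revert x y; decide +kernel
  · revert x y; decide +kernel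
  all_goals generalize φ (var 2) = t
  rotate_right
  · revert y t; decide +kernel
  all_goals generalize φ (var 3) = s
  · revert x y t s; decide +kernel
  · revert x y t s; decide +kernel
  · revert x y t s; decide +kernel

theorem WLaws.withOne {T : Type*} [Semigroup T]
    (hT : ∀ e ∈ wIdentities, SatisfiesIdentity T e) : WLaws (WithOne T) := by
  have hT' := fun (x y t s : T) => fun e he =>
    (satisfiesIdentity_iff_lift e).1 (hT e he) (assign [x, y, t, s] x)
  simp only [wIdentities, Set.mem_insert_iff, Set.mem_singleton_iff, forall_eq_or_imp,
    forall_eq, map_mul, FreeSemigroup.lift_of, assign_zero, assign_one, assign_two,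
    assign_three] at hT'
  have hcube : ∀ x : WithOne T, x * x = x * x * x := by
    intro x
    induction x using WithOne.recOneCoe with
    | one => simp
    | coe x => exact_mod_cast (hT' x x x x).1
  have lift : ∀ {x : WithOne T}, x ≠ 1 → ∃ y : T, x = y := fun {x} hx =>
    ⟨_, (WithOne.coe_unone hx).symm⟩
  refine ⟨?_, hcube, ?_, ?_, ?_, ?_, ?_, ?_⟩
  · intro x y h
    induction x using WithOne.recOneCoe with
    | one => simpa using h
    | coe x =>
      induction y using WithOne.recOneCoe with
      | one => simp at h
      | coe y => exact absurd h WithOne.coe_ne_one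
  · intro x y hx
    obtain ⟨x, rfl⟩ := lift hx
    induction y using WithOne.recOneCoe with
    | one => simpa using hcube x
    | coe y => exact_mod_cast (hT' x y x x).2.1
  · intro x y
    induction x using WithOne.recOneCoe with
    | one => simp
    | coe x =>
      induction y using WithOne.recOneCoe with
      | one => simpa using (hcube x).symm
      | coe y => exact_mod_cast (hT' x y x x).2.2.1
  · intro t s x y ht hs
    obtain ⟨t, rfl⟩ := lift ht
    obtain ⟨s, rfl⟩ := lift hs
    induction x using WithOne.recOneCoe with
    | one => simp
    | coe x =>
      induction y using WithOne.recOneCoe with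
      | one => simp
      | coe y => exact_mod_cast (hT' x y t s).2.2.2.1
  · intro t s x y ht hs hx hy
    obtain ⟨t, rfl⟩ := lift ht
    obtain ⟨s, rfl⟩ := lift hs
    obtain ⟨x, rfl⟩ := lift hx
    obtain ⟨y, rfl⟩ := lift hy
    exact_mod_cast (hT' x y t s).2.2.2.2.1
  · intro t s x y ht hs hx hy
    obtain ⟨t, rfl⟩ := lift ht
    obtain ⟨s, rfl⟩ := lift hs
    obtain ⟨x, rfl⟩ := lift hx
    obtain ⟨y, rfl⟩ := lift hy
    exact_mod_cast (hT' x y t s).2.2.2.2.2.1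
  · intro t y ht hy
    obtain ⟨t, rfl⟩ := lift ht
    obtain ⟨y, rfl⟩ := lift hy
    exact_mod_cast (hT' t y t t).2.2.2.2.2.2

/-- The generators of `W_λ` in the model. -/
def WModel.ofGen : IndicatorBurnside.Gen3 → WModel
  | .a => a
  | .x => b false
  | .y => b true

/-- The elements of the model as words in the generators of `W_λ`. -/
def WModel.normalForm {S : Type} [SemigroupWithZero S] (g : IndicatorBurnside.Gen3 → S) :
    WModel → S
  | zero => 0
  | a => g .a
  | b false => g .x
  | b true => g .y
  | el false false false => g .a * g .x
  | el false false true => g .a * g .y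
  | el false true false => g .a * (g .x * g .a)
  | el false true true => g .a * (g .y * g .a)
  | el true false false => g .x * (g .a * g .x)
  | el true false true => g .y * (g .a * g .y)
  | el true true false => g .x * g .a
  | el true true true => g .y * g .a

theorem hasFiniteBasis_Wlam : HasFiniteBasis.{u} IndicatorBurnside.Wlam := by
  refine HasFiniteBasis.of_presentation fun S _ g hg => ?_
  have hrel := hg.relation
  simp only [Set.mem_insert_iff, Set.mem_singleton_iff, forall_eq_or_imp, forall_eq, map_mul,
    liftZero_gen₀, liftZero_zero] at hrel
  obtain ⟨haa, hxx, hyy, hxy, hyx, hax, hay, hxa, hya, hxay, hyax⟩ := hrel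
  simp only [mul_assoc] at hax hay hxa hya hxay hyax
  have mz : ∀ {p q : S}, p * q = 0 → ∀ z, p * (q * z) = 0 := fun h z => by
    rw [← mul_assoc, h, zero_mul]
  have m4 : ∀ {p q : S}, p * q = p * (q * (p * q)) → ∀ z,
      p * (q * (p * (q * z))) = p * (q * z) := fun {p q} h z => by
    conv_rhs => rw [← mul_assoc, h]
    simp only [mul_assoc]
  have m3 : ∀ {p q r : S}, p * (q * r) = p * (q * p) → ∀ z,
      p * (q * (r * z)) = p * (q * (p * z)) := fun {p q r} h z => by
    have := congrArg (· * z) h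
    simpa only [mul_assoc] using this
  obtain ⟨F, hF0, hF⟩ := hg.exists_hom WModel WModel.ofGen (by
    simp only [Set.mem_insert_iff, Set.mem_singleton_iff, forall_eq_or_imp, forall_eq, map_mul,
      liftZero_gen₀, liftZero_zero]
    decide)
  refine ⟨wIdentities, by unfold wIdentities; exact Set.toFinite _, fun e he =>
    hg.satisfies F hF0 hF (WModel.normalForm g) rfl ?_ ?_ (WModel.satisfies_wIdentities he), ?_⟩
  · rintro (_ | _ | _) <;> rfl
  · rintro (_ | _ | _) (_ | _ | (_ | _) | ⟨_ | _, _ | _, _ | _⟩)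
    all_goals
      conv_lhs =>
        simp only [WModel.normalForm, haa, hxx, hyy, hxy, hyx, hxay, hyax, ← hax,
          ← hay, ← hxa, ← hya, mz haa, mz hxx, mz hyy, mz hxy, mz hyx, m4 hax, m4 hay, m4 hxa,
          m4 hya, m3 hxay, m3 hyax, mul_zero, mul_assoc]
      rfl
  · intro T _ hT e he
    have hF' : Function.Surjective F := by
      intro m
      refine ⟨WModel.normalForm g m, ?_⟩
      rcases m with _ | _ | (_ | _) | ⟨_ | _, _ | _, _ | _⟩ <;>
        simp only [WModel.normalForm, map_mul, hF] <;> first | exact hF0 | rfl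
    have hW := (satisfiesIdentity_iff_evalList e).1 (he.of_surjective F hF')
    rw [satisfiesIdentity_iff_evalList]
    intro f
    obtain ⟨⟨t, l⟩, ⟨t', m⟩⟩ := e
    have h : ∀ k : ℕ → WModel, evalList (fun c => (k c : WithOne WModel)) (t :: l) =
      evalList (fun c => (k c : WithOne WModel)) (t' :: m) := hW
    obtain rfl := WModel.head_eq h
    exact (WLaws.withOne hT).evalList_eq (fun c => WithOne.coe_ne_one) (WModel.sameWalks h)
      (WModel.head?_eq_or_isLoopIn h)

theorem hasFiniteBasis_Wrho : HasFiniteBasis.{u} IndicatorBurnside.Wrho := by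
  refine hasFiniteBasis_Wlam.presentedWithZero_op (fun S _ g hg => ?_) (fun S _ g hg => ?_)
  all_goals
    simp only [Set.mem_insert_iff, Set.mem_singleton_iff, forall_eq_or_imp, forall_eq, map_mul,
      liftZero_gen₀, liftZero_zero, ← MulOpposite.op_mul, MulOpposite.op_inj,
      MulOpposite.op_eq_zero_iff, ← mul_assoc] at hg ⊢
    obtain ⟨h1, h2, h3, h4, h5, h6, h7, h8, h9, h10, h11⟩ := hg
    exact ⟨h1, h2, h3, h5, h4, h6, h7, h8, h9, h11, h10⟩

/-! ### The semigroups `C_λ` and `C_ρ` -/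

/-- After `p`, only the set of the letters matters if, after `p`, all factors commute and are
idempotent. -/
theorem mul_evalList_eq_of_mem_iff {N : Type*} [Monoid N] {p : N} {f : ℕ → N}
    (hc : ∀ z w, p * z * w = p * w * z) (hi : ∀ z, p * z * z = p * z) {l m : List ℕ}
    (h : ∀ c, c ∈ l ↔ c ∈ m) : p * evalList f l = p * evalList f m := by
  have absorb : ∀ {l : List ℕ} {c}, c ∈ l → p * evalList f l * f c = p * evalList f l := by
    intro l c hcl
    obtain ⟨a, b, rfl⟩ := List.append_of_mem hcl
    have : p * evalList f (a ++ c :: b) = p * f c * (evalList f a * evalList f b) := by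
      rw [evalList_append, evalList_cons, ← mul_assoc, ← mul_assoc, hc _ (f c), mul_assoc]
    rw [this, mul_assoc p, hc, ← mul_assoc, hi, mul_assoc]
  have absorb' : ∀ {l m : List ℕ}, (∀ c ∈ m, c ∈ l) →
      p * evalList f l * evalList f m = p * evalList f l := by
    intro l m hlm
    induction m with
    | nil => simp
    | cons c m ih =>
      rw [evalList_cons, ← mul_assoc, absorb (hlm c (by simp)),
        ih fun d hd => hlm d (by simp [hd])]
  rw [← absorb' fun c hcm => (h c).2 hcm, hc, absorb' fun c hcl => (h c).1 hcl]

/-- The laws, with an identity adjoined, of a finite basis of identities of `C_λ`. -/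
structure CLaws (N : Type*) [Monoid N] : Prop where
  comm : ∀ {x y : N}, x ≠ 1 → y ≠ 1 → ∀ z w, x * y * z * w = x * y * w * z
  idem : ∀ {x y : N}, x ≠ 1 → y ≠ 1 → ∀ z, x * y * z * z = x * y * z
  cube : ∀ x : N, x * x * x = x * x
  swap : ∀ {x y z : N}, x ≠ 1 → y ≠ 1 → z ≠ 1 → x * y * y * z = x * z * y * z
  move : ∀ {x y z : N}, x ≠ 1 → y ≠ 1 → z ≠ 1 → x * y * (x * y) * z = z * z * (x * y)

namespace CLaws

variable {N : Type*} [Monoid N] {f : ℕ → N}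

theorem evalList_eq_of_mem_iff (hN : CLaws N) (hf : ∀ c, f c ≠ 1) (s t : ℕ) {l m : List ℕ}
    (h : ∀ c, c ∈ l ↔ c ∈ m) : evalList f (s :: t :: l) = evalList f (s :: t :: m) := by
  simp only [evalList_cons, ← mul_assoc]
  exact mul_evalList_eq_of_mem_iff (hN.comm (hf s) (hf t)) (hN.idem (hf s) (hf t)) h

/-- If the second letter is repeated, any other letter but the first can take its place. -/
theorem evalList_eq_of_second_mem (hN : CLaws N) (hf : ∀ c, f c ≠ 1) (s : ℕ) {t t' : ℕ}
    {l : List ℕ} (ht : t ∈ l) (ht' : t' ∈ l) :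
    evalList f (s :: t :: l) = evalList f (s :: t' :: l) := by
  rw [hN.evalList_eq_of_mem_iff hf s t (m := t :: t' :: l) (by grind),
    hN.evalList_eq_of_mem_iff hf s t' (m := t :: t' :: l) (by grind)]
  simp only [evalList_cons, ← mul_assoc]
  rw [hN.swap (hf s) (hf t) (hf t')]

/-- If the first two letters are repeated, then each letter can be moved to the front. -/
theorem evalList_eq_square (hN : CLaws N) (hf : ∀ c, f c ≠ 1) {s t z : ℕ} {l : List ℕ}
    (hs : s = t ∨ s ∈ l) (ht : s = t ∨ t ∈ l) (hz : z ∈ s :: l) :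
    evalList f (s :: t :: l) = evalList f (z :: z :: s :: t :: l) := by
  -- the first two letters may be assumed to occur once more
  have h : evalList f (s :: t :: l) = evalList f (s :: t :: s :: t :: z :: l) := by
    by_cases hst : s = t
    · subst hst
      have : evalList f (s :: s :: l) = evalList f (s :: s :: s :: l) := by
        simp only [evalList_cons, ← mul_assoc, hN.cube]
      rw [this]
      exact hN.evalList_eq_of_mem_iff hf s s (by grind)
    · exact hN.evalList_eq_of_mem_iff hf s t (by grind)
  rw [h]
  have := congrArg (· * evalList f l) (hN.move (hf s) (hf t) (hf z))
  simpa [mul_assoc] using this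

/-- The identities of `C_λ` follow from `CLaws`. The second letter is kept if it is not repeated;
otherwise the first letter is kept if it is not repeated; otherwise only the content matters. -/
theorem evalList_eq (hN : CLaws N) (hf : ∀ c, f c ≠ 1) {u v : List ℕ}
    (hmem : ∀ c, c ∈ u ↔ c ∈ v)
    (h1 : ∀ s, (∃ l, u = s :: l ∧ s ∉ l) ↔ ∃ m, v = s :: m ∧ s ∉ m)
    (h2 : ∀ s t, s ≠ t → ((∃ l, u = s :: t :: l ∧ t ∉ l) ↔ ∃ m, v = s :: t :: m ∧ t ∉ m)) :
    evalList f u = evalList f v := by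
  match u, v with
  | [], [] => rfl
  | [], s :: v => simpa using hmem s
  | s :: u, [] => simpa using hmem s
  | [s], s' :: v =>
    obtain ⟨m, hm, hs⟩ := (h1 s).1 ⟨[], rfl, by simp⟩
    obtain ⟨rfl, rfl⟩ := List.cons_eq_cons.1 hm
    have : v = [] := List.eq_nil_iff_forall_not_mem.2 fun c hc => by
      have := (hmem c).2 (by simp [hc])
      simp only [List.mem_singleton] at this
      exact hs (this ▸ hc)
    rw [this]
  | s' :: u, [s] =>
    obtain ⟨m, hm, hs⟩ := (h1 s).2 ⟨[], rfl, by simp⟩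
    obtain ⟨rfl, rfl⟩ := List.cons_eq_cons.1 hm
    have : u = [] := List.eq_nil_iff_forall_not_mem.2 fun c hc => by
      have := (hmem c).1 (by simp [hc])
      simp only [List.mem_singleton] at this
      exact hs (this ▸ hc)
    rw [this]
  | s :: t :: l, s' :: t' :: m =>
    simp only [List.cons.injEq] at h1 h2
    by_cases ht : s ≠ t ∧ t ∉ l
    · obtain ⟨m', ⟨rfl, rfl, rfl⟩, ht'⟩ := (h2 s t ht.1).1 ⟨l, ⟨rfl, rfl, rfl⟩, ht.2⟩
      have := h1 s'
      exact hN.evalList_eq_of_mem_iff hf _ _ (by grind)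
    have ht' : ¬ (s' ≠ t' ∧ t' ∉ m) := fun hm => ht <| by
      obtain ⟨_, ⟨rfl, rfl, rfl⟩, h⟩ := (h2 s' t' hm.1).2 ⟨m, ⟨rfl, rfl, rfl⟩, hm.2⟩
      exact ⟨hm.1, h⟩
    by_cases hs : s ∉ t :: l
    · obtain ⟨m', ⟨rfl, rfl⟩, hs'⟩ := (h1 s).1 ⟨_, ⟨rfl, rfl⟩, hs⟩
      have h : t' ∈ l := by grind
      rw [hN.evalList_eq_of_second_mem hf s' (by grind) h]
      exact hN.evalList_eq_of_mem_iff hf _ _ (by grind)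
    have hs' : ¬ s' ∉ t' :: m := fun hm => hs <| by
      obtain ⟨_, ⟨rfl, rfl⟩, h⟩ := (h1 s').2 ⟨_, ⟨rfl, rfl⟩, hm⟩
      exact h
    rw [hN.evalList_eq_square hf (z := s) (by grind) (by grind) (by simp),
      hN.evalList_eq_square hf (s := s') (z := s) (by grind) (by grind) (by grind)]
    exact hN.evalList_eq_of_mem_iff hf _ _ (by grind)

end CLaws

/-- The elements of `C_λ`. -/
inductive CModel : Type
  | zero
  | x
  | xx
  | y
  | xy
  deriving DecidableEq

namespace CModel

/-- The multiplication of `C_λ`. -/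
protected def mul : CModel → CModel → CModel
  | x, x => xx
  | x, xx => xx
  | x, y => xy
  | xx, x => xx
  | xx, xx => xx
  | y, x => y
  | y, xx => y
  | xy, x => xy
  | xy, xx => xy
  | _, _ => zero

instance : Fintype CModel where
  elems := {zero, x, xx, y, xy}
  complete := by rintro (_ | _ | _ | _ | _) <;> decide

instance : SemigroupWithZero CModel where
  mul := CModel.mul
  mul_assoc := by
    rintro (_ | _ | _ | _ | _) (_ | _ | _ | _ | _) (_ | _ | _ | _ | _) <;> rfl
  zero := zero
  zero_mul := by rintro (_ | _ | _ | _ | _) <;> rfl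
  mul_zero := by rintro (_ | _ | _ | _ | _) <;> rfl

/-- The generators of `C_λ` in the model. -/
def ofGen : IndicatorBurnside.Gen2 → CModel
  | .x => x
  | .y => y

/-- The elements of the model as words in the generators of `C_λ`. -/
def normalForm {S : Type} [SemigroupWithZero S] (g : IndicatorBurnside.Gen2 → S) : CModel → S
  | zero => 0
  | x => g .x
  | xx => g .x * g .x
  | y => g .y
  | xy => g .x * g .y

section Identities

variable {k : ℕ → CModel}

theorem coe_mul_ne {p q : CModel} (hpq : p ≠ q) (h : ∀ z, p * z ≠ q) (Z : WithOne CModel) :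
    (p : WithOne CModel) * Z ≠ q := by
  induction Z using WithOne.recOneCoe with
  | one => simpa using hpq
  | coe z => exact_mod_cast h z

theorem y_mul_evalList {l : List ℕ} (h : ∀ c ∈ l, k c = x ∨ k c = xx) :
    (y : WithOne CModel) * evalList (fun c => (k c : WithOne CModel)) l = y := by
  induction l with
  | nil => simp
  | cons c l ih =>
    have hc : y * k c = y := by obtain h | h := h c (by simp) <;> rw [h] <;> rfl
    rw [evalList_cons, ← mul_assoc, ← WithOne.coe_mul, hc, ih fun d hd => h d (by simp [hd])]

theorem y_mul_evalList_eq_zero {l : List ℕ} {c : ℕ} (hc : c ∈ l) (hk : k c = y) :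
    (y : WithOne CModel) * evalList (fun c => (k c : WithOne CModel)) l = (0 : CModel) := by
  induction l with
  | nil => simp at hc
  | cons d l ih =>
    rw [evalList_cons, ← mul_assoc, ← WithOne.coe_mul]
    have hd : ∀ z, z = 0 ∨ y * z = 0 ∨ y * z = y := by decide
    obtain h | h | h := hd (k d)
    · rw [h, mul_zero, coe_zero_mul_evalList]
    · rw [h, coe_zero_mul_evalList]
    · rw [h]
      refine ih ?_
      rcases List.mem_cons.1 hc with rfl | hc
      · rw [hk] at h; exact absurd h (by decide)
      · exact hc

theorem evalList_ne_zero {l : List ℕ} (h : ∀ c ∈ l, k c = x) :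
    (xx : WithOne CModel) * evalList (fun c => (k c : WithOne CModel)) l = xx := by
  induction l with
  | nil => simp
  | cons c l ih =>
    have hc : xx * k c = xx := by rw [h c (by simp)]; rfl
    rw [evalList_cons, ← mul_assoc, ← WithOne.coe_mul, hc, ih fun d hd => h d (by simp [hd])]

variable {u v : List ℕ}
  (h : ∀ k : ℕ → CModel, evalList (fun c => (k c : WithOne CModel)) u =
    evalList (fun c => (k c : WithOne CModel)) v)
include h

theorem mem_of_mem {c : ℕ} (hc : c ∈ u) : c ∈ v := by
  by_contra hv
  have := congrArg (((xx : CModel) : WithOne CModel) * ·) (h fun d => if d = c then 0 else x)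
  rw [coe_mul_evalList_eq_zero hc (by simp), evalList_ne_zero fun d hd => if_neg ?_] at this
  · exact absurd (WithOne.coe_injective this) (by decide)
  · rintro rfl; exact hv hd

theorem first_of_first {s : ℕ} (hs : ∃ l, u = s :: l ∧ s ∉ l) : ∃ m, v = s :: m ∧ s ∉ m := by
  obtain ⟨l, rfl, hl⟩ := hs
  have := h fun d => if d = s then y else x
  rw [evalList_cons, if_pos rfl, y_mul_evalList fun d hd => Or.inl (if_neg ?_)] at this
  swap
  · rintro rfl; exact hl hd
  cases v with
  | nil => exact absurd this (by simp)
  | cons d m =>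
    rw [evalList_cons] at this
    by_cases hd : d = s
    · subst hd
      refine ⟨m, rfl, fun hm => ?_⟩
      rw [if_pos rfl, y_mul_evalList_eq_zero hm (by simp)] at this
      exact absurd (WithOne.coe_injective this) (by decide)
    · rw [if_neg hd] at this
      exact absurd this.symm (coe_mul_ne (by decide) (by decide) _)

theorem second_of_second {s t : ℕ} (hst : s ≠ t) (ht : ∃ l, u = s :: t :: l ∧ t ∉ l) :
    ∃ m, v = s :: t :: m ∧ t ∉ m := by
  obtain ⟨l, rfl, hl⟩ := ht
  have := h fun d => if d = t then y else if d = s then x else xx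
  have hmul : (x : WithOne CModel) * y = xy := rfl
  rw [evalList_cons, evalList_cons, if_pos rfl, if_neg hst, if_pos rfl,
    y_mul_evalList fun d hd => ?_, hmul] at this
  swap
  · rw [if_neg (by rintro rfl; exact hl hd)]
    split_ifs <;> simp
  cases v with
  | nil => exact absurd this (by simp)
  | cons d m =>
    rw [evalList_cons] at this
    by_cases hd : d = t
    · rw [if_pos hd] at this
      exact absurd this.symm (coe_mul_ne (by decide) (by decide) _)
    by_cases hd' : d = s
    swap
    · rw [if_neg hd, if_neg hd'] at this
      exact absurd this.symm (coe_mul_ne (by decide) (by decide) _)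
    subst hd'
    rw [if_neg hd, if_pos rfl] at this
    cases m with
    | nil => exact absurd this.symm (by simp)
    | cons e m =>
      rw [evalList_cons] at this
      by_cases he : e = t
      · subst he
        refine ⟨m, rfl, fun hm => ?_⟩
        rw [if_pos rfl, y_mul_evalList_eq_zero hm (by simp), ← WithOne.coe_mul, mul_zero] at this
        exact absurd (WithOne.coe_injective this) (by decide)
      · rw [if_neg he, ← mul_assoc, ← WithOne.coe_mul,
          show (x * if e = d then x else xx) = xx by split_ifs <;> rfl] at this
        exact absurd this.symm (coe_mul_ne (by decide) (by decide) _)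

end Identities

end CModel

/-- A finite basis of identities of `C_λ`. -/
def cIdentities : Set SemigroupIdentity :=
  let x := var 0
  let y := var 1
  let z := var 2
  let w := var 3
  {(x * y * z * w, x * y * w * z), (x * y * z * z, x * y * z), (x * x * x, x * x),
    (x * y * y * z, x * z * y * z), (x * y * (x * y) * z, z * z * (x * y))}

theorem CModel.satisfies_cIdentities {e : SemigroupIdentity} (he : e ∈ cIdentities) :
    SatisfiesIdentity CModel e := by
  obtain rfl | rfl | rfl | rfl | rfl := he <;> intro φ <;>
    simp only [map_mul] <;> generalize φ (var 0) = p
  rotate_left 2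
  · revert p; decide
  all_goals generalize φ (var 1) = q
  all_goals generalize φ (var 2) = r
  · revert p q r; decide +kernel
  · revert p q r; decide +kernel
  · generalize φ (var 3) = s
    revert p q r s; decide +kernel
  · revert p q r; decide +kernel

theorem CLaws.withOne {T : Type*} [Semigroup T]
    (hT : ∀ e ∈ cIdentities, SatisfiesIdentity T e) : CLaws (WithOne T) := by
  have hT' := fun (x y z w : T) => fun e he =>
    (satisfiesIdentity_iff_lift e).1 (hT e he) (assign [x, y, z, w] x)
  simp only [cIdentities, Set.mem_insert_iff, Set.mem_singleton_iff, forall_eq_or_imp,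
    forall_eq, map_mul, FreeSemigroup.lift_of, assign_zero, assign_one, assign_two,
    assign_three] at hT'
  have lift : ∀ {x : WithOne T}, x ≠ 1 → ∃ y : T, x = y := fun {x} hx =>
    ⟨_, (WithOne.coe_unone hx).symm⟩
  refine ⟨?_, ?_, ?_, ?_, ?_⟩
  · intro x y hx hy z w
    obtain ⟨x, rfl⟩ := lift hx
    obtain ⟨y, rfl⟩ := lift hy
    induction z using WithOne.recOneCoe with
    | one => simp
    | coe z =>
      induction w using WithOne.recOneCoe with
      | one => simp
      | coe w => exact_mod_cast (hT' x y z w).1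
  · intro x y hx hy z
    obtain ⟨x, rfl⟩ := lift hx
    obtain ⟨y, rfl⟩ := lift hy
    induction z using WithOne.recOneCoe with
    | one => simp
    | coe z => exact_mod_cast (hT' x y z z).2.1
  · intro x
    induction x using WithOne.recOneCoe with
    | one => simp
    | coe x => exact_mod_cast (hT' x x x x).2.2.1
  · intro x y z hx hy hz
    obtain ⟨x, rfl⟩ := lift hx
    obtain ⟨y, rfl⟩ := lift hy
    obtain ⟨z, rfl⟩ := lift hz
    exact_mod_cast (hT' x y z z).2.2.2.1
  · intro x y z hx hy hz
    obtain ⟨x, rfl⟩ := lift hx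
    obtain ⟨y, rfl⟩ := lift hy
    obtain ⟨z, rfl⟩ := lift hz
    exact_mod_cast (hT' x y z z).2.2.2.2

theorem hasFiniteBasis_Clam : HasFiniteBasis.{u} IndicatorBurnside.Clam := by
  refine HasFiniteBasis.of_presentation fun S _ g hg => ?_
  have hrel := hg.relation
  simp only [Set.mem_insert_iff, Set.mem_singleton_iff, forall_eq_or_imp, forall_eq, map_mul,
    liftZero_gen₀, liftZero_zero] at hrel
  obtain ⟨hx, hyx, hxy, hy⟩ := hrel
  obtain ⟨F, hF0, hF⟩ := hg.exists_hom CModel CModel.ofGen (by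
    simp only [Set.mem_insert_iff, Set.mem_singleton_iff, forall_eq_or_imp, forall_eq, map_mul,
      liftZero_gen₀, liftZero_zero]
    decide)
  refine ⟨cIdentities, by unfold cIdentities; exact Set.toFinite _, fun e he =>
    hg.satisfies F hF0 hF (CModel.normalForm g) rfl ?_ ?_ (CModel.satisfies_cIdentities he), ?_⟩
  · rintro (_ | _) <;> rfl
  · rintro (_ | _) (_ | _ | _ | _ | _)
    all_goals
      conv_lhs =>
        simp only [CModel.normalForm, ← mul_assoc, hyx, hxy, hy, ← hx, mul_zero]
      rfl
  · intro T _ hT e he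
    have hF' : Function.Surjective F := by
      intro m
      refine ⟨CModel.normalForm g m, ?_⟩
      rcases m with _ | _ | _ | _ | _ <;>
        simp only [CModel.normalForm, map_mul, hF] <;> first | exact hF0 | rfl
    have h := (satisfiesIdentity_iff_evalList e).1 (he.of_surjective F hF')
    have h' := fun k => (h k).symm
    rw [satisfiesIdentity_iff_evalList]
    intro f
    exact (CLaws.withOne hT).evalList_eq (fun c => WithOne.coe_ne_one)
      (fun c => ⟨CModel.mem_of_mem h, CModel.mem_of_mem h'⟩)
      (fun s => ⟨CModel.first_of_first h, CModel.first_of_first h'⟩)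
      (fun s t hst => ⟨CModel.second_of_second h hst, CModel.second_of_second h' hst⟩)

theorem hasFiniteBasis_Crho : HasFiniteBasis.{u} IndicatorBurnside.Crho := by
  refine hasFiniteBasis_Clam.presentedWithZero_op (fun S _ g hg => ?_) (fun S _ g hg => ?_)
  all_goals
    simp only [Set.mem_insert_iff, Set.mem_singleton_iff, forall_eq_or_imp, forall_eq, map_mul,
      liftZero_gen₀, liftZero_zero, ← MulOpposite.op_mul, MulOpposite.op_inj,
      MulOpposite.op_eq_zero_iff, ← mul_assoc] at hg ⊢
    exact hg

/-! ### Laws of the semigroups `K_n` -/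

/-- Laws, with an identity adjoined, that follow from a finite basis of identities of `K_n` and
are symmetric under reversal of the multiplication. -/
structure KLaws (n : ℕ) (N : Type*) [Monoid N] : Prop where
  mul_ne_one : ∀ {x y : N}, x ≠ 1 ∨ y ≠ 1 → x * y ≠ 1
  comm : ∀ {x t : N}, x ≠ 1 → t ≠ 1 → ∀ y z, x * y * z * t = x * z * y * t
  pow : ∀ {x z : N}, x ≠ 1 → z ≠ 1 → ∀ y, x * y ^ (n + 1) * z = x * y * z
  squares : ∀ {x : N}, x ≠ 1 → ∀ y z, x * (y * y) * (z * z) = x * (z * z) * (y * y)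
  squares' : ∀ {x : N}, x ≠ 1 → ∀ y z, (y * y) * (z * z) * x = (z * z) * (y * y) * x

namespace KLaws

variable {n : ℕ} {N : Type*} [Monoid N]

open MulOpposite in
protected theorem op (hN : KLaws n N) : KLaws n Nᵐᵒᵖ where
  mul_ne_one {x y} h := by
    have : y.unop * x.unop ≠ 1 := hN.mul_ne_one (by
      rw [Ne, unop_eq_one_iff, Ne, unop_eq_one_iff]; exact h.symm)
    intro h
    exact this (by rw [← unop_mul, h, unop_one])
  comm {x t} hx ht y z := by
    apply unop_injective
    have := hN.comm (x := t.unop) (t := x.unop) (by simpa using ht) (by simpa using hx) z.unop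
      y.unop
    simpa [mul_assoc] using this
  pow {x t} hx ht y := by
    apply unop_injective
    have := hN.pow (x := t.unop) (z := x.unop) (by simpa using ht) (by simpa using hx) y.unop
    simpa [mul_assoc] using this
  squares {x} hx y z := by
    apply unop_injective
    have := hN.squares' (x := x.unop) (by simpa using hx) z.unop y.unop
    simpa [mul_assoc] using this
  squares' {x} hx y z := by
    apply unop_injective
    have := hN.squares (x := x.unop) (by simpa using hx) z.unop y.unop
    simpa [mul_assoc] using this

variable {f : ℕ → N}

theorem mul_pow_mul_eq (hN : KLaws n N) {p q : N} (hp : p ≠ 1) (hq : q ≠ 1) (x : N) {i j : ℕ}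
    (hi : 0 < i) (hj : 0 < j) (hij : (i : ZMod n) = j) : p * x ^ i * q = p * x ^ j * q := by
  have h1 : ∀ i k, p * x ^ (i + 1 + n * k) * q = p * x ^ (i + 1) * q := by
    intro i k
    induction k with
    | zero => rfl
    | succ k ih =>
      rw [← ih, show i + 1 + n * (k + 1) = n + 1 + (i + n * k) by ring, pow_add,
        show i + 1 + n * k = 1 + (i + n * k) by ring, pow_add _ 1, pow_one, ← mul_assoc, ← mul_assoc,
        mul_assoc (p * _) _ q, mul_assoc (p * x) _ q, hN.pow hp (hN.mul_ne_one (Or.inr hq))]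
  wlog hle : i ≤ j generalizing i j
  · exact (this hj hi hij.symm (by omega)).symm
  rw [ZMod.natCast_eq_natCast_iff] at hij
  obtain ⟨k, hk⟩ := (Nat.modEq_iff_dvd' hle).1 hij
  obtain ⟨i, rfl⟩ := Nat.exists_eq_succ_of_ne_zero hi.ne'
  obtain rfl : j = i + 1 + n * k := by rw [← hk]; omega
  exact (h1 i k).symm

theorem mul_evalList_mul_perm (hN : KLaws n N) {p q : N} (hp : p ≠ 1) (hq : q ≠ 1)
    {l m : List ℕ} (h : l.Perm m) : p * evalList f l * q = p * evalList f m * q := by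
  induction h generalizing p with
  | nil => rfl
  | cons c _ ih =>
    rw [evalList_cons, ← mul_assoc, ih (hN.mul_ne_one (Or.inl hp)), evalList_cons, ← mul_assoc]
  | swap a b l =>
    simp only [evalList_cons, ← mul_assoc]
    rw [mul_assoc _ _ q, mul_assoc _ _ q, hN.comm hp (hN.mul_ne_one (Or.inr hq))]
  | trans _ _ h1 h2 => rw [h1 hp, h2 hp]

theorem evalList_replicate (c i : ℕ) : evalList f (List.replicate i c) = f c ^ i := by
  simp [evalList]

/-- Inside a word, only the content and the numbers of occurrences modulo `n` matter. -/
theorem mul_evalList_mul_eq (hN : KLaws n N) {p q : N} (hp : p ≠ 1) (hq : q ≠ 1) {l m : List ℕ}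
    (hmem : ∀ c, c ∈ l ↔ c ∈ m) (hcount : ∀ c, (l.count c : ZMod n) = m.count c) :
    p * evalList f l * q = p * evalList f m * q := by
  induction hk : l.length using Nat.strong_induction_on generalizing p l m with
  | _ k ih =>
    cases l with
    | nil =>
      obtain rfl : m = [] := List.eq_nil_iff_forall_not_mem.2 fun c hc => by
        simpa using (hmem c).2 hc
      rfl
    | cons c l =>
      have split : ∀ l : List ℕ,
          (List.replicate (l.count c) c ++ l.filter fun d => !(d == c)).Perm l := fun l => by
        rw [← List.filter_beq]
        exact List.filter_append_perm _ _
      have key : p * f c ^ (c :: l).count c * evalList f ((c :: l).filter fun d => !(d == c)) * q =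
          p * f c ^ (c :: l).count c * evalList f (m.filter fun d => !(d == c)) * q := by
        refine ih _ ?_ (hN.mul_ne_one (Or.inl hp)) ?_ ?_ rfl
        · have := List.length_filter_le (fun d => !(d == c)) l
          simp at hk ⊢
          omega
        · intro d
          have := hmem d
          grind
        · intro d
          by_cases hd : d = c
          · rw [List.count_eq_zero_of_not_mem (by simp [hd]),
              List.count_eq_zero_of_not_mem (by simp [hd])]
          · rw [List.count_filter (by simpa using hd), List.count_filter (by simpa using hd),
              hcount]
      rw [← hN.mul_evalList_mul_perm hp hq (split (c :: l)),
        ← hN.mul_evalList_mul_perm hp hq (split m), evalList_append, evalList_append,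
        evalList_replicate, evalList_replicate, ← mul_assoc, ← mul_assoc,
        key,
        mul_assoc _ _ q, mul_assoc _ _ q,
        hN.mul_pow_mul_eq hp (hN.mul_ne_one (Or.inr hq)) _ ?_ ?_ (hcount c)]
      · exact List.count_pos_iff.2 (by simp)
      · exact List.count_pos_iff.2 ((hmem c).1 (by simp))

/-- A repeated last letter can be changed. -/
theorem mul_evalList_eq_of_last (hn : 1 ≤ n) (hN : KLaws n N) (hf : ∀ c, f c ≠ 1) {p : N}
    (hp : p ≠ 1) {l m : List ℕ} {t t' : ℕ} (ht : t ∈ l) (ht' : t' ∈ m)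
    (hmem : ∀ c, c ∈ l ↔ c ∈ m)
    (hcount : ∀ c, ((l ++ [t]).count c : ZMod n) = (m ++ [t']).count c) :
    p * evalList f (l ++ [t]) = p * evalList f (m ++ [t']) := by
  have htl := (hmem t').2 ht'
  obtain ⟨n, rfl⟩ := Nat.exists_eq_succ_of_ne_zero (show n ≠ 0 by omega)
  -- the letters between `p` and the last letter may be assumed to end with `t' t' t`
  let k := l ++ List.replicate (n + n) t' ++ List.replicate n t
  have hn0 : ((n : ZMod (n + 1)) + 1) = 0 := by exact_mod_cast ZMod.natCast_self (n + 1)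
  have h1 : p * evalList f (l ++ [t]) = p * evalList f (k ++ [t', t', t] ++ [t]) := by
    simp only [evalList_append _ _ [t], evalList_cons, evalList_nil, mul_one, ← mul_assoc]
    refine hN.mul_evalList_mul_eq hp (hf t) (by simp [k]; grind) fun c => ?_
    simp only [k, List.count_append, List.count_replicate, List.count_cons, List.count_nil,
      beq_iff_eq]
    split_ifs <;> push_cast <;> grind
  have h2 : p * evalList f (m ++ [t']) = p * evalList f (k ++ [t, t, t'] ++ [t']) := by
    simp only [evalList_append _ _ [t'], evalList_cons, evalList_nil, mul_one, ← mul_assoc]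
    refine hN.mul_evalList_mul_eq hp (hf t') (by simp [k]; grind) fun c => ?_
    have := hcount c
    simp only [k, List.count_append, List.count_replicate, List.count_cons, List.count_nil,
      beq_iff_eq] at this ⊢
    split_ifs at this ⊢ <;> push_cast at this ⊢ <;> grind
  rw [h1, h2]
  have := hN.squares (x := p * evalList f k) (hN.mul_ne_one (Or.inl hp)) (f t') (f t)
  simpa [mul_assoc] using this

open MulOpposite in
theorem evalList_op (l : List ℕ) : evalList (fun c => op (f c)) l = op (evalList f l.reverse) := by
  induction l with
  | nil => rfl
  | cons c l ih => simp [ih]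

open MulOpposite in
/-- A repeated first letter can be changed. -/
theorem evalList_mul_eq_of_first (hn : 1 ≤ n) (hN : KLaws n N) (hf : ∀ c, f c ≠ 1) {p : N}
    (hp : p ≠ 1) {l m : List ℕ} {s s' : ℕ} (hs : s ∈ l) (hs' : s' ∈ m)
    (hmem : ∀ c, c ∈ l ↔ c ∈ m)
    (hcount : ∀ c, ((s :: l).count c : ZMod n) = (s' :: m).count c) :
    evalList f (s :: l) * p = evalList f (s' :: m) * p := by
  have := mul_evalList_eq_of_last hn hN.op (f := fun c => op (f c)) (p := op p)
    (l := l.reverse) (m := m.reverse) (t := s) (t' := s') (by simpa using hf) (by simpa using hp)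
    (by simpa using hs) (by simpa using hs') (by simpa using hmem) fun c => by
      have := hcount c
      simp only [List.count_append, List.count_reverse, List.count_cons, List.count_nil] at this ⊢
      simpa using this
  rw [evalList_op, evalList_op, ← op_mul, ← op_mul] at this
  simpa using op_injective this

theorem evalList_eq_of_first_last (hn : 1 ≤ n) (hN : KLaws n N) (hf : ∀ c, f c ≠ 1)
    {l m : List ℕ} {s s' t t' : ℕ} (hs : s ∈ l) (ht : t ∈ l) (hs' : s' ∈ m) (ht' : t' ∈ m)
    (hmem : ∀ c, c ∈ l ↔ c ∈ m)
    (hcount : ∀ c, ((s :: (l ++ [t])).count c : ZMod n) = (s' :: (m ++ [t'])).count c) :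
    evalList f (s :: (l ++ [t])) = evalList f (s' :: (m ++ [t'])) := by
  have htl := (hmem t').2 ht'
  obtain ⟨n, rfl⟩ := Nat.exists_eq_succ_of_ne_zero (show n ≠ 0 by omega)
  have hn0 : ((n : ZMod (n + 1)) + 1) = 0 := by exact_mod_cast ZMod.natCast_self (n + 1)
  let k := l ++ [t] ++ List.replicate n t'
  have h1 : evalList f (s :: (l ++ [t])) = evalList f (s :: (k ++ [t'])) := by
    rw [evalList_cons, evalList_cons]
    refine mul_evalList_eq_of_last hn hN hf (hf s) ht (by simp [k]; grind) (by simp [k]; grind)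
      fun c => ?_
    simp only [k, List.count_append, List.count_replicate, List.count_cons, List.count_nil,
      beq_iff_eq]
    split_ifs <;> push_cast <;> grind
  have h2 : evalList f (s :: k) * f t' = evalList f (s' :: m) * f t' := by
    refine evalList_mul_eq_of_first hn hN hf (hf t') (by grind) hs' (by grind) fun c => ?_
    have := hcount c
    simp only [k, List.count_append, List.count_replicate, List.count_cons, List.count_nil,
      beq_iff_eq] at this ⊢
    split_ifs at this ⊢ <;> push_cast at this ⊢ <;> grind
  rw [h1]
  simpa [mul_assoc] using h2

end KLaws

/-! ### Words in which the first and the last letter are repeated -/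

/-- The laws, with an identity adjoined, of a finite basis of identities of `K_n`. -/
structure KFullLaws (n : ℕ) (N : Type*) [Monoid N] : Prop extends KLaws n N where
  square : ∀ x : N, x * x = x ^ (n + 2)
  power : ∀ {d : ℕ}, 1 < d → d ∣ n → ∀ x y : N, x * y ^ d * x = x * x * y ^ d

theorem exists_mul_count_eq {d : ℕ} {l : List ℕ} (h : ∀ c, d ∣ l.count c) :
    ∃ m : List ℕ, ∀ c, l.count c = d * m.count c := by
  refine ⟨(Finsupp.toMultiset ((Multiset.toFinsupp (l : Multiset ℕ)).mapRange (· / d)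
    (Nat.zero_div d))).toList, fun c => ?_⟩
  rw [← Multiset.coe_count, ← Multiset.coe_count, Multiset.coe_toList, Finsupp.count_toMultiset]
  simp [Nat.mul_div_cancel' (h c)]

theorem count_flatten_replicate (d : ℕ) (l : List ℕ) (c : ℕ) :
    (List.replicate d l).flatten.count c = d * l.count c := by
  induction d with
  | zero => simp
  | succ d ih => rw [List.replicate_succ, List.flatten_cons, List.count_append, ih]; ring

theorem evalList_flatten_replicate {N : Type*} [Monoid N] (f : ℕ → N) (d : ℕ) (l : List ℕ) :
    evalList f (List.replicate d l).flatten = evalList f l ^ d := by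
  induction d with
  | zero => simp
  | succ d ih => rw [List.replicate_succ, List.flatten_cons, evalList_append, ih, pow_succ']

theorem sum_map_ite_eq_count {R : Type*} [AddCommMonoidWithOne R] (c : ℕ) (l : List ℕ) :
    (l.map fun d => if d = c then (1 : R) else 0).sum = l.count c := by
  induction l with
  | nil => simp
  | cons d l ih =>
    rw [List.map_cons, List.sum_cons, ih, List.count_cons]
    by_cases h : d = c <;> simp [h, add_comm]

/-- If no combination of the numbers of occurrences of the letters is `1` modulo `n`, then
these numbers and `n` have a common divisor. -/
theorem exists_dvd_of_sum_ne_one {n : ℕ} (hn : 1 ≤ n) {l : List ℕ}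
    (h : ∀ k : ℕ → ZMod n, (l.map k).sum ≠ 1) : ∃ d, 1 < d ∧ d ∣ n ∧ ∀ c, d ∣ l.count c := by
  let Φ : (ℕ → ZMod n) →+ ZMod n :=
    { toFun := fun k => (l.map k).sum
      map_zero' := by
        change (l.map fun _ => (0 : ZMod n)).sum = 0
        simp
      map_add' := fun j k => List.sum_map_add }
  let J : AddSubgroup ℤ := Φ.range.comap (Int.castAddHom (ZMod n))
  obtain ⟨a, ha⟩ := Int.subgroup_cyclic J
  have hmem : ∀ z, z ∈ J ↔ a ∣ z := fun z => by
    rw [ha, AddSubgroup.mem_closure_singleton]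
    exact ⟨fun ⟨k, hk⟩ => ⟨k, by rw [← hk, smul_eq_mul, mul_comm]⟩,
      fun ⟨k, hk⟩ => ⟨k, by rw [hk, smul_eq_mul, mul_comm]⟩⟩
  have han : a ∣ n := (hmem _).1 ⟨0, by
    change Φ 0 = ((n : ℤ) : ZMod n)
    simp⟩
  have hac : ∀ c, a ∣ l.count c := fun c => (hmem _).1 ⟨fun d => if d = c then 1 else 0, by
    change (l.map _).sum = ((l.count c : ℤ) : ZMod n)
    rw [sum_map_ite_eq_count, Int.cast_natCast]⟩
  refine ⟨a.natAbs, ?_, Int.natCast_dvd_natCast.1 (by simpa using han),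
    fun c => Int.natCast_dvd_natCast.1 (by simpa using hac c)⟩
  have h0 : a.natAbs ≠ 0 := by
    intro h0
    rw [Int.natAbs_eq_zero.1 h0, zero_dvd_iff] at han
    omega
  have h1 : a.natAbs ≠ 1 := fun h1 => by
    have : (1 : ℤ) ∈ J := (hmem 1).2 (Int.natAbs_dvd.1 (by simp [h1]))
    obtain ⟨k, hk⟩ := this
    refine h k (hk.trans ?_)
    change ((1 : ℤ) : ZMod n) = 1
    simp
  omega

namespace KFullLaws

variable {n : ℕ} {N : Type*} [Monoid N] {f : ℕ → N}

/-- The word `l` is special if it starts and ends with a letter that does not occur in its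
interior, and the interior can be evaluated to the generator of a cyclic group of order `n`. -/
def IsSpecial (n : ℕ) (l : List ℕ) : Prop :=
  ∃ s w, l = s :: (w ++ [s]) ∧ s ∉ w ∧ w ≠ [] ∧ ∃ k : ℕ → ZMod n, (w.map k).sum = 1

/-- The words that are not special and in which the first and the last letter are repeated
can be transformed so that these letters occur in the interior. -/
theorem exists_evalList_eq (hn : 1 ≤ n) (hN : KFullLaws n N) (hf : ∀ c, f c ≠ 1) {u : List ℕ}
    (hu : u ≠ []) (hfirst : ∀ s l, u = s :: l → s ∈ l) (hlast : ∀ t l, u = l ++ [t] → t ∈ l)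
    (hs : ¬ IsSpecial n u) : ∃ s t l, s ∈ l ∧ t ∈ l ∧ (∀ c, c ∈ u ↔ c ∈ l) ∧
      (∀ c, (u.count c : ZMod n) = (s :: (l ++ [t])).count c) ∧
      evalList f u = evalList f (s :: (l ++ [t])) := by
  cases u with
  | nil => exact absurd rfl hu
  | cons s l =>
    have hsl := hfirst s l rfl
    obtain rfl | ⟨l, t, rfl⟩ := l.eq_nil_or_concat'
    · simp at hsl
    have htl := hlast t (s :: l) rfl
    by_cases hsw : s ∈ l
    · refine ⟨s, t, l, hsw, ?_, ?_, fun c => rfl, rfl⟩ <;> grind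
    obtain rfl : s = t := by grind
    by_cases hl : l = []
    · subst hl
      refine ⟨s, s, List.replicate n s, ?_, ?_, ?_, ?_, ?_⟩
      · simp; omega
      · simp; omega
      · have : n ≠ 0 := by omega
        simp [this]
      · intro c
        simp only [List.nil_append, List.count_cons, List.count_nil, List.count_append,
          List.count_replicate, beq_iff_eq]
        split_ifs <;> simp [one_add_one_eq_two]
      · simp only [List.nil_append, evalList_cons, evalList_append, KLaws.evalList_replicate,
          evalList_nil, mul_one, hN.square, ← pow_succ, ← pow_succ']
    · obtain ⟨d, hd1, hdn, hdl⟩ := exists_dvd_of_sum_ne_one hn (l := l) fun k hk =>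
        hs ⟨s, l, rfl, hsw, hl, k, hk⟩
      obtain ⟨m, hm⟩ := exists_mul_count_eq hdl
      obtain ⟨d, rfl⟩ : ∃ e, d = e + 2 := ⟨d - 2, by omega⟩
      have hml : ∀ c, c ∈ m ↔ c ∈ l := fun c => by
        rw [← List.count_pos_iff, ← List.count_pos_iff, hm c]
        simp
      have hfl : ∀ (e : ℕ) c, c ∈ (List.replicate (e + 1) m).flatten ↔ c ∈ l := fun e c => by
        rw [← hml, List.mem_flatten]
        simp
      have h1 : evalList f (s :: (l ++ [s])) = evalList f (s :: s :: (List.replicate (d + 2) m).flatten) := by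
        have := hN.mul_evalList_mul_eq (f := f) (hf s) (hf s) (l := l)
          (m := (List.replicate (d + 2) m).flatten) (fun c => (hfl _ c).symm) fun c => by
            rw [hm, count_flatten_replicate]
        rw [evalList_flatten_replicate, hN.power (by omega) hdn] at this
        rw [evalList_cons, evalList_append, evalList_cons _ s [], evalList_cons, evalList_cons,
          evalList_flatten_replicate, ← mul_assoc, ← mul_assoc, this]
        simp [mul_assoc]
      obtain rfl | ⟨m, t, rfl⟩ := m.eq_nil_or_concat'
      · refine absurd (List.eq_nil_iff_forall_not_mem.2 fun c hc => ?_) hl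
        simpa using (hml c).2 hc
      have h2 : (List.replicate (d + 2) (m ++ [t])).flatten =
          (List.replicate (d + 1) (m ++ [t])).flatten ++ m ++ [t] := by
        rw [List.replicate_succ']
        simp
      have ht := (hml t).1 (by simp)
      have hml' : ∀ c ∈ m, c ∈ l := fun c hc => (hml c).1 (by simp [hc])
      refine ⟨s, t, s :: ((List.replicate (d + 1) (m ++ [t])).flatten ++ m), by simp, ?_, ?_, ?_, ?_⟩
      · rw [List.mem_cons, List.mem_append, hfl]
        exact Or.inr (Or.inl ht)
      · intro c
        simp only [List.mem_cons, List.mem_append, hfl]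
        have := hml' c
        grind
      · intro c
        rw [List.cons_append, ← h2]
        simp only [List.count_cons, List.count_nil, count_flatten_replicate, ← hm,
          List.count_append (l₁ := l)]
        push_cast
        ring
      · rw [h1, h2, List.cons_append]

/-- The identities of `K_n` follow from `KFullLaws`. The first letter is kept if it is not repeated,
and so is the last one; a special word keeps both; in all other words both can be changed. -/
theorem evalList_eq (hn : 1 ≤ n) (hN : KFullLaws n N) (hf : ∀ c, f c ≠ 1) {u v : List ℕ}
    (hmem : ∀ c, c ∈ u ↔ c ∈ v) (hcount : ∀ c, (u.count c : ZMod n) = v.count c)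
    (hfirst : ∀ s, (∃ l, u = s :: l ∧ s ∉ l) ↔ ∃ m, v = s :: m ∧ s ∉ m)
    (hlast : ∀ t, (∃ l, u = l ++ [t] ∧ t ∉ l) ↔ ∃ m, v = m ++ [t] ∧ t ∉ m)
    (hspec : ∀ s, (∃ w, u = s :: (w ++ [s]) ∧ s ∉ w ∧ w ≠ [] ∧
        ∃ k : ℕ → ZMod n, (w.map k).sum = 1) ↔
      ∃ w, v = s :: (w ++ [s]) ∧ s ∉ w ∧ w ≠ [] ∧ ∃ k : ℕ → ZMod n, (w.map k).sum = 1) :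
    evalList f u = evalList f v := by
  by_cases hu : u = []
  · subst hu
    rw [List.eq_nil_iff_forall_not_mem.2 fun c hc => List.not_mem_nil ((hmem c).2 hc)]
  have hv : v ≠ [] := by
    rintro rfl
    exact hu (List.eq_nil_iff_forall_not_mem.2 fun c hc => List.not_mem_nil ((hmem c).1 hc))
  by_cases hA : ∃ s l, u = s :: l ∧ s ∉ l
  · obtain ⟨s, l, rfl, hsl⟩ := hA
    obtain ⟨m, rfl, hsm⟩ := (hfirst s).1 ⟨l, rfl, hsl⟩
    have hlm : ∀ c, c ∈ l ↔ c ∈ m := by grind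
    have hclm : ∀ c, (l.count c : ZMod n) = m.count c := fun c => by
      simpa [List.count_cons] using hcount c
    obtain rfl | ⟨l, t, rfl⟩ := l.eq_nil_or_concat'
    · rw [List.eq_nil_iff_forall_not_mem.2 fun c hc => List.not_mem_nil ((hlm c).2 hc)]
    obtain rfl | ⟨m, t', rfl⟩ := m.eq_nil_or_concat'
    · simpa using hlm t
    rw [evalList_cons, evalList_cons]
    by_cases htl : t ∈ l
    · have htm : t' ∈ m := by
        by_contra htm
        obtain ⟨l', h, hl'⟩ := (hlast t').2 ⟨s :: m, rfl, by grind⟩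
        rw [← List.cons_append] at h
        obtain ⟨rfl, h⟩ := List.append_inj' h rfl
        grind
      refine hN.mul_evalList_eq_of_last hn hf (hf s) htl htm (fun c => ?_) hclm
      have := hlm c
      grind
    · obtain ⟨m', h, hm'⟩ := (hlast t).1 ⟨s :: l, rfl, by grind⟩
      rw [← List.cons_append] at h
      obtain ⟨rfl, h⟩ := List.append_inj' h rfl
      obtain rfl : t' = t := by simpa using h
      rw [evalList_append, evalList_append, ← mul_assoc, ← mul_assoc]
      refine hN.mul_evalList_mul_eq (hf s) (by simpa using hf t') (fun c => ?_) fun c => ?_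
      · have := hlm c
        grind
      · simpa using hclm c
  have hB' : ∀ s l, u = s :: l → s ∈ l := fun s l h => by
    by_contra hs; exact hA ⟨s, l, h, hs⟩
  have hB'' : ∀ s l, v = s :: l → s ∈ l := fun s l h => by
    by_contra hs
    obtain ⟨l, h⟩ := (hfirst s).2 ⟨l, h, hs⟩
    exact hA ⟨s, l, h⟩
  by_cases hB : ∃ t l, u = l ++ [t] ∧ t ∉ l
  · obtain ⟨t, l, rfl, htl⟩ := hB
    obtain ⟨m, rfl, htm⟩ := (hlast t).1 ⟨l, rfl, htl⟩
    cases l with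
    | nil => simpa using hB' t [] rfl
    | cons s l =>
      cases m with
      | nil => simpa using hB'' t [] rfl
      | cons s' m =>
        have h1 := hB' s _ rfl
        have h2 := hB'' s' _ rfl
        rw [evalList_append, evalList_append]
        refine hN.evalList_mul_eq_of_first hn hf (by simpa using hf t) ?_ ?_ ?_ fun c => ?_
        · grind
        · grind
        · intro c
          have := hmem c
          have := hmem s
          have := hmem s'
          grind
        · have := hcount c
          rw [List.count_append, List.count_append, Nat.cast_add, Nat.cast_add] at this
          exact add_right_cancel this
  have hC' : ∀ t l, u = l ++ [t] → t ∈ l := fun t l h => by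
    by_contra ht; exact hB ⟨t, l, h, ht⟩
  have hC'' : ∀ t l, v = l ++ [t] → t ∈ l := fun t l h => by
    by_contra ht
    obtain ⟨l, h⟩ := (hlast t).2 ⟨l, h, ht⟩
    exact hB ⟨t, l, h⟩
  by_cases hS : IsSpecial n u
  · obtain ⟨s, w, rfl, hw⟩ := hS
    obtain ⟨w', rfl, hw'⟩ := (hspec s).1 ⟨w, rfl, hw⟩
    rw [evalList_cons, evalList_cons, evalList_append, evalList_append, ← mul_assoc, ← mul_assoc]
    refine hN.mul_evalList_mul_eq (hf s) (by simpa using hf s) (fun c => ?_) fun c => ?_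
    · have := hmem c
      grind
    · simpa [List.count_cons] using hcount c
  have hS' : ¬ IsSpecial n v := fun ⟨s, h⟩ => hS ⟨s, (hspec s).2 h⟩
  obtain ⟨s, t, l, hs, ht, hl, hc, he⟩ := hN.exists_evalList_eq hn hf hu hB' hC' hS
  obtain ⟨s', t', m, hs', ht', hm, hc', he'⟩ := hN.exists_evalList_eq hn hf hv hB'' hC'' hS'
  rw [he, he']
  exact hN.evalList_eq_of_first_last hn hf hs ht hs' ht'
    (fun c => by rw [← hl, hmem, hm]) fun c => by rw [← hc, hcount, hc']

end KFullLaws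

/-! ### A model of `D` and of the main part of `K_n` -/

/-- The quotient of `K_n` that identifies `y` and `yⁿ⁺¹`; for `n = 1` it is `D`. The exponents of
`y` are taken modulo `n`: the nonzero elements are `x`, `Y r = yʳ`, `L r = xyʳ`, `R r = yʳx` and
`f = xyx`. -/
inductive KModel (n : ℕ) : Type
  | zero
  | x
  | Y (r : ZMod n)
  | L (r : ZMod n)
  | R (r : ZMod n)
  | f

namespace KModel

variable {n : ℕ}

/-- The multiplication of `KModel n`. -/
protected def mul : KModel n → KModel n → KModel n
  | x, Y r => L r
  | Y r, x => R r
  | Y r, Y s => Y (r + s)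
  | L r, Y s => L (r + s)
  | Y r, R s => R (r + s)
  | x, R r => if r = 1 then f else zero
  | L r, x => if r = 1 then f else zero
  | L r, R s => if r + s = 1 then f else zero
  | _, _ => zero

instance : SemigroupWithZero (KModel n) where
  mul := KModel.mul
  mul_assoc := by
    suffices h : ∀ a b c : KModel n, (a.mul b).mul c = a.mul (b.mul c) from h
    rintro (_ | _ | r | r | r | _) (_ | _ | s | s | s | _) (_ | _ | t | t | t | _) <;>
      simp only [KModel.mul, add_assoc] <;> split_ifs <;> rfl
  zero := zero
  zero_mul := by rintro (_ | _ | _ | _ | _ | _) <;> rfl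
  mul_zero := by rintro (_ | _ | _ | _ | _ | _) <;> rfl

theorem zero_def : (0 : KModel n) = zero := rfl

theorem Y_mul_Y (r s : ZMod n) : Y r * Y s = Y (r + s) := rfl

theorem L_mul_Y (r s : ZMod n) : L r * Y s = L (r + s) := rfl

theorem x_mul_Y (r : ZMod n) : x * Y r = L r := rfl

theorem L_mul_x (r : ZMod n) : L r * x = if r = 1 then f else 0 := rfl

/-- The reversal of words, as an anti-automorphism. -/
def rev : KModel n → KModel n
  | L r => R r
  | R r => L r
  | m => m

theorem rev_mul (a b : KModel n) : rev (a * b) = rev b * rev a := by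
  suffices h : (a.mul b).rev = b.rev.mul a.rev from h
  rcases a with _ | _ | r | r | r | _ <;> rcases b with _ | _ | s | s | s | _ <;>
    simp only [KModel.mul, rev, add_comm] <;> split_ifs <;> rfl

theorem rev_rev (a : KModel n) : rev (rev a) = a := by
  rcases a with _ | _ | r | r | r | _ <;> rfl

/-- The value of a reversed word. -/
theorem evalList_reverse (k : ℕ → KModel n) (l : List ℕ) :
    evalList (fun c => ((rev (k c) : KModel n) : WithOne (KModel n))) l.reverse =
      WithOne.recOneCoe (motive := fun _ => WithOne (KModel n)) 1 (fun a => (rev a : KModel n))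
        (evalList (fun c => (k c : WithOne (KModel n))) l) := by
  induction l with
  | nil => rfl
  | cons c l ih =>
    rw [List.reverse_cons, evalList_append, ih, evalList_cons, evalList_cons, evalList_nil, mul_one]
    generalize evalList (fun c => (k c : WithOne (KModel n))) l = z
    induction z using WithOne.recOneCoe with
    | one => simp
    | coe z =>
      rw [← WithOne.coe_mul, WithOne.recOneCoe_coe, WithOne.recOneCoe_coe, rev_mul,
        WithOne.coe_mul]

section Identities

variable {k : ℕ → KModel n} {j : ℕ → ZMod n}

theorem evalList_mul_Y {l : List ℕ} (h : ∀ c ∈ l, k c = Y (j c)) (r : ZMod n) :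
    evalList (fun c => (k c : WithOne (KModel n))) l * (Y r : KModel n) =
      (Y ((l.map j).sum + r) : KModel n) := by
  induction l with
  | nil => simp
  | cons c l ih =>
    rw [evalList_cons, mul_assoc, ih fun d hd => h d (by simp [hd]), h c (by simp),
      ← WithOne.coe_mul, Y_mul_Y, List.map_cons, List.sum_cons, add_assoc]

theorem L_mul_evalList {l : List ℕ} (h : ∀ c ∈ l, k c = Y (j c)) (r : ZMod n) :
    ((L r : KModel n) : WithOne (KModel n)) * evalList (fun c => (k c : WithOne (KModel n))) l =
      (L (r + (l.map j).sum) : KModel n) := by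
  induction l generalizing r with
  | nil => simp
  | cons c l ih =>
    rw [evalList_cons, ← mul_assoc, h c (by simp), ← WithOne.coe_mul, L_mul_Y,
      ih fun d hd => h d (by simp [hd]), List.map_cons, List.sum_cons, add_assoc]

theorem x_mul_mul_x (z : WithOne (KModel n)) :
    ((x : KModel n) : WithOne (KModel n)) * z * (x : KModel n) = (0 : KModel n) ∨
      ((x : KModel n) : WithOne (KModel n)) * z * (x : KModel n) = (f : KModel n) := by
  induction z using WithOne.recOneCoe with
  | one => exact Or.inl rfl
  | coe z =>
    rw [← WithOne.coe_mul, ← WithOne.coe_mul, WithOne.coe_inj, WithOne.coe_inj]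
    rcases z with _ | _ | r | r | r | _
    iterate 2 exact Or.inl rfl
    · rw [x_mul_Y, L_mul_x]
      split_ifs <;> simp
    · exact Or.inl rfl
    · change (if r = 1 then f else zero) * x = 0 ∨ (if r = 1 then f else zero) * x = f
      left; split_ifs <;> rfl
    · exact Or.inl rfl

/-- A word whose value is `f` after a letter with value `L r` ends with the letter `x`. -/
theorem exists_of_L_mul_evalList_eq_f {s : ℕ} (hs : k s = x) (h : ∀ c, c ≠ s → k c = Y (j c))
    {m : List ℕ} {r : ZMod n} (hm : ((L r : KModel n) : WithOne (KModel n)) *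
      evalList (fun c => (k c : WithOne (KModel n))) m = (f : KModel n)) :
    ∃ w, m = w ++ [s] ∧ s ∉ w ∧ r + (w.map j).sum = 1 := by
  induction m generalizing r with
  | nil => simp at hm
  | cons c m ih =>
    rw [evalList_cons, ← mul_assoc, ← WithOne.coe_mul] at hm
    by_cases hc : c = s
    · subst hc
      rw [hs, L_mul_x] at hm
      split_ifs at hm with hr
      · cases m with
        | nil => exact ⟨[], rfl, by simp, by simpa using hr⟩
        | cons d m =>
          have hf : (f : KModel n) * k d = 0 := by
            rcases k d with _ | _ | _ | _ | _ | _ <;> rfl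
          rw [evalList_cons, ← mul_assoc, ← WithOne.coe_mul, hf, coe_zero_mul_evalList,
            WithOne.coe_inj, zero_def] at hm
          simp at hm
      · rw [coe_zero_mul_evalList, WithOne.coe_inj, zero_def] at hm
        simp at hm
    · rw [h c hc, L_mul_Y] at hm
      obtain ⟨w, rfl, hw, hsum⟩ := ih hm
      exact ⟨c :: w, rfl, by simp [hw, Ne.symm hc], by
        rw [List.map_cons, List.sum_cons, ← add_assoc, hsum]⟩

variable {u v : List ℕ}
  (h : ∀ k : ℕ → KModel n, evalList (fun c => (k c : WithOne (KModel n))) u =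
    evalList (fun c => (k c : WithOne (KModel n))) v)
include h

theorem mem_of_mem {c : ℕ} (hc : c ∈ u) : c ∈ v := by
  by_contra hv
  have := congrArg (((L 0 : KModel n) : WithOne (KModel n)) * ·)
    (h fun d => if d = c then 0 else Y 0)
  rw [coe_mul_evalList_eq_zero hc (by simp), L_mul_evalList (j := fun _ => 0) fun d hd => if_neg ?_,
    WithOne.coe_inj, zero_def] at this
  · simp at this
  · rintro rfl; exact hv hd

theorem count_eq (c : ℕ) : (u.count c : ZMod n) = v.count c := by
  have := congrArg (((L 0 : KModel n) : WithOne (KModel n)) * ·)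
    (h fun d => Y (if d = c then 1 else 0))
  rw [L_mul_evalList (fun _ _ => rfl), L_mul_evalList (fun _ _ => rfl), WithOne.coe_inj,
    sum_map_ite_eq_count, sum_map_ite_eq_count] at this
  simpa using this

theorem first_of_first {s : ℕ} (hs : ∃ l, u = s :: l ∧ s ∉ l) : ∃ m, v = s :: m ∧ s ∉ m := by
  obtain ⟨l, rfl, hl⟩ := hs
  have := congrArg (· * ((Y 0 : KModel n) : WithOne (KModel n)))
    (h fun d => if d = s then x else Y 0)
  rw [evalList_cons, mul_assoc, evalList_mul_Y (j := fun _ => 0) (fun d hd => if_neg ?_),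
    if_pos rfl, ← WithOne.coe_mul, x_mul_Y] at this
  swap
  · rintro rfl; exact hl hd
  have hcoe : ∀ z : WithOne (KModel n), ∃ y : KModel n, z * (Y 0 : KModel n) = y := by
    intro z
    induction z using WithOne.recOneCoe with
    | one => exact ⟨Y 0, one_mul _⟩
    | coe z => exact ⟨z * Y 0, rfl⟩
  cases v with
  | nil => simp at this
  | cons d m =>
    rw [evalList_cons] at this
    by_cases hd : d = s
    swap
    · obtain ⟨y, hy⟩ := hcoe (evalList (fun c => ((if c = s then x else Y 0 : KModel n) :
        WithOne (KModel n))) m)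
      rw [mul_assoc, hy, if_neg hd, ← WithOne.coe_mul, WithOne.coe_inj] at this
      rcases y with _ | _ | _ | _ | _ | _ <;> exact absurd this (by rintro ⟨⟩)
    subst hd
    refine ⟨m, rfl, fun hm => ?_⟩
    obtain ⟨a, b, rfl⟩ := List.append_of_mem hm
    rw [evalList_append, evalList_cons, if_pos rfl, ← mul_assoc, ← mul_assoc, mul_assoc _ _
      ((Y 0 : KModel n) : WithOne (KModel n))] at this
    obtain ⟨y, hy⟩ := hcoe (evalList (fun c => ((if c = d then x else Y 0 : KModel n) :
        WithOne (KModel n))) b)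
    have hf : f * y = 0 := by rcases y with _ | _ | _ | _ | _ | _ <;> rfl
    obtain h1 | h1 := x_mul_mul_x (evalList (fun c => ((if c = d then x else Y 0 : KModel n) :
        WithOne (KModel n))) a)
    · rw [h1, hy, ← WithOne.coe_mul, zero_mul, WithOne.coe_inj, zero_def] at this
      simp at this
    · rw [h1, hy, ← WithOne.coe_mul, hf, WithOne.coe_inj, zero_def] at this
      simp at this

theorem last_of_last {t : ℕ} (ht : ∃ l, u = l ++ [t] ∧ t ∉ l) : ∃ m, v = m ++ [t] ∧ t ∉ m := by
  have h' : ∀ k : ℕ → KModel n, evalList (fun c => (k c : WithOne (KModel n))) u.reverse =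
      evalList (fun c => (k c : WithOne (KModel n))) v.reverse := fun k => by
    have := congrArg (WithOne.recOneCoe (motive := fun _ => WithOne (KModel n)) 1
      fun a => (rev a : KModel n)) (h fun c => rev (k c))
    rw [← evalList_reverse, ← evalList_reverse] at this
    simpa only [rev_rev] using this
  obtain ⟨l, rfl, hl⟩ := ht
  obtain ⟨m, hm, htm⟩ := first_of_first (s := t) h' ⟨l.reverse, by simp, by simpa using hl⟩
  exact ⟨m.reverse, by rw [← List.reverse_reverse v, hm]; simp, by simpa using htm⟩

theorem special_of_special {s : ℕ} (hs : ∃ w, u = s :: (w ++ [s]) ∧ s ∉ w ∧ w ≠ [] ∧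
    ∃ j : ℕ → ZMod n, (w.map j).sum = 1) :
    ∃ w, v = s :: (w ++ [s]) ∧ s ∉ w ∧ w ≠ [] ∧ ∃ j : ℕ → ZMod n, (w.map j).sum = 1 := by
  obtain ⟨w, rfl, hw, hnil, j, hj⟩ := hs
  obtain ⟨c, w, rfl⟩ := List.exists_cons_of_ne_nil hnil
  simp only [List.mem_cons, not_or] at hw
  have := h fun d => if d = s then x else Y (j d)
  rw [List.cons_append, evalList_cons, evalList_cons, evalList_append, if_pos rfl,
    if_neg (Ne.symm hw.1), ← mul_assoc, ← mul_assoc, ← WithOne.coe_mul, x_mul_Y,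
    L_mul_evalList (j := j) (fun d hd => if_neg ?_), evalList_cons, evalList_nil, mul_one,
    if_pos rfl, ← WithOne.coe_mul, L_mul_x, if_pos (by simpa using hj)] at this
  swap
  · rintro rfl; exact hw.2 hd
  cases v with
  | nil => simp at this
  | cons d m =>
    rw [evalList_cons] at this
    by_cases hd : d = s
    swap
    · generalize evalList (fun c => ((if c = s then x else Y (j c) : KModel n) :
        WithOne (KModel n))) m = z at this
      rw [if_neg hd] at this
      induction z using WithOne.recOneCoe with
      | one => simp at this
      | coe y =>
        rw [← WithOne.coe_mul, WithOne.coe_inj] at this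
        rcases y with _ | _ | _ | _ | _ | _ <;> exact absurd this (by rintro ⟨⟩)
    subst hd
    rw [if_pos rfl] at this
    cases m with
    | nil => simp at this
    | cons e m =>
      rw [evalList_cons, ← mul_assoc, ← WithOne.coe_mul] at this
      by_cases he : e = d
      · rw [if_pos he, show (x : KModel n) * x = 0 from rfl, coe_zero_mul_evalList,
          WithOne.coe_inj, zero_def] at this
        simp at this
      · rw [if_neg he, x_mul_Y] at this
        obtain ⟨w', rfl, hw', hsum⟩ := exists_of_L_mul_evalList_eq_f (s := d) (j := j)
          (if_pos rfl) (fun c hc => if_neg hc) this.symm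
        exact ⟨e :: w', rfl, by simp [hw', Ne.symm he], by simp, j, by simpa using hsum⟩

end Identities

end KModel

/-! ### The semigroups `K_n` and `D` -/

section PowSucc

variable {M : Type} [Semigroup M]

theorem powSucc_add (m : M) (i j : ℕ) : powSucc m i * powSucc m j = powSucc m (i + j + 1) := by
  induction j with
  | zero => rfl
  | succ j ih =>
    change powSucc m i * (powSucc m j * m) = powSucc m (i + j + 1) * m
    rw [← mul_assoc, ih]

theorem powSucc_powSucc (m : M) (i j : ℕ) :
    powSucc (powSucc m i) j = powSucc m (i + j * (i + 1)) := by
  induction j with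
  | zero => simp [powSucc]
  | succ j ih =>
    rw [powSucc, ih, powSucc_add]
    congr 1
    ring

theorem map_powSucc {M' : Type} [Semigroup M'] (F : M →ₙ* M') (m : M) (k : ℕ) :
    F (powSucc m k) = powSucc (F m) k := by
  induction k with
  | zero => rfl
  | succ k ih => rw [powSucc, map_mul, ih, powSucc]

end PowSucc

theorem powSucc_eq_zero {M : Type} [SemigroupWithZero M] {m : M} (h : m * m = 0) {k : ℕ}
    (hk : 1 ≤ k) : powSucc m k = 0 := by
  obtain ⟨k, rfl⟩ := Nat.exists_eq_add_of_le hk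
  induction k with
  | zero => exact h
  | succ k ih => rw [← add_assoc, powSucc, ih (by omega), zero_mul]

/-- The relations of `K_n` for a pair of generators of a semigroup. -/
structure KRelations (n : ℕ) {S : Type} [SemigroupWithZero S] (x y : S) : Prop where
  xx : x * x = 0
  yy : y * y = powSucc y (n + 1)
  yxy : y * x * y = 0
  xyx : x * y * x = x * powSucc y n * x
  xpx : ∀ k, 1 ≤ k → k < n → x * powSucc y k * x = 0
  induction : ∀ P : S → Prop, P 0 → P x → P y → (∀ s, P s → P (x * s)) → (∀ s, P s → P (y * s)) →
    ∀ s, P s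

namespace KRelations

variable {n : ℕ} {S : Type} [SemigroupWithZero S] {x y : S}

theorem powSucc_add_mul (h : KRelations n x y) {j : ℕ} (hj : 1 ≤ j) (k : ℕ) :
    powSucc y (j + n * k) = powSucc y j := by
  have h1 : ∀ i, powSucc y (i + 1 + n) = powSucc y (i + 1) := by
    intro i
    cases i with
    | zero => rw [show 0 + 1 + n = n + 1 by ring, ← h.yy]; rfl
    | succ i =>
      rw [show i + 1 + 1 + n = i + (n + 1) + 1 by ring, ← powSucc_add, ← h.yy]
      exact powSucc_add y i 1
  obtain ⟨j, rfl⟩ := Nat.exists_eq_add_of_le' hj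
  induction k with
  | zero => rfl
  | succ k ih => rw [← ih, show j + 1 + n * (k + 1) = j + n * k + 1 + n by ring, h1]; congr 1; ring

theorem eq_mul (h : KRelations n x y) (s : S) :
    s = 0 ∨ (s = x ∨ s = y) ∨ ∃ t, s = x * t ∨ s = y * t := by
  refine h.induction (fun s => s = 0 ∨ (s = x ∨ s = y) ∨ ∃ t, s = x * t ∨ s = y * t) (by simp)
    (by simp) (by simp) ?_ ?_ s
  · exact fun s _ => Or.inr (Or.inr ⟨s, Or.inl rfl⟩)
  · exact fun s _ => Or.inr (Or.inr ⟨s, Or.inr rfl⟩)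

theorem eq_mul' (h : KRelations n x y) (s : S) :
    s = 0 ∨ (s = x ∨ s = y) ∨ ∃ t, s = t * x ∨ s = t * y := by
  refine h.induction (fun s => s = 0 ∨ (s = x ∨ s = y) ∨ ∃ t, s = t * x ∨ s = t * y) (by simp)
    (by simp) (by simp) ?_ ?_ s
  · rintro s (rfl | (hs | hs) | ⟨t, rfl | rfl⟩)
    · simp
    · exact Or.inr (Or.inr ⟨x, Or.inl (by rw [hs])⟩)
    · exact Or.inr (Or.inr ⟨x, Or.inr (by rw [hs])⟩)
    · exact Or.inr (Or.inr ⟨x * t, Or.inl (mul_assoc _ _ _).symm⟩)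
    · exact Or.inr (Or.inr ⟨x * t, Or.inr (mul_assoc _ _ _).symm⟩)
  · rintro s (rfl | (hs | hs) | ⟨t, rfl | rfl⟩)
    · simp
    · exact Or.inr (Or.inr ⟨y, Or.inl (by rw [hs])⟩)
    · exact Or.inr (Or.inr ⟨y, Or.inr (by rw [hs])⟩)
    · exact Or.inr (Or.inr ⟨y * t, Or.inl (mul_assoc _ _ _).symm⟩)
    · exact Or.inr (Or.inr ⟨y * t, Or.inr (mul_assoc _ _ _).symm⟩)

theorem mul_x_mul (h : KRelations n x y) (a c : S) : a * x * c = 0 := by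
  have hx : ∀ c, x * (x * c) = 0 := fun c => by rw [← mul_assoc, h.xx, zero_mul]
  have hxc : ∀ c, x * c = 0 ∨ ∃ d, x * c = x * y ∨ x * c = x * (y * d) := by
    intro c
    obtain rfl | (rfl | hc) | ⟨t, rfl | rfl⟩ := h.eq_mul c
    · simp
    · exact Or.inl h.xx
    · exact Or.inr ⟨y, Or.inl (by rw [hc])⟩
    · exact Or.inl (hx t)
    · exact Or.inr ⟨t, Or.inr rfl⟩
  have hy : y * (x * c) = 0 := by
    obtain hc | ⟨d, hc | hc⟩ := hxc c <;> rw [hc]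
    · exact mul_zero y
    · rw [← mul_assoc, h.yxy]
    · rw [← mul_assoc, ← mul_assoc, h.yxy, zero_mul]
  rw [mul_assoc]
  obtain rfl | (ha | ha) | ⟨t, rfl | rfl⟩ := h.eq_mul' a
  · exact zero_mul _
  · rw [ha]; exact hx c
  · rw [ha]; exact hy
  · rw [mul_assoc, hx, mul_zero]
  · rw [mul_assoc, hy, mul_zero]

theorem x_mul_powSucc_mul_x (h : KRelations n x y) (hn : 1 ≤ n) (k : ℕ) :
    x * powSucc y k * x = if n ∣ k then x * y * x else 0 := by
  have hk := Nat.mod_add_div k n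
  have hlt := Nat.mod_lt k (show n > 0 by omega)
  obtain h0 | h0 := Nat.eq_zero_or_pos (k % n)
  · rw [if_pos (Nat.dvd_of_mod_eq_zero h0)]
    rw [h0, zero_add] at hk
    obtain h1 | h1 := Nat.eq_zero_or_pos (k / n)
    · rw [h1] at hk
      rw [← hk]; rfl
    · obtain ⟨d, hd⟩ := Nat.exists_eq_add_of_le' h1
      rw [h.xyx, ← hk, hd, show n * (d + 1) = n + n * d by ring, h.powSucc_add_mul hn]
  · rw [if_neg fun hd => h0.ne' (Nat.mod_eq_zero_of_dvd hd), ← hk, h.powSucc_add_mul h0,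
      h.xpx _ h0 hlt]

theorem mul_powSucc_mul (h : KRelations n x y) (a c : S) : a * powSucc y n * c = a * y * c := by
  have hyn : y * powSucc y n = y * y := by
    rw [h.yy]
    exact (powSucc_add y 0 n).trans (by rw [zero_add])
  have hny : powSucc y n * y = y * y := h.yy.symm
  have hxx := h.xyx.symm
  have hny' : ∀ t, powSucc y n * (y * t) = y * (y * t) := fun t => by
    rw [← mul_assoc, hny, mul_assoc]
  have hxx' : ∀ t, x * (powSucc y n * (x * t)) = x * (y * (x * t)) := fun t => by
    rw [← mul_assoc, ← mul_assoc, hxx, mul_assoc, mul_assoc]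
  rw [mul_assoc, mul_assoc] at hxx
  obtain rfl | (hc | hc) | ⟨t, hc | hc⟩ := h.eq_mul c
  · rw [mul_zero, mul_zero]
  all_goals
    rw [hc]
    obtain rfl | (ha | ha) | ⟨t', ha | ha⟩ := h.eq_mul' a
    · simp only [zero_mul]
    all_goals
      rw [ha]
      simp only [mul_assoc, hyn, hny, hxx, hny', hxx']

/-- Each element is a power of `y`, or generates a nilpotent ideal. -/
theorem powSucc_or (h : KRelations n x y) (hn : 1 ≤ n) (s : S) : (∃ j, s = powSucc y j) ∨
    (∀ a c, a * s * c = 0) ∧ s * s = 0 ∧ ∀ j, ¬ n ∣ j → s * powSucc y j * s = 0 := by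
  have hx := h.mul_x_mul
  have key : ∀ s, (∃ j, s = powSucc y j) ∨ s = 0 ∨ s = x ∨ (∃ j, s = x * powSucc y j) ∨
      (∃ j, s = powSucc y j * x) ∨ s = x * y * x := by
    refine h.induction _ (by simp) (by simp) (Or.inl ⟨0, rfl⟩) ?_ ?_
    · rintro s (⟨j, rfl⟩ | rfl | rfl | ⟨j, rfl⟩ | ⟨j, rfl⟩ | rfl)
      · exact Or.inr (Or.inr (Or.inr (Or.inl ⟨j, rfl⟩)))
      · simp
      · exact Or.inr (Or.inl h.xx)
      · exact Or.inr (Or.inl (by rw [← mul_assoc, h.xx, zero_mul]))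
      · rw [← mul_assoc, h.x_mul_powSucc_mul_x hn]
        split_ifs <;> simp
      · exact Or.inr (Or.inl (by rw [← mul_assoc, ← mul_assoc, h.xx, zero_mul, zero_mul]))
    · rintro s (⟨j, rfl⟩ | rfl | rfl | ⟨j, rfl⟩ | ⟨j, rfl⟩ | rfl)
      · exact Or.inl ⟨0 + j + 1, powSucc_add y 0 j⟩
      · simp
      · exact Or.inr (Or.inr (Or.inr (Or.inr (Or.inl ⟨0, rfl⟩))))
      · exact Or.inr (Or.inl (by rw [← mul_assoc, hx]))
      · refine Or.inr (Or.inr (Or.inr (Or.inr (Or.inl ⟨0 + j + 1, ?_⟩))))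
        rw [← mul_assoc]
        exact congrArg (· * x) (powSucc_add y 0 j)
      · exact Or.inr (Or.inl (by rw [← mul_assoc, ← mul_assoc, h.yxy, zero_mul]))
  obtain ⟨j, rfl⟩ | rfl | rfl | ⟨j, rfl⟩ | ⟨j, rfl⟩ | rfl := key s
  · exact Or.inl ⟨j, rfl⟩
  · exact Or.inr ⟨by simp, by simp, by simp⟩
  · exact Or.inr ⟨hx, h.xx, fun j hj => by rw [h.x_mul_powSucc_mul_x hn, if_neg hj]⟩
  · have h1 : ∀ a c, a * (x * powSucc y j) * c = 0 := fun a c => by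
      rw [← mul_assoc a x, mul_assoc, hx]
    exact Or.inr ⟨h1, by rw [← mul_assoc, hx],
      fun i _ => by rw [← mul_assoc, hx]⟩
  · have h1 : ∀ a c, a * (powSucc y j * x) * c = 0 := fun a c => by
      rw [← mul_assoc, hx]
    exact Or.inr ⟨h1, by rw [← mul_assoc, hx, zero_mul], fun i _ => by rw [hx, zero_mul]⟩
  · have h1 : ∀ a c, a * (x * y * x) * c = 0 := fun a c => by
      rw [← mul_assoc, hx]
    exact Or.inr ⟨h1, by rw [← mul_assoc, hx, zero_mul], fun i _ => by rw [hx, zero_mul]⟩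

end KRelations

/-- A finite basis of identities of `K_n`. -/
def kIdentities (n : ℕ) : Set SemigroupIdentity :=
  let x := var 0
  let y := var 1
  let z := var 2
  let t := var 3
  {(x * y * z * t, x * z * y * t), (x * powSucc y n * z, x * y * z), (x * x, powSucc x (n + 1)),
    (x * (y * y) * (z * z), x * (z * z) * (y * y)),
    (y * y * (z * z) * x, z * z * (y * y) * x)} ∪
  (fun e => (x * powSucc y e * x, x * x * powSucc y e)) '' {e | 1 ≤ e ∧ e + 1 ∣ n}

theorem finite_kIdentities {n : ℕ} (hn : 1 ≤ n) : (kIdentities n).Finite := by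
  refine Set.Finite.union (Set.toFinite _) (Set.Finite.image _ ?_)
  exact (Set.finite_lt_nat n).subset fun e he => Nat.le_of_dvd hn he.2

theorem KRelations.satisfies {n : ℕ} {S : Type} [SemigroupWithZero S] {x y : S}
    (h : KRelations n x y) (hn : 1 ≤ n) {e : SemigroupIdentity} (he : e ∈ kIdentities n) :
    SatisfiesIdentity S e := by
  have hd := h.powSucc_or hn
  have hcomm : ∀ i j, powSucc y i * powSucc y j = powSucc y j * powSucc y i := fun i j => by
    rw [powSucc_add, powSucc_add, add_comm i j]
  obtain (rfl | rfl | rfl | rfl | rfl) | ⟨e, ⟨he1, hen⟩, rfl⟩ := he <;> intro φ <;>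
    simp only [map_mul, map_powSucc] <;> generalize φ (var 0) = a
  all_goals try generalize φ (var 1) = b
  all_goals try generalize φ (var 2) = c
  all_goals try generalize φ (var 3) = d
  · obtain ⟨i, rfl⟩ | ⟨hb, -⟩ := hd b
    · obtain ⟨j, rfl⟩ | ⟨hc, -⟩ := hd c
      · rw [mul_assoc a (powSucc y i), hcomm, ← mul_assoc]
      · rw [hc, hc, zero_mul]
    · rw [hb, hb, zero_mul]
  · obtain ⟨i, rfl⟩ | ⟨hb, hb2, -⟩ := hd b
    · rw [powSucc_powSucc]
      obtain hi | hi := Nat.eq_zero_or_pos i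
      · subst hi
        rw [zero_add, zero_add, mul_one]
        exact h.mul_powSucc_mul a c
      · rw [h.powSucc_add_mul hi]
    · rw [powSucc_eq_zero hb2 hn, hb, mul_zero, zero_mul]
  · obtain ⟨i, rfl⟩ | ⟨hb, hb2, -⟩ := hd a
    · rw [powSucc_powSucc, powSucc_add, show i + (n + 1) * (i + 1) = i + i + 1 + n * (i + 1) by ring,
        h.powSucc_add_mul (by omega)]
    · rw [powSucc_eq_zero hb2 (by omega), hb2]
  · obtain ⟨i, rfl⟩ | ⟨-, hb, -⟩ := hd b
    · obtain ⟨j, rfl⟩ | ⟨-, hc, -⟩ := hd c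
      · rw [powSucc_add, powSucc_add, mul_assoc a, mul_assoc a, hcomm]
      · rw [hc, mul_zero, mul_zero, zero_mul]
    · rw [hb, mul_zero, mul_zero, zero_mul]
  · obtain ⟨i, rfl⟩ | ⟨-, hb, -⟩ := hd b
    · obtain ⟨j, rfl⟩ | ⟨-, hc, -⟩ := hd c
      · rw [powSucc_add, powSucc_add, hcomm]
      · rw [hc, zero_mul, mul_zero]
    · rw [hb, zero_mul, mul_zero]
  · obtain ⟨j, rfl⟩ | ⟨-, hb, -⟩ := hd b
    · rw [powSucc_powSucc]
      obtain ⟨i, rfl⟩ | ⟨-, ha, ha'⟩ := hd a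
      · rw [mul_assoc, hcomm _ i, ← mul_assoc]
      · rw [ha, zero_mul]
        refine ha' _ fun hdiv => ?_
        -- `e + 1` would divide the consecutive exponents `(j + 1) * (e + 1) - 1` and
        -- `(j + 1) * (e + 1)`
        have h1 := hen.trans hdiv
        have h2 : e + 1 ∣ j + e * (j + 1) + 1 := ⟨j + 1, by ring⟩
        have := (Nat.dvd_add_right h1).1 h2
        have := Nat.le_of_dvd one_pos this
        omega
    · rw [powSucc_eq_zero hb he1, mul_zero, zero_mul, mul_zero]

theorem coe_powSucc {T : Type*} [Semigroup T] (F : FreeSemigroup ℕ →ₙ* T) (m : FreeSemigroup ℕ)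
    (k : ℕ) : ((F (powSucc m k) : T) : WithOne T) = (F m : WithOne T) ^ (k + 1) := by
  induction k with
  | zero => simp [powSucc]
  | succ k ih => rw [powSucc, map_mul, WithOne.coe_mul, ih, ← pow_succ]

theorem KFullLaws.withOne {n : ℕ} {T : Type*} [Semigroup T]
    (hT : ∀ e ∈ kIdentities n, SatisfiesIdentity T e) : KFullLaws n (WithOne T) := by
  have hT' := fun (x y z t : T) => fun e he => congrArg (fun s : T => (s : WithOne T)) <|
    (satisfiesIdentity_iff_lift e).1 (hT e he) (assign [x, y, z, t] x)
  simp only [kIdentities, Set.mem_union, or_imp, forall_and, Set.mem_insert_iff,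
    Set.mem_singleton_iff, Set.forall_mem_image, Set.mem_ofPred_eq, and_imp,
    forall_eq, map_mul, WithOne.coe_mul, coe_powSucc, FreeSemigroup.lift_of, assign_zero,
    assign_one, assign_two, assign_three] at hT'
  obtain ⟨⟨h1, h2, h3, h4, h5⟩, h6⟩ := hT'
  have lift : ∀ {x : WithOne T}, x ≠ 1 → ∃ y : T, x = y := fun {x} hx =>
    ⟨_, (WithOne.coe_unone hx).symm⟩
  have lift' : ∀ x : WithOne T, x = 1 ∨ ∃ y : T, x = y := fun x => by
    by_cases hx : x = 1
    exacts [Or.inl hx, Or.inr (lift hx)]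
  refine ⟨⟨?_, ?_, ?_, ?_, ?_⟩, ?_, ?_⟩
  · intro x y h
    obtain rfl | ⟨x, rfl⟩ := lift' x
    · simpa using h
    · obtain rfl | ⟨y, rfl⟩ := lift' y
      · simp
      · exact WithOne.coe_ne_one
  · intro x t hx ht y z
    obtain ⟨x, rfl⟩ := lift hx
    obtain ⟨t, rfl⟩ := lift ht
    obtain rfl | ⟨y, rfl⟩ := lift' y
    · simp
    · obtain rfl | ⟨z, rfl⟩ := lift' z
      · simp
      · exact h1 x y z t
  · intro x z hx hz y
    obtain ⟨x, rfl⟩ := lift hx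
    obtain ⟨z, rfl⟩ := lift hz
    obtain rfl | ⟨y, rfl⟩ := lift' y
    · simp
    · exact h2 x y z x
  · intro x hx y z
    obtain ⟨x, rfl⟩ := lift hx
    obtain rfl | ⟨y, rfl⟩ := lift' y
    · simp
    · obtain rfl | ⟨z, rfl⟩ := lift' z
      · simp
      · exact h4 x y z x
  · intro x hx y z
    obtain ⟨x, rfl⟩ := lift hx
    obtain rfl | ⟨y, rfl⟩ := lift' y
    · simp
    · obtain rfl | ⟨z, rfl⟩ := lift' z
      · simp
      · exact h5 x y z x
  · intro x
    obtain rfl | ⟨x, rfl⟩ := lift' x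
    · simp
    · exact h3 x x x x
  · intro d hd hdn x y
    obtain ⟨e, rfl⟩ := Nat.exists_eq_add_of_le' hd.le
    obtain rfl | ⟨x, rfl⟩ := lift' x
    · simp
    · obtain rfl | ⟨y, rfl⟩ := lift' y
      · simp
      · exact h6 x y x x (by omega) hdn

theorem KModel.powSucc_Y {n : ℕ} (k : ℕ) : powSucc (Y 1 : KModel n) k = Y (k + 1 : ℕ) := by
  induction k with
  | zero => simp [powSucc]
  | succ k ih => rw [powSucc, ih, Y_mul_Y]; push_cast; rfl

/-- A semigroup generated by a pair that satisfies the relations of `K_n`, and that maps onto the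
model, has a finite basis of identities. -/
theorem hasFiniteBasis_of_kRelations {n : ℕ} (hn : 1 ≤ n) {S : Type} [SemigroupWithZero S]
    {x y : S} (h : KRelations n x y) (F : S →ₙ* KModel n) (hF0 : F 0 = 0) (hx : F x = .x)
    (hy : F y = .Y 1) : HasFiniteBasis.{u} S := by
  refine ⟨kIdentities n, finite_kIdentities hn, fun e he => h.satisfies hn he, ?_⟩
  intro T _ hT e he
  have hsurjY : ∀ r : ZMod n, ∃ s, F s = .Y r := by
    have : NeZero n := ⟨by omega⟩
    intro r
    refine ⟨powSucc y (r - 1).val, ?_⟩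
    rw [map_powSucc, hy, KModel.powSucc_Y]
    simp
  have hF : Function.Surjective F := by
    rintro (_ | _ | r | r | r | _)
    · exact ⟨0, hF0⟩
    · exact ⟨x, hx⟩
    · exact hsurjY r
    · obtain ⟨s, hs⟩ := hsurjY r
      exact ⟨x * s, by rw [map_mul, hs, hx]; rfl⟩
    · obtain ⟨s, hs⟩ := hsurjY r
      exact ⟨s * x, by rw [map_mul, hs, hx]; rfl⟩
    · obtain ⟨s, hs⟩ := hsurjY 1
      refine ⟨x * s * x, ?_⟩
      rw [map_mul, map_mul, hs, hx, KModel.x_mul_Y, KModel.L_mul_x, if_pos rfl]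
  have h1 := (satisfiesIdentity_iff_evalList e).1 (he.of_surjective F hF)
  have h2 := fun k => (h1 k).symm
  rw [satisfiesIdentity_iff_evalList]
  intro f
  exact (KFullLaws.withOne hT).evalList_eq hn (fun c => WithOne.coe_ne_one)
    (fun c => ⟨KModel.mem_of_mem h1, KModel.mem_of_mem h2⟩) (KModel.count_eq h1)
    (fun s => ⟨KModel.first_of_first h1, KModel.first_of_first h2⟩)
    (fun s => ⟨KModel.last_of_last h1, KModel.last_of_last h2⟩)
    (fun s => ⟨KModel.special_of_special h1, KModel.special_of_special h2⟩)

/-- The generators of `K_n` in the model. -/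
def KModel.ofGen (n : ℕ) : IndicatorBurnside.Gen2 → KModel n
  | .x => .x
  | .y => .Y 1

theorem hasFiniteBasis_D : HasFiniteBasis.{u} IndicatorBurnside.D := by
  refine HasFiniteBasis.of_presentation fun S _ g hg => ?_
  have hrel := hg.relation
  simp only [Set.mem_insert_iff, Set.mem_singleton_iff, forall_eq_or_imp, forall_eq, map_mul,
    liftZero_gen₀, liftZero_zero] at hrel
  obtain ⟨hx, hy, hyx⟩ := hrel
  obtain ⟨F, hF0, hF⟩ := hg.exists_hom (KModel 1) (KModel.ofGen 1) (by
    simp only [Set.mem_insert_iff, Set.mem_singleton_iff, forall_eq_or_imp, forall_eq, map_mul,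
      liftZero_gen₀, liftZero_zero]
    exact ⟨rfl, rfl, rfl⟩)
  refine hasFiniteBasis_of_kRelations le_rfl (x := g .x) (y := g .y) ⟨hx, ?_, hyx, ?_, ?_, ?_⟩ F hF0
    (hF _) (hF _)
  · simp only [powSucc, ← hy]
  · simp only [powSucc, ← hy]
  · omega
  · intro P h0 hPx hPy hx hy
    refine hg.induction P h0 ?_ ?_
    · rintro (_ | _); exacts [hPx, hPy]
    · rintro (_ | _) s hs; exacts [hx s hs, hy s hs]

theorem hasFiniteBasis_K {n : ℕ} (hn : 1 ≤ n) : HasFiniteBasis.{u} (IndicatorBurnside.K n) := by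
  refine HasFiniteBasis.of_presentation fun S _ g hg => ?_
  have hrel := hg.relation
  simp only [Set.mem_union, or_imp, forall_and, Set.mem_insert_iff, Set.mem_singleton_iff,
    forall_eq, map_mul, liftZero_gen₀, liftZero_zero, map_powSucc,
    Set.mem_ofPred_eq, forall_exists_index, and_imp] at hrel
  obtain ⟨⟨hx, hy, hyx, hxyx⟩, hpow⟩ := hrel
  obtain ⟨F, hF0, hF⟩ := hg.exists_hom (KModel n) (KModel.ofGen n) (by
    simp only [Set.mem_union, or_imp, forall_and, Set.mem_insert_iff, Set.mem_singleton_iff,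
      forall_eq, map_mul, liftZero_gen₀, liftZero_zero, map_powSucc,
      Set.mem_ofPred_eq, forall_exists_index, and_imp, KModel.ofGen, KModel.powSucc_Y,
      KModel.Y_mul_Y, KModel.x_mul_Y, KModel.L_mul_x]
    refine ⟨⟨rfl, ?_, rfl, ?_⟩, ?_⟩
    · simp [one_add_one_eq_two]
    · simp
    · rintro _ k h1 h2 rfl
      simp only [map_mul, liftZero_gen₀, liftZero_zero, map_powSucc, KModel.ofGen,
        KModel.powSucc_Y, KModel.x_mul_Y, KModel.L_mul_x]
      refine if_neg fun h => ?_
      have h : ((k : ℕ) : ZMod n) = 0 := by simpa using h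
      rw [ZMod.natCast_eq_zero_iff] at h
      have := Nat.le_of_dvd (by omega) h
      omega)
  refine hasFiniteBasis_of_kRelations hn (x := g .x) (y := g .y) ⟨hx, hy, hyx, hxyx, ?_, ?_⟩ F hF0
    (hF _) (hF _)
  · intro k h1 h2
    have := hpow _ k (by omega) (by omega) rfl
    simpa only [map_mul, liftZero_gen₀, liftZero_zero, map_powSucc] using this
  · intro P h0 hPx hPy hx hy
    refine hg.induction P h0 ?_ ?_
    · rintro (_ | _); exacts [hPx, hPy]
    · rintro (_ | _) s hs; exacts [hx s hs, hy s hs]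

theorem theorem2 (S : Semigrp.{0}) (hS : IsIndicatorBurnside S) :
    IsFinitelyBased (varietyGeneratedBy.{u} S) := by
  cases hS with
  | A => exact hasFiniteBasis_A.isFinitelyBased
  | B => exact hasFiniteBasis_B.isFinitelyBased
  | Clam => exact hasFiniteBasis_Clam.isFinitelyBased
  | Crho => exact hasFiniteBasis_Crho.isFinitelyBased
  | N3 => exact hasFiniteBasis_N3.isFinitelyBased
  | D => exact hasFiniteBasis_D.isFinitelyBased
  | K n hn => exact (hasFiniteBasis_K hn).isFinitelyBased
  | Flam => exact hasFiniteBasis_Flam.isFinitelyBased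
  | Frho => exact hasFiniteBasis_Frho.isFinitelyBased
  | Wlam => exact hasFiniteBasis_Wlam.isFinitelyBased
  | Wrho => exact hasFiniteBasis_Wrho.isFinitelyBased
  | L21 => exact hasFiniteBasis_L21.isFinitelyBased
  | R21 => exact hasFiniteBasis_R21.isFinitelyBased
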